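/- Write $\lg=\log_2$. On a BSP computer with parameters $p,L,g$, a superstep in which every processor performs at most $x$ basic operations and sends or receives at most $h$ words contributes $x$ to the computation time and $\max\{L,gh\}$ to the communication time (which thus carries all terms involving $L$). Charges for computation: $m\lg m$ for sorting $m$ keys, $m\lg q$ for merging $q$ sorted lists of total size $m$, $\lceil\lg(m+1)\rceil$ for a binary search in a sorted list of $m$ keys, and $1$ for each random draw, each selection of a sample key and each splitter received; moving data is charged as communication only. The comparing sequential algorithm takes time $n\lg n$, so for an algorithm with computation time $\mathcal C$ and communication time $\mathcal M$ on an input of $n$ keys, $\pi=p\,\mathcal C/(n\lg n)$ and $\mu=p\,\mathcal M/(n\lg n)$. Algorithm Sort_IRan_BSP, with parameter $\omega_n$, sorts $n$ distinct keys, of which each of the $p$ processors initially holds at most $\lceil n/p\rceil$, as follows. Let $s=\lceil 2\omega_n^2\lg n\rceil$. (1) Each processor sorts its keys. (2) A uniformly random sample of $sp-1$ distinct positions of the input is drawn; each processor makes $s$ of these draws (the last one $s-1$), requests the keys drawn from their owners, receives them, and sorts its block of the sample. (3) The sample is sorted by Batcher's bitonic sorter on $p$ lines (the first $p$ lines of the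 sorter on $2^{\lceil\lg p\rceil}$ lines, all comparators directed towards the lower-numbered line), where a comparator acts on blocks: the two processors exchange their blocks, merge them, and keep the lower $s$ keys and the rest, respectively. (4) The $p-1$ splitters, of ranks $s,2s,\dots,(p-1)s$ in the sorted sample, are sent to processor $0$ and broadcast by pipelining along a complete binary tree on the processors. (5) Each processor partitions its sorted keys into $p$ subsequences by a binary search of each splitter, sends the $i$-th subsequence to processor $i$ for all $i$, and merges the $p$ sorted sequences that it receives. **Proposition.** There are constants $C,\rho>0$ and $n_0$ such that the following holds for all integers $n\ge n_0$, $p\ge 2$, all real $\omega_n\ge 1$, $L\ge 0$, $g\ge 0$ with $$2p\,\omega_n^2\lg n<\frac n2,\qquad p^2\le\frac{n}{\omega_n\lg n},\qquad L\le\frac{2n}{p\lg^2p},$$ and every such input of $n$ distinct keys from a linearly ordered set: with probability at least $1-n^{-\rho}$ over the random sample, Sort_IRan_BSP satisfies both $$\pi\le 1+\frac{\lg p}{\omega_n\lg n}+\frac{2p\,\omega_n^2\lg^2p}{n}+C\left(\frac1{\omega_n\lg n}+\frac{\omega_n^{3/2}\lg p}{\sqrt{n\lg n}}\right)$$ and $$\mu\le\Bigl(1+\frac1{\omega_n}\Bigr)\frac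 g{\lg n}+\frac{g\,p\,\omega_n^2\lg^2p}{n}+\frac{L\,p\lg^2p}{2n\lg n}+C\left(\frac1{\lg p\,\lg n}+\frac{g\,\omega_n^{3/2}\lg p}{\sqrt{n\lg n}}+\frac g{\omega_n\lg^2n}\right).$$ -/

import Mathlib

/-! ## The bulk-synchronous parallel machine -/

universe u

namespace BSP

/-- The logarithm to base `2`. -/
noncomputable def lg (x : ℝ) : ℝ := Real.logb 2 x

/-- The result of a local computation, with the time charged for it. -/
structure Charged (α : Type*) where
  val : α
  time : ℝ

/-- A task local to each processor: from the processor's number, its memory and the words that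
arrived from each processor at the end of the previous superstep, to its new memory. -/
abbrev Task (p : ℕ) (S W : Type*) := Fin p → S → (Fin p → List W) → Charged S

/-- What processor `k`, with memory `m`, sends to processor `j`, as a list of words. -/
abbrev Sends (p : ℕ) (S W : Type*) := Fin p → S → Fin p → List W

/-- A superstep: local computation on data available before the superstep started, and message
transmissions; the messages can be used from the next superstep on. -/
structure Superstep (p : ℕ) (S W : Type*) where
  compute : Task p S W
  send : Sends p S W

/-- The local memories, and the words `inbox k j` waiting at `k` that were sent by `j`. -/
structure Config (p : ℕ) (S W : Type*) where
  mem : Fin p → S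
  inbox : Fin p → Fin p → List W

section Machine

variable {p : ℕ} {S W : Type*}

/-- Processor memories after the local computation of a superstep. -/
def Superstep.mem (σ : Superstep p S W) (c : Config p S W) (k : Fin p) : S :=
  (σ.compute k (c.mem k) (c.inbox k)).val

/-- The configuration after a superstep. -/
def Superstep.next (σ : Superstep p S W) (c : Config p S W) : Config p S W where
  mem := σ.mem c
  inbox := fun k j => σ.send j (σ.mem c j) k

/-- `x`: the maximum local computation time over the processors in a superstep. -/
noncomputable def Superstep.work (σ : Superstep p S W) (c : Config p S W) : ℝ :=
  ⨆ k : Fin p, (σ.compute k (c.mem k) (c.inbox k)).time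

/-- `h`: the maximum number of words sent or received by a processor in a superstep. -/
def Superstep.relation (σ : Superstep p S W) (c : Config p S W) : ℕ :=
  Finset.univ.sup fun k : Fin p =>
    max (∑ j, (σ.send k (σ.mem c k) j).length) (∑ j, (σ.send j (σ.mem c j) k).length)

/-- The configuration after the execution of a list of supersteps. -/
def run : List (Superstep p S W) → Config p S W → Config p S W
  | [], c => c
  | σ :: r, c => run r (σ.next c)

/-- Computation time: the sum of `x` over the supersteps. -/
noncomputable def compTime : List (Superstep p S W) → Config p S W → ℝ
  | [], _ => 0
  | σ :: r, c => σ.work c + compTime r (σ.next c)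

/-- Communication time: the sum of `max {L, g h}` over the supersteps (all terms that involve `L`
are part of the communication time; `max {L, x + g h} ≤ x + max {L, g h}`). -/
noncomputable def commTime (L g : ℝ) : List (Superstep p S W) → Config p S W → ℝ
  | [], _ => 0
  | σ :: r, c => max L (g * σ.relation c) + commTime L g r (σ.next c)

/-- A communication followed by the processing of the messages received. -/
structure Round (p : ℕ) (S W : Type*) where
  send : Sends p S W
  compute : Task p S W

/-- A first local computation followed by rounds, cut into supersteps at the points where messages
have to be delivered. -/
def supersteps : Task p S W → List (Round p S W) → List (Superstep p S W)
  | c, [] => [⟨c, fun _ _ _ => []⟩]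
  | c, r :: rs => ⟨c, r.send⟩ :: supersteps r.compute rs

end Machine

/-! ## Charged sequential operations -/

section Sequential

variable {K : Type*} [LinearOrder K]

/-- Sequential sorting of `m` keys, charged `m lg m`. -/
noncomputable def sortSeq (l : List K) : Charged (List K) where
  val := l.mergeSort (fun a b => decide (a ≤ b))
  time := l.length * lg l.length

/-- Merging of `q` sorted lists of total size `m`, charged `m lg q`. -/
noncomputable def mergeSeq (ls : List (List K)) : Charged (List K) where
  val := ls.foldr (fun a b => List.merge a b (fun x y => decide (x ≤ y))) []
  time := ls.flatten.length * lg ls.length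

/-- Binary search of `y` in a sorted list of length `m`: the number of its elements below `y`,
charged `⌈lg (m + 1)⌉`. -/
noncomputable def binSearch (l : List K) (y : K) : Charged ℕ where
  val := l.countP (fun x => decide (x < y))
  time := ⌈lg (l.length + 1)⌉₊

end Sequential

/-! ## The algorithm `Sort_IRan_BSP` -/

namespace IRan

/-- A word is a key or an index into a local array. -/
inductive Word (K : Type*)
  | key (x : K)
  | idx (i : ℕ)

/-- The keys in a message. -/
def keysOf {K : Type*} (w : List (Word K)) : List K :=
  w.filterMap fun a => match a with
    | .key x => some x
    | .idx _ => none

/-- The indices in a message. -/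
def idxsOf {K : Type*} (w : List (Word K)) : List ℕ :=
  w.filterMap fun a => match a with
    | .key _ => none
    | .idx i => some i

/-- Local memory of a processor. -/
structure Mem (p : ℕ) (K : Type*) where
  /-- the local part of the sequence that is sorted -/
  keys : List K
  /-- the local keys selected on the request of each processor -/
  selected : Fin p → List K
  /-- the local block of the sample -/
  sample : List K
  /-- the splitters known so far -/
  splitters : List K
  /-- the segment of splitters received last during the broadcast -/
  relay : List K
  /-- the subsequences of the local keys that are induced by the splitters -/
  buckets : Fin p → List K

section Algorithm

variable {K : Type*} [LinearOrder K] (p s : ℕ)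

/-- The draws made by processor `k`: number `j` is made by processor `⌊j / s⌋`, so that each
processor makes `s` draws, and the last one `s - 1`. A draw is a processor and a local index. -/
def drawsOf (draw : Fin (s * p - 1) → Fin p × ℕ) (k : Fin p) : List (Fin p × ℕ) :=
  ((List.finRange (s * p - 1)).filter fun j => j.val / s == k.val).map draw

/-- Local sorting, and the random draws (unit time each). -/
noncomputable def localSort (draw : Fin (s * p - 1) → Fin p × ℕ) : Task p (Mem p K) (Word K) :=
  fun k m _ =>
    ⟨{ m with keys := (sortSeq m.keys).val },
      (sortSeq m.keys).time + (drawsOf p s draw k).length⟩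

/-- Each draw is sent to the processor drawn, which selects the key (unit time each). -/
noncomputable def requestRound (draw : Fin (s * p - 1) → Fin p × ℕ) :
    Round p (Mem p K) (Word K) where
  send := fun k _ j =>
    ((drawsOf p s draw k).filter fun d => d.1 == j).map fun d => Word.idx d.2
  compute := fun _ m inbox =>
    ⟨{ m with selected := fun j => (idxsOf (inbox j)).filterMap fun i => m.keys[i]? },
      ∑ j, ((idxsOf (inbox j)).length : ℝ)⟩

/-- The selected keys are returned; each processor sorts its block of the sample. -/
noncomputable def replyRound : Round p (Mem p K) (Word K) where
  send := fun _ m j => (m.selected j).map Word.key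
  compute := fun _ m inbox =>
    let r := sortSeq ((List.finRange p).flatMap fun j => keysOf (inbox j))
    ⟨{ m with sample := r.val }, r.time⟩

/-- The comparator stages of Batcher's bitonic sorter on `2 ^ t` lines, in the form in which each
comparator leaves the minimum on the line with the lower number. Line `i` is compared with the line
whose number is the bitwise exclusive or of `i` and the entry of the list. For `a = 1, …, t`, a
merge of pairs of sorted runs of `2 ^ (a - 1)` lines consists of a comparison of mirror images
in groups of `2 ^ a` lines, followed by the distances `2 ^ (a - 2), …, 2, 1`. -/
def bitonicStages (t : ℕ) : List ℕ :=
  (List.range t).flatMap fun a => (2 ^ (a + 1) - 1) :: ((List.range a).reverse.map (2 ^ ·))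

/-- One stage of the bitonic sorter on sorted blocks: partners exchange their blocks of the sample,
merge them, and keep the lower `s` keys and the rest, respectively. The lines
`p, p + 1, …` are absent (they would hold infinite keys). -/
noncomputable def exchangeRound (μ : ℕ) : Round p (Mem p K) (Word K) where
  send := fun k m j => if j.val = k.val ^^^ μ then m.sample.map Word.key else []
  compute := fun k m inbox =>
    if h : k.val ^^^ μ < p then
      let r := mergeSeq [m.sample, keysOf (inbox ⟨k.val ^^^ μ, h⟩)]
      ⟨{ m with sample := if k.val < k.val ^^^ μ then r.val.take s else r.val.drop s }, r.time⟩
    else ⟨m, 0⟩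

/-- The splitters are the keys of rank `s, 2 s, …, (p - 1) s` in the sorted sample, that is, the
last keys of the blocks of the processors `0, …, p - 2`. They are collected by processor `0`. -/
noncomputable def gatherRound : Round p (Mem p K) (Word K) where
  send := fun k m j =>
    if j.val = 0 ∧ k.val + 1 < p then m.sample.getLast?.toList.map Word.key else []
  compute := fun k m inbox =>
    if k.val = 0 then
      let r := (List.finRange p).flatMap fun j => keysOf (inbox j)
      ⟨{ m with splitters := r }, r.length⟩
    else ⟨m, 0⟩

/-- Depth of the complete binary tree on the nodes `0, …, p - 1`, in which the children of `k` are
`2 k + 1` and `2 k + 2`. -/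
def treeDepth : ℕ := Nat.log 2 p

/-- Length of the segments into which the `p - 1` splitters are cut for the broadcast. -/
def segment : ℕ := (p - 1) ⌈/⌉ treeDepth p

/-- One superstep of the pipelined broadcast along the binary tree: the root sends segment number
`τ` to its children, the others pass on the segment they received last. -/
noncomputable def broadcastRound (τ : ℕ) : Round p (Mem p K) (Word K) where
  send := fun k m j =>
    if j.val = 2 * k.val + 1 ∨ j.val = 2 * k.val + 2 then
      (if k.val = 0 then (m.splitters.drop (τ * segment p)).take (segment p) else m.relay).map
        Word.key
    else []
  compute := fun k m inbox =>
    if k.val = 0 then ⟨m, 0⟩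
    else
      let r := (List.finRange p).flatMap fun j => keysOf (inbox j)
      ⟨{ m with splitters := m.splitters ++ r, relay := r }, r.length⟩

/-- Each processor partitions its sorted keys by a binary search of each splitter: subsequence `0`
has the keys below the first splitter, subsequence `j` those that are at least splitter number `j`
and below splitter number `j + 1`. -/
noncomputable def partitionRound : Round p (Mem p K) (Word K) where
  send := fun _ _ _ => []
  compute := fun _ m _ =>
    let cuts := m.splitters.map fun y => (binSearch m.keys y).val
    let first : ℕ → ℕ := fun j => (0 :: cuts)[j]?.getD m.keys.length
    ⟨{ m with buckets := fun j =>
          (m.keys.drop (first j.val)).take (first (j.val + 1) - first j.val) },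
      (m.splitters.map fun y => (binSearch m.keys y).time).sum⟩

/-- The keys are routed, and each processor merges the `p` sorted sequences it receives. -/
noncomputable def routeRound : Round p (Mem p K) (Word K) where
  send := fun _ m j => (m.buckets j).map Word.key
  compute := fun _ m inbox =>
    let r := mergeSeq ((List.finRange p).map fun j => keysOf (inbox j))
    ⟨{ m with keys := r.val }, r.time⟩

/-- The algorithm `Sort_IRan_BSP` on `p` processors with oversampling factor `s`, for given
outcomes of the random draws. -/
noncomputable def algorithm (draw : Fin (s * p - 1) → Fin p × ℕ) :
    List (Superstep p (Mem p K) (Word K)) :=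
  supersteps (localSort p s draw)
    ([requestRound p s draw, replyRound p]
      ++ (bitonicStages (Nat.clog 2 p)).map (exchangeRound p s)
      ++ [gatherRound p]
      ++ (List.range ((p - 1) ⌈/⌉ segment p + treeDepth p - 1)).map (broadcastRound p)
      ++ [partitionRound p, routeRound p])

end Algorithm

/-- Initially processor `k` holds the keys `X k` and nothing else. -/
def initial {p : ℕ} {K : Type*} (X : Fin p → List K) : Config p (Mem p K) (Word K) where
  mem := fun k => ⟨X k, fun _ => [], [], [], [], fun _ => []⟩
  inbox := fun _ _ => []

/-- The possible outcomes of the sampling: sequences of `s p - 1` distinct positions of the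
input. -/
abbrev Draws {p : ℕ} {K : Type*} (X : Fin p → List K) (s : ℕ) :=
  Fin (s * p - 1) ↪ (Σ k : Fin p, Fin (X k).length)

/-- The draws as pairs of a processor and a local index. -/
def Draws.pairs {p : ℕ} {K : Type*} {X : Fin p → List K} {s : ℕ} (d : Draws X s) :
    Fin (s * p - 1) → Fin p × ℕ :=
  fun j => ((d j).1, (d j).2.val)

section Ratios

variable {K : Type*} [LinearOrder K] {p : ℕ}

/-- `π`: computation time over the time `n lg n / p` of an optimal sequential algorithm spread over
the `p` processors. -/
noncomputable def piRatio (n s : ℕ) (X : Fin p → List K) (d : Draws X s) : ℝ :=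
  p * compTime (algorithm p s d.pairs) (initial X) / (n * lg n)

/-- `μ`: communication time over `n lg n / p`. -/
noncomputable def muRatio (L g : ℝ) (n s : ℕ) (X : Fin p → List K) (d : Draws X s) : ℝ :=
  p * commTime L g (algorithm p s d.pairs) (initial X) / (n * lg n)

/-- The input consists of `n` distinct keys, of which each processor holds at most `⌈n / p⌉`. -/
structure IsInput (n : ℕ) (X : Fin p → List K) : Prop where
  total : ∑ k, (X k).length = n
  even : ∀ k, (X k).length ≤ n ⌈/⌉ p
  distinct : ((List.finRange p).flatMap X).Nodup

end Ratios

/-- The oversampling factor `2 ω² lg n`, rounded up to an integer. -/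
noncomputable def oversampling (ω : ℝ) (n : ℕ) : ℕ := ⌈2 * ω ^ 2 * lg n⌉₊

end IRan

/-- The probability of an event under the uniform distribution on a finite set. -/
noncomputable def uniformProb {Ω : Type*} (E : Set Ω) : ℝ := (E.ncard : ℝ) / Nat.card Ω

end BSP

/-! Two random events decide the cost; the rest is deterministic. Suppose that no processor owns `4
s` or more of the drawn positions, and that every order-connected set of keys with at most `s`
sample keys has fewer than `B` keys, where `B = span + cell` is about `(1 + 1/ω) n / p`. Then every
round has a bounded cost (`cost_le`), and inserting the bounds into the two ratios is arithmetic
(`comp_ratio_le`, `comm_ratio_le`). Only cost is claimed, so the last round is analysed without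
showing that its output is sorted.

Deterministic part. The bound `B` applies to a bucket once the bucket is known to hold at most `s`
sample keys, and this needs the sample to be really sorted by a network that acts on blocks, with
absent lines and a short last block. For a threshold `y`, only the number of keys below `y` in each
block matters, and a comparator acts on these numbers by `countStage`. A 0-1 principle for blocks
follows: a full block reads as a one, an empty one as a zero, a mixed one as either, and every
reading of the output of a comparator comes from a reading of its input
(`exists_represents_bitStage`). An unsorted output would have an unsorted reading, although the
network sorts bits. Rounds are chained by `Within`, a Hoare triple that carries both costs.

Probability. The generating function of the number of hits without repetition is at most the
binomial one (`sum_pow_hits_le`), so Chernoff bounds hold. Long intervals reduce to about `n / cell`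
aligned rank blocks of length `span`. With deviation `1/ω` and `s ≥ 2 ω² lg n`, a fixed block fails
with probability at most `exp (-(lg n) ω / (ω + 1))`, there are `O(p ω lg n)` blocks, and the union
bound gives `n ^ (-0.15)`. Too many requests at one processor have probability at most `2 ^ (-s) ≤ n
^ (-2)`.

Arithmetic. Local sorting contributes `1 - lg p / lg n` and the final merge `(1 + 1/ω) lg p / lg n`,
up to error terms, with sum `1 + lg p / (ω lg n)`. The roughly `lg² p / 2` stages of the sorter,
each with work `2 s` and `s` words, give the terms with `p ω² lg² p / n`. The hypothesis `p² ≤ n /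
(ω lg n)` absorbs the handling of the splitters and turns `p ω² / n` into `ω ^ (3/2) / √(n lg n)`.
-/

namespace BSP

open Finset

/-! ### Tail bounds for sampling without repetition -/

section Sampling

variable {P : Type*} [DecidableEq P]

/-- The number of draws that fall into `A`. -/
def hits {N : ℕ} (A : Finset P) (f : Fin N ↪ P) : ℕ := #{i | f i ∈ A}

theorem hits_le_card {N : ℕ} (A : Finset P) (f : Fin N ↪ P) : hits A f ≤ #A := by
  unfold hits
  exact Finset.card_le_card_of_injOn f (fun i hi => by simpa using hi) f.injective.injOn

theorem card_filter_mem_range {N : ℕ} (A : Finset P) (f : Fin N ↪ P) :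
    #{x ∈ A | x ∈ Set.range f} = hits A f := by
  symm
  unfold hits
  refine Finset.card_bij (fun i _ => f i) ?_ ?_ ?_
  · intro i hi
    simpa using hi
  · intro i _ j _ h
    exact f.injective h
  · intro x hx
    obtain ⟨h1, i, rfl⟩ := by simpa using hx
    exact ⟨i, by simpa using h1, rfl⟩

theorem hits_symm_embeddingFinSucc {N : ℕ} (A : Finset P)
    (q : Σ e : Fin N ↪ P, {x // x ∉ Set.range e}) :
    hits A ((Equiv.embeddingFinSucc N P).symm q) = hits A q.1 + if q.2.1 ∈ A then 1 else 0 := by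
  unfold hits
  rw [Finset.card_filter, Finset.card_filter, Fin.sum_univ_succ]
  simp [add_comm]

theorem card_notMem_range {N : ℕ} (A : Finset P) (f : Fin N ↪ P) :
    (#{x ∈ A | x ∉ Set.range f} : ℝ) = #A - hits A f := by
  have h := Finset.card_filter_add_card_filter_not (s := A) (fun x => x ∈ Set.range f)
  rw [card_filter_mem_range] at h
  rw [← h]
  push_cast
  ring

variable [Fintype P]

theorem hits_univ {N : ℕ} (f : Fin N ↪ P) : hits univ f = N := by
  simp [hits]

/-- Drawing one more position without repetition. -/
theorem sum_hits_succ {N : ℕ} (A : Finset P) (F : ℕ → ℝ) :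
    ∑ g : Fin (N + 1) ↪ P, F (hits A g) =
      ∑ f : Fin N ↪ P, ((Fintype.card P - N - (#A - hits A f)) * F (hits A f)
        + (#A - hits A f) * F (hits A f + 1)) := by
  rw [← Equiv.sum_comp (Equiv.embeddingFinSucc N P).symm, Fintype.sum_sigma]
  refine Finset.sum_congr rfl fun f _ => ?_
  -- Given the first `N` draws, the new one changes the count only if it is one of the `#A - hits A
  -- f` free elements of `A`.
  have h1 : ∀ x : {x // x ∉ Set.range f},
      F (hits A ((Equiv.embeddingFinSucc N P).symm ⟨f, x⟩)) =
        F (hits A f) + (if x.1 ∈ A then F (hits A f + 1) - F (hits A f) else 0) := by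
    intro x
    rw [hits_symm_embeddingFinSucc]
    split_ifs <;> simp
  simp only [h1]
  rw [← Finset.sum_subtype ({x | x ∉ Set.range f} : Finset P) (by simp)
    (fun x => F (hits A f) + (if x ∈ A then F (hits A f + 1) - F (hits A f) else 0)),
    Finset.sum_add_distrib, ← Finset.sum_filter, Finset.sum_const, Finset.sum_const,
    Finset.filter_filter]
  have h2 : ({x | x ∉ Set.range f ∧ x ∈ A} : Finset P) = {x ∈ A | x ∉ Set.range f} := by
    ext x; simp [and_comm]
  rw [h2, nsmul_eq_mul, nsmul_eq_mul, card_notMem_range, card_notMem_range, hits_univ,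
    Finset.card_univ]
  ring

/-- The case of a constant function in `sum_hits_succ`. No bound on `N` is needed: both sides vanish
from `N = Fintype.card P` on. -/
theorem card_embedding_succ (N : ℕ) :
    (Fintype.card (Fin (N + 1) ↪ P) : ℝ) =
      Fintype.card (Fin N ↪ P) * (Fintype.card P - N) := by
  have h := sum_hits_succ (N := N) (∅ : Finset P) (fun _ => 1)
  simp only [Finset.sum_const, Finset.card_univ, nsmul_eq_mul, mul_one, hits] at h
  rw [h]
  simp
  ring

/-- The expected number of hits. -/
theorem sum_hits {N : ℕ} (A : Finset P) :
    ∑ f : Fin N ↪ P, (hits A f : ℝ) =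
      Fintype.card (Fin N ↪ P) * (N * (#A / Fintype.card P)) := by
  rcases Nat.eq_zero_or_pos (Fintype.card P) with h0 | hpos
  · have hA : ∀ f : Fin N ↪ P, hits A f = 0 := fun f =>
      Nat.le_zero.1 ((hits_le_card A f).trans ((Finset.card_le_univ A).trans h0.le))
    simp [hA, h0]
  have hn : (Fintype.card P : ℝ) ≠ 0 := by positivity
  induction N with
  | zero => simp [hits]
  | succ N ih =>
    rw [sum_hits_succ A (fun x => (x : ℝ)), card_embedding_succ]
    have h1 : ∀ f : Fin N ↪ P, ((Fintype.card P - N - (#A - hits A f)) * (hits A f : ℝ)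
        + (#A - hits A f) * ((hits A f + 1 : ℕ) : ℝ)) =
        (Fintype.card P - N - 1) * hits A f + #A := by
      intro f; push_cast; ring
    rw [Finset.sum_congr rfl fun f _ => h1 f, Finset.sum_add_distrib, ← Finset.mul_sum, ih,
      Finset.sum_const, Finset.card_univ, nsmul_eq_mul]
    push_cast
    field_simp
    ring

/-- Sampling without repetition is at most as spread as sampling with repetition. -/
theorem sum_pow_hits_le {N : ℕ} (A : Finset P) {z : ℝ} (hz : 1 ≤ z) :
    ∑ f : Fin N ↪ P, z ^ hits A f ≤
      Fintype.card (Fin N ↪ P) * (1 + (z - 1) * (#A / Fintype.card P)) ^ N := by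
  induction N with
  | zero => simp [hits]
  | succ N ih =>
    rcases Nat.eq_zero_or_pos (Fintype.card (Fin (N + 1) ↪ P)) with h0 | hpos
    · have := Fintype.card_eq_zero_iff.1 h0
      simp
    have hNP : N + 1 ≤ Fintype.card P := by
      obtain ⟨e⟩ := Fintype.card_pos_iff.1 hpos
      simpa using Fintype.card_le_of_embedding e
    have hNP' : (N : ℝ) + 1 ≤ Fintype.card P := by exact_mod_cast hNP
    have hn : (Fintype.card P : ℝ) ≠ 0 := by
      have : (0 : ℝ) ≤ N := Nat.cast_nonneg N
      linarith
    have hcN : (0 : ℝ) < Fintype.card (Fin N ↪ P) := by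
      have h := card_embedding_succ (P := P) N
      have h' : (0 : ℝ) < Fintype.card (Fin (N + 1) ↪ P) := by exact_mod_cast hpos
      rw [h] at h'
      exact (pos_iff_pos_of_mul_pos h').2 (by linarith)
    set q : ℝ := #A / Fintype.card P
    have hq : 0 ≤ q := by positivity
    have hsum : ∑ f : Fin N ↪ P, ((Fintype.card P - N : ℝ) + (z - 1) * (#A - hits A f)) =
        Fintype.card (Fin N ↪ P) * ((Fintype.card P - N) * (1 + (z - 1) * q)) := by
      rw [Finset.sum_add_distrib, ← Finset.mul_sum,
        Finset.sum_sub_distrib (f := fun _ => (#A : ℝ)), sum_hits]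
      simp only [Finset.sum_const, Finset.card_univ, nsmul_eq_mul]
      simp only [q]
      field_simp
    -- The more hits so far, the fewer elements of `A` remain. Hence the two factors of the
    -- recursion are oppositely ordered, and Chebyshev's sum inequality replaces the second factor
    -- by its mean, which `sum_hits` evaluates.
    have hanti : Antivary (fun f : Fin N ↪ P => z ^ hits A f)
        (fun f => (Fintype.card P - N : ℝ) + (z - 1) * (#A - hits A f)) := by
      intro f g h
      simp only at h ⊢
      apply pow_le_pow_right₀ hz
      by_contra! hc
      have : (hits A f : ℝ) ≤ hits A g := by exact_mod_cast hc.le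
      nlinarith
    have hch := hanti.card_mul_sum_le_sum_mul_sum
    rw [hsum] at hch
    have hrec : ∑ g : Fin (N + 1) ↪ P, z ^ hits A g = ∑ f : Fin N ↪ P, z ^ hits A f *
        ((Fintype.card P - N : ℝ) + (z - 1) * (#A - hits A f)) := by
      rw [sum_hits_succ A (fun x => z ^ x)]
      refine Finset.sum_congr rfl fun f _ => ?_
      rw [pow_succ]
      ring
    rw [hrec, card_embedding_succ, pow_succ]
    have h1 : ∑ f : Fin N ↪ P, z ^ hits A f *
        ((Fintype.card P - N : ℝ) + (z - 1) * (#A - hits A f)) ≤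
        (∑ f : Fin N ↪ P, z ^ hits A f) * ((Fintype.card P - N) * (1 + (z - 1) * q)) := by
      refine le_of_mul_le_mul_left (hch.trans_eq ?_) hcN
      ring
    refine h1.trans ?_
    have h2 : 0 ≤ (Fintype.card P - N : ℝ) * (1 + (z - 1) * q) := by
      have : 0 ≤ (z - 1) * q := mul_nonneg (by linarith) hq
      exact mul_nonneg (by linarith) (by linarith)
    refine (mul_le_mul_of_nonneg_right ih h2).trans_eq ?_
    ring

theorem hits_add_hits_compl {N : ℕ} (A : Finset P) (f : Fin N ↪ P) :
    hits A f + hits Aᶜ f = N := by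
  unfold hits
  simpa using Finset.card_filter_add_card_filter_not (s := univ) (fun i => f i ∈ A)

/-- Passing to the complement of `A` turns a base `z ≤ 1` into `z⁻¹ ≥ 1`, because the hits of `A`
and of its complement add up to `N`. -/
theorem sum_pow_hits_le_of_le_one {N : ℕ} (A : Finset P) {z : ℝ} (hz : 0 < z) (hz1 : z ≤ 1)
    (hP : 0 < Fintype.card P) :
    ∑ f : Fin N ↪ P, z ^ hits A f ≤
      Fintype.card (Fin N ↪ P) * (1 - (1 - z) * (#A / Fintype.card P)) ^ N := by
  have hn : (Fintype.card P : ℝ) ≠ 0 := by positivity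
  have h := sum_pow_hits_le (N := N) Aᶜ ((one_le_inv₀ hz).2 hz1)
  have hc : (#Aᶜ : ℝ) = Fintype.card P - #A := by
    rw [Finset.card_compl, Nat.cast_sub (Finset.card_le_univ A)]
  have h1 : ∀ f : Fin N ↪ P, z ^ hits A f = z ^ N * z⁻¹ ^ hits Aᶜ f := by
    intro f
    have h2 : z ^ N = z ^ hits A f * z ^ hits Aᶜ f := by rw [← pow_add, hits_add_hits_compl]
    rw [h2, mul_assoc, ← mul_pow, mul_inv_cancel₀ hz.ne', one_pow, mul_one]
  calc ∑ f : Fin N ↪ P, z ^ hits A f = z ^ N * ∑ f : Fin N ↪ P, z⁻¹ ^ hits Aᶜ f := by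
        rw [Finset.mul_sum]; exact Finset.sum_congr rfl fun f _ => h1 f
    _ ≤ z ^ N * (Fintype.card (Fin N ↪ P) * (1 + (z⁻¹ - 1) * (#Aᶜ / Fintype.card P)) ^ N) := by
        gcongr
    _ = Fintype.card (Fin N ↪ P) * (z * (1 + (z⁻¹ - 1) * (#Aᶜ / Fintype.card P))) ^ N := by
        rw [mul_pow]; ring
    _ = _ := by
        congr 2
        rw [hc]
        field_simp
        ring

/-- Markov's inequality for `2 ^ hits`. The base `2` is crude but enough for the number of requests,
where a constant factor above the mean is allowed. -/
theorem card_hits_ge_le {N : ℕ} (A : Finset P) (r : ℕ) :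
    (#{f : Fin N ↪ P | r ≤ hits A f} : ℝ) ≤
      Fintype.card (Fin N ↪ P) * (Real.exp (N * (#A / Fintype.card P)) / 2 ^ r) := by
  have h := sum_pow_hits_le (N := N) A (z := 2) (by norm_num)
  have h1 : (#{f : Fin N ↪ P | r ≤ hits A f} : ℝ) * 2 ^ r ≤ ∑ f : Fin N ↪ P, 2 ^ hits A f := by
    rw [← nsmul_eq_mul]
    refine (Finset.card_nsmul_le_sum _ (fun f => (2 : ℝ) ^ hits A f) _ ?_).trans
      (Finset.sum_le_sum_of_subset_of_nonneg (Finset.subset_univ _) fun _ _ _ => by positivity)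
    intro f hf
    exact pow_le_pow_right₀ (by norm_num) (by simpa using hf)
  rw [← mul_div_assoc, le_div_iff₀ (by positivity)]
  refine (h1.trans h).trans ?_
  gcongr
  rw [Real.exp_nat_mul]
  gcongr
  have := Real.add_one_le_exp ((#A : ℝ) / Fintype.card P)
  linarith

/-- With `y = log (1 + x) ≥ 0`, the right-hand side is exactly `sinh y`, and `y ≤ sinh y`. -/
theorem log_one_add_le {x : ℝ} (hx : 0 ≤ x) :
    Real.log (1 + x) ≤ x - x ^ 2 / (2 * (1 + x)) := by
  have h1 : 0 ≤ Real.log (1 + x) := Real.log_nonneg (by linarith)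
  have h2 := Real.self_le_sinh_iff.2 h1
  rw [Real.sinh_log (by linarith)] at h2
  refine h2.trans_eq ?_
  have : 1 + x ≠ 0 := by positivity
  field_simp
  ring

/-- Lower Chernoff bound with the optimal base `z = 1 / (1 + e)`: the expectation of `z ^ hits` is
at most `exp (-(e s))`, and division by `z ^ s` leaves `exp (-(s (e - log (1 + e))))`. -/
theorem card_hits_le_le {N : ℕ} (A : Finset P) (s : ℕ) {e : ℝ} (he : 0 ≤ e)
    (hA : (1 + e) * s * Fintype.card P ≤ N * #A) (hP : 0 < Fintype.card P) :
    (#{f : Fin N ↪ P | hits A f ≤ s} : ℝ) ≤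
      Fintype.card (Fin N ↪ P) * Real.exp (-(s * (e ^ 2 / (2 * (1 + e))))) := by
  have hn : (0 : ℝ) < Fintype.card P := by positivity
  have he1 : 0 < 1 + e := by linarith
  set z : ℝ := (1 + e)⁻¹ with hzdef
  have hz : 0 < z := by positivity
  have hz1 : z ≤ 1 := inv_le_one_of_one_le₀ (by linarith)
  have h := sum_pow_hits_le_of_le_one (N := N) A hz hz1 hP
  have h1 : (#{f : Fin N ↪ P | hits A f ≤ s} : ℝ) * z ^ s ≤ ∑ f : Fin N ↪ P, z ^ hits A f := by
    rw [← nsmul_eq_mul]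
    refine (Finset.card_nsmul_le_sum _ (fun f => z ^ hits A f) _ ?_).trans
      (Finset.sum_le_sum_of_subset_of_nonneg (Finset.subset_univ _) fun _ _ _ => by positivity)
    intro f hf
    exact pow_le_pow_of_le_one hz.le hz1 (by simpa using hf)
  have hq : (#A : ℝ) / Fintype.card P ≤ 1 := by
    rw [div_le_one hn]; exact_mod_cast Finset.card_le_univ A
  have h2 : (1 - (1 - z) * (#A / Fintype.card P)) ^ N ≤ Real.exp (-(e * s)) := by
    have h3 : 1 - (1 - z) * ((#A : ℝ) / Fintype.card P) ≤
        Real.exp (-((1 - z) * (#A / Fintype.card P))) := by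
      have := Real.add_one_le_exp (-((1 - z) * ((#A : ℝ) / Fintype.card P)))
      linarith
    have h4 : 0 ≤ 1 - (1 - z) * ((#A : ℝ) / Fintype.card P) := by
      have : (1 - z) * ((#A : ℝ) / Fintype.card P) ≤ 1 * 1 := by
        apply mul_le_mul _ hq (by positivity) (by norm_num)
        linarith
      linarith
    refine (pow_le_pow_left₀ h4 h3 N).trans ?_
    rw [← Real.exp_nat_mul, Real.exp_le_exp]
    have h5 : (1 + e) * s ≤ N * (#A / Fintype.card P) := by
      rw [← mul_div_assoc, le_div_iff₀ hn]; exact hA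
    have h6 : (1 - z) * ((1 + e) * s) = e * s := by
      rw [hzdef]; field_simp; ring
    have h7 := mul_le_mul_of_nonneg_left h5 (sub_nonneg.2 hz1)
    linarith
  have h8 : Real.exp (-(e * s)) ≤ Real.exp (-(s * (e ^ 2 / (2 * (1 + e))))) * z ^ s := by
    have : z ^ s = Real.exp (-(s * Real.log (1 + e))) := by
      rw [hzdef, inv_pow, Real.exp_neg, Real.exp_nat_mul, Real.exp_log he1]
    rw [this, ← Real.exp_add, Real.exp_le_exp]
    have h9 := mul_le_mul_of_nonneg_left (log_one_add_le he) (Nat.cast_nonneg (α := ℝ) s)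
    linarith
  have hz2 : 0 < z ^ s := by positivity
  refine le_of_mul_le_mul_right ?_ hz2
  calc _ ≤ _ := h1.trans h
    _ ≤ Fintype.card (Fin N ↪ P) *
        (Real.exp (-(s * (e ^ 2 / (2 * (1 + e))))) * z ^ s) := by
          gcongr; exact h2.trans h8
    _ = _ := by ring

end Sampling

/-! ### Intervals with few sample points -/

section Intervals

variable {P : Type*} [Fintype P] [LinearOrder P]

/-- The elements with `a` to `b - 1` elements below them. -/
def rankIco (a b : ℕ) : Finset P :=
  (univ.filter fun i : Fin (Fintype.card P) => a ≤ i.val ∧ i.val < b).map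
    (monoEquivOfFin P rfl).toEquiv.toEmbedding

theorem card_rankIco (a b : ℕ) (h : b ≤ Fintype.card P) : #(rankIco a b : Finset P) = b - a := by
  rw [rankIco, Finset.card_map]
  rw [← Nat.card_Ico a b]
  refine Finset.card_bij (fun i _ => i.val) ?_ ?_ ?_
  · intro i hi; simpa using hi
  · intro i _ j _ h; exact Fin.ext h
  · intro x hx
    have := Finset.mem_Ico.1 hx
    exact ⟨⟨x, by omega⟩, by simpa using this, rfl⟩

/-- A long interval contains an aligned interval. -/
theorem exists_rankIco_subset {I : Set P} (hI : I.OrdConnected) {M c : ℕ} (hc : 0 < c)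
    (hM : 0 < M) (hlong : M + c ≤ I.ncard) :
    ∃ i ∈ range (Fintype.card P / c + 1), c * i + M ≤ Fintype.card P ∧
      ((rankIco (c * i) (c * i + M) : Finset P) : Set P) ⊆ I := by
  classical
  set φ := monoEquivOfFin P rfl
  set J : Finset (Fin (Fintype.card P)) := univ.filter fun i => φ i ∈ I
  have hJ : #J = I.ncard := by
    rw [← Set.ncard_coe_finset, ← Set.ncard_image_of_injective _ φ.injective]
    congr 1
    ext x
    constructor
    · rintro ⟨i, hi, rfl⟩; simpa [J] using hi
    · intro hx; exact ⟨φ.symm x, by simpa [J] using hx, by simp⟩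
  have hne : J.Nonempty := Finset.card_pos.1 (by omega)
  set a := J.min' hne
  set e := J.max' hne
  have ha : φ a ∈ I := by
    have := J.min'_mem hne; simpa [J] using this
  have hem : φ e ∈ I := by
    have := J.max'_mem hne; simpa [J] using this
  have hle : #J ≤ e.val + 1 - a.val := by
    rw [← Fin.card_Icc]
    exact Finset.card_le_card fun x hx => Finset.mem_Icc.2 ⟨J.min'_le x hx, J.le_max' x hx⟩
  have hlt := e.isLt
  have hdm := Nat.div_add_mod (a.val + c - 1) c
  have hmod := Nat.mod_lt (a.val + c - 1) hc
  -- The least rank `a` in `I` is rounded up to a multiple of `c`. This loses at most `c - 1` ranks,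
  -- so `M` consecutive ranks of `I` remain.
  refine ⟨(a.val + c - 1) / c, ?_, ?_, ?_⟩
  · rw [Finset.mem_range, Nat.lt_succ_iff]
    exact Nat.div_le_div_right (by omega)
  · omega
  · intro x hx
    simp only [rankIco, Finset.coe_map, Set.mem_image, Finset.mem_coe, Finset.mem_filter] at hx
    obtain ⟨i, ⟨-, h1, h2⟩, rfl⟩ := hx
    refine hI.out ha hem ⟨?_, ?_⟩
    · exact φ.monotone (Fin.le_def.2 (by omega))
    · exact φ.monotone (Fin.le_def.2 (by omega))

/-- With high probability, every interval with at most `s` sample points is short. -/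
theorem card_exists_long_interval_le {N : ℕ} (s M c : ℕ) {e : ℝ} (he : 0 ≤ e) (hc : 0 < c)
    (hM : 0 < M) (hP : 0 < Fintype.card P) (hA : (1 + e) * s * Fintype.card P ≤ N * M) :
    (({f : Fin N ↪ P | ∃ I : Set P, I.OrdConnected ∧ {i | f i ∈ I}.ncard ≤ s ∧
        M + c ≤ I.ncard} : Set (Fin N ↪ P)).ncard : ℝ) ≤
      (Fintype.card P / c + 1) * (Fintype.card (Fin N ↪ P) *
        Real.exp (-(s * (e ^ 2 / (2 * (1 + e)))))) := by
  classical
  set T := (range (Fintype.card P / c + 1)).filter fun i => c * i + M ≤ Fintype.card P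
  set U : Finset (Fin N ↪ P) := T.biUnion fun i =>
    {f : Fin N ↪ P | hits (rankIco (c * i) (c * i + M)) f ≤ s}
  have hsub : {f : Fin N ↪ P | ∃ I : Set P, I.OrdConnected ∧ {i | f i ∈ I}.ncard ≤ s ∧
        M + c ≤ I.ncard} ⊆ (U : Set (Fin N ↪ P)) := by
    rintro f ⟨I, hI, hs, hl⟩
    obtain ⟨i, hi, hi2, hi3⟩ := exists_rankIco_subset hI hc hM hl
    simp only [U, Finset.coe_biUnion, Set.mem_iUnion]
    refine ⟨i, by simp only [T, Finset.coe_filter, Set.mem_ofPred_eq]; exact ⟨hi, hi2⟩, ?_⟩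
    simp only [Finset.coe_filter, Finset.mem_univ, true_and, Set.mem_ofPred_eq]
    refine le_trans ?_ hs
    unfold hits
    rw [← Set.ncard_coe_finset]
    refine Set.ncard_le_ncard ?_ (Set.toFinite _)
    intro j hj
    apply hi3
    simpa using hj
  have hU : (({f : Fin N ↪ P | ∃ I : Set P, I.OrdConnected ∧ {i | f i ∈ I}.ncard ≤ s ∧
        M + c ≤ I.ncard} : Set (Fin N ↪ P)).ncard) ≤ #U := by
    rw [← Set.ncard_coe_finset]
    exact Set.ncard_le_ncard hsub (Set.toFinite _)
  have hX : (0 : ℝ) ≤ Fintype.card (Fin N ↪ P) * Real.exp (-(s * (e ^ 2 / (2 * (1 + e))))) := by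
    positivity
  calc _ ≤ (#U : ℝ) := by exact_mod_cast hU
    _ ≤ ∑ i ∈ T, (#{f : Fin N ↪ P | hits (rankIco (c * i) (c * i + M)) f ≤ s} : ℝ) := by
        exact_mod_cast Finset.card_biUnion_le
    _ ≤ ∑ i ∈ T, Fintype.card (Fin N ↪ P) * Real.exp (-(s * (e ^ 2 / (2 * (1 + e))))) := by
        refine Finset.sum_le_sum fun i hi => card_hits_le_le _ s he ?_ hP
        rw [card_rankIco _ _ (Finset.mem_filter.1 hi).2]
        simpa using hA
    _ = #T * (Fintype.card (Fin N ↪ P) * Real.exp (-(s * (e ^ 2 / (2 * (1 + e)))))) := by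
        rw [Finset.sum_const, nsmul_eq_mul]
    _ ≤ _ := by
        refine mul_le_mul_of_nonneg_right ?_ hX
        have h1 : #T ≤ Fintype.card P / c + 1 := by
          simpa using Finset.card_filter_le (range (Fintype.card P / c + 1)) _
        calc (#T : ℝ) ≤ ((Fintype.card P / c + 1 : ℕ) : ℝ) := by exact_mod_cast h1
          _ ≤ _ := by push_cast; gcongr; exact Nat.cast_div_le

/-- The same for a family of distinct elements of a linear order. -/
theorem card_exists_long_preimage_le {P K : Type*} [Fintype P] [LinearOrder K] {φ : P → K}
    (hφ : Function.Injective φ) {N : ℕ} (s M c : ℕ) {e : ℝ} (he : 0 ≤ e) (hc : 0 < c)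
    (hM : 0 < M) (hP : 0 < Fintype.card P) (hA : (1 + e) * s * Fintype.card P ≤ N * M) :
    (({f : Fin N ↪ P | ∃ I : Set K, I.OrdConnected ∧ {i | φ (f i) ∈ I}.ncard ≤ s ∧
        M + c ≤ {a | φ a ∈ I}.ncard} : Set (Fin N ↪ P)).ncard : ℝ) ≤
      (Fintype.card P / c + 1) * (Nat.card (Fin N ↪ P) *
        Real.exp (-(s * (e ^ 2 / (2 * (1 + e)))))) := by
  -- The positions are ordered by their keys, which makes preimages of intervals of keys intervals
  -- of positions.
  let _ : LinearOrder P := LinearOrder.lift' φ hφ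
  have hmono : Monotone φ := fun _ _ hab => hab
  rw [Nat.card_eq_fintype_card]
  refine le_trans (Nat.cast_le.2 (Set.ncard_le_ncard ?_ (Set.toFinite _)))
    (card_exists_long_interval_le (P := P) s M c he hc hM hP hA)
  rintro f ⟨I, hI, h1, h2⟩
  exact ⟨φ ⁻¹' I, hI.preimage_mono hmono, h1, h2⟩

end Intervals

namespace IRan

/-! ### The bitonic sorter on bits -/

/-- A mask below `2 ^ n` changes only the last `n` binary digits, so a stage with that mask stays
inside each aligned block of `2 ^ n` lines. -/
theorem mul_two_pow_add_xor {n q r x : ℕ} (hr : r < 2 ^ n) (hx : x < 2 ^ n) :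
    (q * 2 ^ n + r) ^^^ x = q * 2 ^ n + (r ^^^ x) := by
  have hpos : 0 < 2 ^ n := Nat.two_pow_pos n
  have hxor := Nat.xor_lt_two_pow hr hx
  have h1 : ((q * 2 ^ n + r) ^^^ x) / 2 ^ n = q := by
    rw [Nat.xor_div_two_pow, Nat.div_eq_of_lt hx, Nat.xor_zero, mul_comm, Nat.mul_add_div hpos,
      Nat.div_eq_of_lt hr, add_zero]
  have h2 : ((q * 2 ^ n + r) ^^^ x) % 2 ^ n = r ^^^ x := by
    rw [Nat.xor_mod_two_pow, Nat.mod_eq_of_lt hx, mul_comm, Nat.mul_add_mod, Nat.mod_eq_of_lt hr]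
  have h3 := Nat.div_add_mod ((q * 2 ^ n + r) ^^^ x) (2 ^ n)
  rw [h1, h2] at h3
  rw [← h3, mul_comm]

/-- Flipping all `n` digits is a reflection; this is why the first stage of a merge compares mirror
images. -/
theorem xor_two_pow_sub_one {n r : ℕ} (hr : r < 2 ^ n) : r ^^^ (2 ^ n - 1) = 2 ^ n - 1 - r := by
  apply Nat.eq_of_testBit_eq
  intro i
  have h : 2 ^ n - 1 - r = 2 ^ n - (r + 1) := by omega
  rw [h, Nat.testBit_two_pow_sub_succ hr, Nat.testBit_xor, Nat.testBit_two_pow_sub_one]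
  by_cases hi : i < n
  · simp [hi]
  · have : r.testBit i = false :=
      Nat.testBit_lt_two_pow (hr.trans_le (Nat.pow_le_pow_right (by norm_num) (by omega)))
    simp [hi, this]

theorem xor_two_pow_of_lt {n r : ℕ} (hr : r < 2 ^ n) : r ^^^ 2 ^ n = 2 ^ n + r := by
  have h := mul_two_pow_add_xor (q := 1) (r := 0) (Nat.two_pow_pos n) hr
  rw [one_mul, add_zero, Nat.zero_xor] at h
  rw [Nat.xor_comm, h]

theorem two_pow_add_xor_two_pow {n r : ℕ} (hr : r < 2 ^ n) : (2 ^ n + r) ^^^ 2 ^ n = r := by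
  rw [← xor_two_pow_of_lt hr, Nat.xor_xor_cancel_right]

/-- A stage of comparators on bits; the larger bit moves to the line with the lower number. -/
def bitStage (b : ℕ → Bool) (μ : ℕ) (i : ℕ) : Bool :=
  if i < i ^^^ μ then b i || b (i ^^^ μ) else b i && b (i ^^^ μ)

/-- Block number `q` of `2 ^ a` lines is sorted. -/
def BlockSorted (b : ℕ → Bool) (a q : ℕ) : Prop :=
  ∃ l ≤ 2 ^ a, ∀ r < 2 ^ a, (b (q * 2 ^ a + r) = true ↔ r < l)

/-- Block number `q` of `2 ^ a` lines is constant. -/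
def BlockConst (b : ℕ → Bool) (a q : ℕ) (v : Bool) : Prop :=
  ∀ r < 2 ^ a, b (q * 2 ^ a + r) = v

/-- Block number `q` of `2 ^ a` lines is bitonic: the ones, or the zeros, form an interval. -/
def BlockBitonic (b : ℕ → Bool) (a q : ℕ) : Prop :=
  ∃ v : Bool, ∃ l u : ℕ, ∀ r < 2 ^ a, (b (q * 2 ^ a + r) = v ↔ l ≤ r ∧ r < u)

/-- The lower half of a block is all ones and the upper half bitonic, or the upper half is all
zeros and the lower half bitonic. -/
def BlockSplit (b : ℕ → Bool) (a q : ℕ) : Prop :=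
  BlockConst b a (2 * q) true ∧ BlockBitonic b a (2 * q + 1) ∨
    BlockBitonic b a (2 * q) ∧ BlockConst b a (2 * q + 1) false

theorem bitStage_low {b : ℕ → Bool} {a q r : ℕ} (hr : r < 2 ^ a) :
    bitStage b (2 ^ a) (2 * q * 2 ^ a + r) =
      (b (2 * q * 2 ^ a + r) || b ((2 * q + 1) * 2 ^ a + r)) := by
  have hlt : r < 2 ^ (a + 1) := by rw [pow_succ]; omega
  have hlt2 : 2 ^ a < 2 ^ (a + 1) := by rw [pow_succ]; omega
  have e : 2 * q * 2 ^ a = q * 2 ^ (a + 1) := by ring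
  have e2 : (2 * q + 1) * 2 ^ a + r = q * 2 ^ (a + 1) + (2 ^ a + r) := by ring
  have h : (q * 2 ^ (a + 1) + r) ^^^ 2 ^ a = q * 2 ^ (a + 1) + (2 ^ a + r) := by
    rw [mul_two_pow_add_xor hlt hlt2, xor_two_pow_of_lt hr]
  rw [e, e2, bitStage, h, if_pos]
  omega

theorem bitStage_high {b : ℕ → Bool} {a q r : ℕ} (hr : r < 2 ^ a) :
    bitStage b (2 ^ a) ((2 * q + 1) * 2 ^ a + r) =
      (b (2 * q * 2 ^ a + r) && b ((2 * q + 1) * 2 ^ a + r)) := by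
  have hlt : 2 ^ a + r < 2 ^ (a + 1) := by rw [pow_succ]; omega
  have hlt2 : 2 ^ a < 2 ^ (a + 1) := by rw [pow_succ]; omega
  have e : 2 * q * 2 ^ a = q * 2 ^ (a + 1) := by ring
  have e2 : (2 * q + 1) * 2 ^ a + r = q * 2 ^ (a + 1) + (2 ^ a + r) := by ring
  have h : (q * 2 ^ (a + 1) + (2 ^ a + r)) ^^^ 2 ^ a = q * 2 ^ (a + 1) + r := by
    rw [mul_two_pow_add_xor hlt hlt2, two_pow_add_xor_two_pow hr]
  rw [e, e2, bitStage, h, if_neg (by omega), Bool.and_comm]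

theorem bitStage_mirror_low {b : ℕ → Bool} {a q r : ℕ} (hr : r < 2 ^ a) :
    bitStage b (2 ^ (a + 1) - 1) (2 * q * 2 ^ a + r) =
      (b (2 * q * 2 ^ a + r) || b ((2 * q + 1) * 2 ^ a + (2 ^ a - 1 - r))) := by
  have hp : 2 ^ (a + 1) = 2 * 2 ^ a := by rw [pow_succ]; omega
  have e : 2 * q * 2 ^ a = q * 2 ^ (a + 1) := by ring
  have e2 : (2 * q + 1) * 2 ^ a + (2 ^ a - 1 - r) = q * 2 ^ (a + 1) + (2 ^ (a + 1) - 1 - r) := by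
    rw [add_mul, e]; omega
  have h : (q * 2 ^ (a + 1) + r) ^^^ (2 ^ (a + 1) - 1) = q * 2 ^ (a + 1) + (2 ^ (a + 1) - 1 - r) := by
    rw [mul_two_pow_add_xor (by omega) (by omega), xor_two_pow_sub_one (by omega)]
  rw [e, e2, bitStage, h, if_pos]
  omega

theorem bitStage_mirror_high {b : ℕ → Bool} {a q r : ℕ} (hr : r < 2 ^ a) :
    bitStage b (2 ^ (a + 1) - 1) ((2 * q + 1) * 2 ^ a + r) =
      (b (2 * q * 2 ^ a + (2 ^ a - 1 - r)) && b ((2 * q + 1) * 2 ^ a + r)) := by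
  have hp : 2 ^ (a + 1) = 2 * 2 ^ a := by rw [pow_succ]; omega
  have e : 2 * q * 2 ^ a = q * 2 ^ (a + 1) := by ring
  have e2 : (2 * q + 1) * 2 ^ a + r = q * 2 ^ (a + 1) + (2 ^ a + r) := by ring
  have h : (q * 2 ^ (a + 1) + (2 ^ a + r)) ^^^ (2 ^ (a + 1) - 1) =
      q * 2 ^ (a + 1) + (2 ^ a - 1 - r) := by
    rw [mul_two_pow_add_xor (by omega) (by omega), xor_two_pow_sub_one (by omega)]
    omega
  rw [e, e2, bitStage, h, if_neg (by omega), Bool.and_comm]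

/-- The two halves of an interval in `[0, 2 m)`, placed on top of each other. -/
theorem interval_halves (m l u : ℕ) (hu : u ≤ 2 * m) :
    (∃ l' u', ∀ r < m, ((l ≤ r ∧ r < u) ∨ (l ≤ m + r ∧ m + r < u)) ∧
      ((l ≤ r ∧ r < u) ∧ (l ≤ m + r ∧ m + r < u) ↔ l' ≤ r ∧ r < u')) ∨
    (∃ l' u', ∀ r < m, ¬ ((l ≤ r ∧ r < u) ∧ (l ≤ m + r ∧ m + r < u)) ∧
      ((l ≤ r ∧ r < u) ∨ (l ≤ m + r ∧ m + r < u) ↔ l' ≤ r ∧ r < u')) ∨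
    (∃ l' u', ∀ r < m, ¬ ((l ≤ r ∧ r < u) ∧ (l ≤ m + r ∧ m + r < u)) ∧
      (¬ ((l ≤ r ∧ r < u) ∨ (l ≤ m + r ∧ m + r < u)) ↔ l' ≤ r ∧ r < u')) := by
  -- If the interval is at least as long as a half, the overlay covers everything and the doubly
  -- covered part is an interval. If it is shorter, nothing is covered twice: an interval inside one
  -- half stays an interval, and one that crosses the middle leaves an interval uncovered.
  rcases Nat.lt_or_ge u (l + m) with h1 | h1
  · rcases Nat.lt_or_ge m u with h2 | h2
    · rcases Nat.lt_or_ge l m with h3 | h3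
      · exact Or.inr (Or.inr ⟨u - m, l, fun r hr => by omega⟩)
      · exact Or.inr (Or.inl ⟨l - m, u - m, fun r hr => by omega⟩)
    · exact Or.inr (Or.inl ⟨l, u, fun r hr => by omega⟩)
  · exact Or.inl ⟨l, u - m, fun r hr => by omega⟩

/-- A bitonic block is split by the comparison of its halves. -/
theorem BlockBitonic.split {b : ℕ → Bool} {a q : ℕ} (h : BlockBitonic b (a + 1) q) :
    BlockSplit (bitStage b (2 ^ a)) a q := by
  obtain ⟨v, l, u, h⟩ := h
  have hp : 2 ^ (a + 1) = 2 ^ a + 2 ^ a := by rw [pow_succ]; omega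
  have hlow : ∀ r < 2 ^ a, (b (2 * q * 2 ^ a + r) = v ↔ l ≤ r ∧ r < u) := by
    intro r hr
    have := h r (by omega)
    rwa [show q * 2 ^ (a + 1) + r = 2 * q * 2 ^ a + r by ring] at this
  have hhigh : ∀ r < 2 ^ a, (b ((2 * q + 1) * 2 ^ a + r) = v ↔ l ≤ 2 ^ a + r ∧ 2 ^ a + r < u) := by
    intro r hr
    have := h (2 ^ a + r) (by omega)
    rwa [show q * 2 ^ (a + 1) + (2 ^ a + r) = (2 * q + 1) * 2 ^ a + r by ring] at this
  -- The bound `u` may exceed the block in the definition of a bitonic block, so it is truncated.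
  have hu : ∀ r, r < 2 ^ a → (r < u ↔ r < min u (2 * 2 ^ a)) ∧
      (2 ^ a + r < u ↔ 2 ^ a + r < min u (2 * 2 ^ a)) := fun r hr => by omega
  have key := interval_halves (2 ^ a) l (min u (2 * 2 ^ a)) (min_le_right _ _)
  have hA : ∀ r < 2 ^ a, (b (2 * q * 2 ^ a + r) = v ↔ l ≤ r ∧ r < min u (2 * 2 ^ a)) :=
    fun r hr => by rw [hlow r hr, (hu r hr).1]
  have hB : ∀ r < 2 ^ a, (b ((2 * q + 1) * 2 ^ a + r) = v ↔
      l ≤ 2 ^ a + r ∧ 2 ^ a + r < min u (2 * 2 ^ a)) :=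
    fun r hr => by rw [hhigh r hr, (hu r hr).2]
  -- The lower half becomes the disjunction and the upper half the conjunction of the two overlaid
  -- halves. Full coverage by `v` makes the half constant in which `v` wins; absence of double
  -- coverage makes the other one constant.
  rcases key with ⟨l', u', k⟩ | ⟨l', u', k⟩ | ⟨l', u', k⟩
  · cases v
    · refine Or.inr ⟨⟨false, l', u', fun r hr => ?_⟩, fun r hr => ?_⟩
      · rw [bitStage_low hr, ← (k r hr).2, ← hA r hr, ← hB r hr, Bool.or_eq_false_iff]
      · rw [bitStage_high hr, Bool.and_eq_false_iff, hA r hr, hB r hr]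
        exact (k r hr).1
    · refine Or.inl ⟨fun r hr => ?_, ⟨true, l', u', fun r hr => ?_⟩⟩
      · rw [bitStage_low hr, Bool.or_eq_true, hA r hr, hB r hr]
        exact (k r hr).1
      · rw [bitStage_high hr, ← (k r hr).2, ← hA r hr, ← hB r hr, Bool.and_eq_true]
  · cases v
    · refine Or.inl ⟨fun r hr => ?_, ⟨false, l', u', fun r hr => ?_⟩⟩
      · have := (k r hr).1
        rw [← hA r hr, ← hB r hr, ← Bool.or_eq_false_iff, Bool.not_eq_false] at this
        rw [bitStage_low hr, this]
      · rw [bitStage_high hr, ← (k r hr).2, ← hA r hr, ← hB r hr, Bool.and_eq_false_iff]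
    · refine Or.inr ⟨⟨true, l', u', fun r hr => ?_⟩, fun r hr => ?_⟩
      · rw [bitStage_low hr, ← (k r hr).2, ← hA r hr, ← hB r hr, Bool.or_eq_true]
      · have := (k r hr).1
        rw [← hA r hr, ← hB r hr, ← Bool.and_eq_true, Bool.not_eq_true] at this
        rw [bitStage_high hr, this]
  · cases v
    · refine Or.inl ⟨fun r hr => ?_, ⟨true, l', u', fun r hr => ?_⟩⟩
      · have := (k r hr).1
        rw [← hA r hr, ← hB r hr, ← Bool.or_eq_false_iff, Bool.not_eq_false] at this
        rw [bitStage_low hr, this]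
      · rw [bitStage_high hr, ← (k r hr).2, ← hA r hr, ← hB r hr, ← Bool.and_eq_false_iff,
          Bool.not_eq_false]
    · refine Or.inr ⟨⟨false, l', u', fun r hr => ?_⟩, fun r hr => ?_⟩
      · rw [bitStage_low hr, ← (k r hr).2, ← hA r hr, ← hB r hr, ← Bool.or_eq_true,
          Bool.not_eq_true]
      · have := (k r hr).1
        rw [← hA r hr, ← hB r hr, ← Bool.and_eq_true, Bool.not_eq_true] at this
        rw [bitStage_high hr, this]

/-- Two sorted blocks are split by the comparison of mirror images. -/
theorem BlockSorted.split {b : ℕ → Bool} {a q : ℕ} (h0 : BlockSorted b a (2 * q))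
    (h1 : BlockSorted b a (2 * q + 1)) : BlockSplit (bitStage b (2 ^ (a + 1) - 1)) a q := by
  obtain ⟨l, hl, h0⟩ := h0
  obtain ⟨u, hu, h1⟩ := h1
  -- `l + u` is the number of ones in both blocks, which after reflection sit at opposite ends. If
  -- they do not meet, the upper half loses all its ones; otherwise the lower half becomes all ones.
  rcases Nat.lt_or_ge (l + u) (2 ^ a) with h | h
  · refine Or.inr ⟨⟨false, l, 2 ^ a - u, fun r hr => ?_⟩, fun r hr => ?_⟩
    · have k0 := h0 r hr
      have k1 := h1 (2 ^ a - 1 - r) (by omega)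
      rw [bitStage_mirror_low hr, Bool.or_eq_false_iff, ← Bool.not_eq_true, ← Bool.not_eq_true,
        k0, k1]
      omega
    · have k0 := h0 (2 ^ a - 1 - r) (by omega)
      have k1 := h1 r hr
      rw [bitStage_mirror_high hr, ← Bool.not_eq_true, Bool.and_eq_true, k0, k1]
      omega
  · refine Or.inl ⟨fun r hr => ?_, ⟨true, 2 ^ a - l, u, fun r hr => ?_⟩⟩
    · have k0 := h0 r hr
      have k1 := h1 (2 ^ a - 1 - r) (by omega)
      rw [bitStage_mirror_low hr, Bool.or_eq_true, k0, k1]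
      omega
    · have k0 := h0 (2 ^ a - 1 - r) (by omega)
      have k1 := h1 r hr
      rw [bitStage_mirror_high hr, Bool.and_eq_true, k0, k1]
      omega

/-- Partners lie in the same block because `μ < 2 ^ a`, and a comparator does nothing to equal bits.
-/
theorem BlockConst.bitStage {b : ℕ → Bool} {a q : ℕ} {v : Bool} (h : BlockConst b a q v) {μ : ℕ}
    (hμ : μ < 2 ^ a) : BlockConst (bitStage b μ) a q v := by
  intro r hr
  have h1 := h r hr
  have h2 := h (r ^^^ μ) (Nat.xor_lt_two_pow hr hμ)
  rw [← mul_two_pow_add_xor hr hμ] at h2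
  rw [IRan.bitStage, h1, h2]
  simp

/-- The comparisons at the distances `2 ^ (a - 1), …, 2, 1`. -/
def halvings (a : ℕ) : List ℕ := (List.range a).reverse.map (2 ^ ·)

theorem halvings_succ (a : ℕ) : halvings (a + 1) = 2 ^ a :: halvings a := by
  simp [halvings, List.range_succ]

theorem BlockConst.foldl {b : ℕ → Bool} {a q : ℕ} {v : Bool} (h : BlockConst b a q v) {l : List ℕ}
    (hl : ∀ μ ∈ l, μ < 2 ^ a) : BlockConst (l.foldl IRan.bitStage b) a q v := by
  induction l generalizing b with
  | nil => exact h
  | cons μ l ih =>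
    exact ih (h.bitStage (hl μ (by simp))) fun x hx => hl x (by simp [hx])

theorem halvings_lt {a μ : ℕ} (h : μ ∈ halvings a) : μ < 2 ^ a := by
  simp only [halvings, List.mem_map, List.mem_reverse, List.mem_range] at h
  obtain ⟨x, hx, rfl⟩ := h
  exact Nat.pow_lt_pow_right (by norm_num) hx

/-- The recursion step of both kinds of merge: later stages keep the constant half and sort the
bitonic half. Constant ones followed by a sorted half, or a sorted half followed by constant zeros,
are sorted. -/
theorem BlockSplit.sorted_of {b b' : ℕ → Bool} {a q : ℕ} (h : BlockSplit b a q)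
    (hc : ∀ q v, BlockConst b a q v → BlockConst b' a q v)
    (hs : ∀ q, BlockBitonic b a q → BlockSorted b' a q) : BlockSorted b' (a + 1) q := by
  have hp : 2 ^ (a + 1) = 2 ^ a + 2 ^ a := by rw [pow_succ]; omega
  have e : ∀ r, q * 2 ^ (a + 1) + r = 2 * q * 2 ^ a + r := fun r => by ring
  have e2 : ∀ r, 2 ^ a ≤ r → q * 2 ^ (a + 1) + r = (2 * q + 1) * 2 ^ a + (r - 2 ^ a) := by
    intro r hr
    obtain ⟨x, rfl⟩ := Nat.exists_eq_add_of_le hr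
    rw [Nat.add_sub_cancel_left]; ring
  rcases h with ⟨h0, h1⟩ | ⟨h0, h1⟩
  · have k0 := hc _ _ h0
    obtain ⟨l, hl, k1⟩ := hs _ h1
    refine ⟨2 ^ a + l, by omega, fun r hr => ?_⟩
    rcases Nat.lt_or_ge r (2 ^ a) with hr' | hr'
    · rw [e, k0 r hr']; simp; omega
    · rw [e2 r hr', k1 _ (by omega)]; omega
  · have k1 := hc _ _ h1
    obtain ⟨l, hl, k0⟩ := hs _ h0
    refine ⟨l, by omega, fun r hr => ?_⟩
    rcases Nat.lt_or_ge r (2 ^ a) with hr' | hr'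
    · rw [e, k0 r hr']
    · rw [e2 r hr', k1 _ (by omega)]; simp; omega

/-- Each comparison at half distance leaves one half constant and the other bitonic, so the
remaining halvings finish by induction. -/
theorem BlockBitonic.foldl_halvings {b : ℕ → Bool} {a q : ℕ} (h : BlockBitonic b a q) :
    BlockSorted ((halvings a).foldl bitStage b) a q := by
  induction a generalizing b q with
  | zero =>
    by_cases hb : b (q * 2 ^ 0 + 0) = true
    · exact ⟨1, by simp, fun r hr => by
        obtain rfl : r = 0 := by simpa using hr
        simpa [halvings] using hb⟩
    · exact ⟨0, by simp, fun r hr => by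
        obtain rfl : r = 0 := by simpa using hr
        simpa [halvings] using hb⟩
  | succ a ih =>
    rw [halvings_succ, List.foldl_cons]
    exact h.split.sorted_of (fun q v hc => hc.foldl fun μ hμ => halvings_lt hμ)
      fun q hb => ih hb

/-- The bitonic sorter sorts bits. -/
theorem foldl_bitonicStages_sorted (b : ℕ → Bool) (t q : ℕ) :
    BlockSorted ((bitonicStages t).foldl bitStage b) t q := by
  induction t generalizing q with
  | zero =>
    exact BlockBitonic.foldl_halvings (a := 0) ⟨b q, 0, 1, fun r hr => by
      obtain rfl : r = 0 := by simpa using hr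
      simp⟩
  | succ t ih =>
    have : bitonicStages (t + 1) = bitonicStages t ++ (2 ^ (t + 1) - 1) :: halvings t := by
      simp [bitonicStages, List.range_succ, halvings]
    rw [this, List.foldl_append, List.foldl_cons]
    exact ((ih _).split (ih _)).sorted_of (fun q v hc => hc.foldl fun μ hμ => halvings_lt hμ)
      fun q hb => hb.foldl_halvings

/-- A zero mask would compare a line with itself; excluding it gives every line a partner different
from itself. -/
theorem bitonicStages_ne_zero {t μ : ℕ} (h : μ ∈ bitonicStages t) : μ ≠ 0 := by
  simp only [bitonicStages, List.mem_flatMap, List.mem_cons, List.mem_map] at h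
  obtain ⟨a, -, h | ⟨x, -, h⟩⟩ := h
  · have := Nat.one_lt_two_pow (n := a + 1) (by omega)
    omega
  · rw [← h]; exact (Nat.two_pow_pos x).ne'

theorem length_bitonicStages (t : ℕ) : (bitonicStages t).length * 2 = t * (t + 1) := by
  induction t with
  | zero => simp [bitonicStages]
  | succ t ih =>
    have : bitonicStages (t + 1) = bitonicStages t ++ (2 ^ (t + 1) - 1) :: halvings t := by
      simp [bitonicStages, List.range_succ, halvings]
    rw [this, List.length_append, add_mul, ih]
    simp [halvings]
    ring

/-! ### The bitonic sorter on blocks -/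

/-- The effect of a stage on the numbers of keys below a threshold in blocks of size `s`. -/
def countStage (s : ℕ) (c : ℕ → ℕ) (μ : ℕ) (i : ℕ) : ℕ :=
  if i < i ^^^ μ then min s (c i + c (i ^^^ μ)) else c i + c (i ^^^ μ) - s

/-- Bits that represent blocks of size `s`: a one if all keys are below the threshold, a zero if
none is. -/
def Represents (s : ℕ) (c : ℕ → ℕ) (b : ℕ → Bool) : Prop :=
  ∀ i, (b i = true → 0 < c i) ∧ (b i = false → c i < s)

theorem xor_ne_self {i μ : ℕ} (h : μ ≠ 0) : i ^^^ μ ≠ i := by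
  intro h'
  exact h (by simpa using congrArg (i ^^^ ·) h')

/-- Every representation of the outcome of a stage arises from a representation of its input. -/
theorem exists_represents_bitStage {s : ℕ} {c : ℕ → ℕ} (hc : ∀ i, c i ≤ s) {μ : ℕ} (hμ : μ ≠ 0)
    {b' : ℕ → Bool} (h : Represents s (countStage s c μ) b') :
    ∃ b, Represents s c b ∧ bitStage b μ = b' := by
  have key : ∀ i, i < i ^^^ μ → ∃ β : Bool × Bool,
      ((β.1 = true → 0 < c i) ∧ (β.1 = false → c i < s)) ∧
      ((β.2 = true → 0 < c (i ^^^ μ)) ∧ (β.2 = false → c (i ^^^ μ) < s)) ∧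
      (β.1 || β.2) = b' i ∧ (β.2 && β.1) = b' (i ^^^ μ) := by
    intro i hi
    have h1 := h i
    have h2 := h (i ^^^ μ)
    have c1 := hc i
    have c2 := hc (i ^^^ μ)
    simp only [countStage, Nat.xor_xor_cancel_right, if_pos hi, if_neg hi.not_gt] at h1 h2
    cases hb1 : b' i <;> cases hb2 : b' (i ^^^ μ) <;> simp only [hb1, hb2] at h1 h2
    · exact ⟨(false, false), by simp; simp at h1 h2; omega⟩
    · simp at h1 h2; omega
    · by_cases hx : 0 < c i ∧ c (i ^^^ μ) < s
      · exact ⟨(true, false), by simpa using hx⟩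
      · exact ⟨(false, true), by simp; simp at h1 h2; omega⟩
    · exact ⟨(true, true), by simp; simp at h1 h2; omega⟩
  -- The pair of bits is chosen once per comparator, at its lower line; the upper line uses the
  -- second component.
  choose! β hβ using key
  have hlt : ∀ i, ¬ i < i ^^^ μ → i ^^^ μ < (i ^^^ μ) ^^^ μ := by
    intro i hi
    rw [Nat.xor_xor_cancel_right]
    have := xor_ne_self (i := i) hμ
    omega
  refine ⟨fun i => if i < i ^^^ μ then (β i).1 else (β (i ^^^ μ)).2, ?_, ?_⟩
  · intro i
    by_cases hi : i < i ^^^ μ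
    · simp only [if_pos hi]
      exact (hβ i hi).1
    · simp only [if_neg hi]
      have := (hβ _ (hlt i hi)).2.1
      rwa [Nat.xor_xor_cancel_right] at this
  · funext i
    by_cases hi : i < i ^^^ μ
    · have := (hβ i hi).2.2.1
      simp only [bitStage, if_pos hi, Nat.xor_xor_cancel_right, if_neg hi.not_gt]
      exact this
    · have h1 := hlt i hi
      have := (hβ _ h1).2.2.2
      rw [Nat.xor_xor_cancel_right] at this h1
      simp only [bitStage, if_neg hi, Nat.xor_xor_cancel_right, if_pos h1]
      exact this

theorem countStage_le {s : ℕ} {c : ℕ → ℕ} (hc : ∀ i, c i ≤ s) (μ i : ℕ) :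
    countStage s c μ i ≤ s := by
  have h1 := hc i
  have h2 := hc (i ^^^ μ)
  unfold countStage
  split_ifs <;> omega

theorem exists_represents_foldl {s : ℕ} {l : List ℕ} (hl : ∀ μ ∈ l, μ ≠ 0) {c : ℕ → ℕ}
    (hc : ∀ i, c i ≤ s) {b' : ℕ → Bool} (h : Represents s (l.foldl (countStage s) c) b') :
    ∃ b, Represents s c b ∧ l.foldl bitStage b = b' := by
  induction l generalizing c with
  | nil => exact ⟨b', h, rfl⟩
  | cons μ l ih =>
    obtain ⟨b1, hb1, rfl⟩ := ih (fun x hx => hl x (by simp [hx])) (countStage_le hc μ) h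
    obtain ⟨b, hb, rfl⟩ := exists_represents_bitStage hc (hl μ (by simp)) hb1
    exact ⟨b, hb, rfl⟩

/-- The bitonic sorter sorts blocks. -/
theorem foldl_countStage_sorted {s t : ℕ} {c : ℕ → ℕ} (hc : ∀ i, c i ≤ s) {i j : ℕ} (hij : i < j)
    (hj : j < 2 ^ t) (hi : (bitonicStages t).foldl (countStage s) c i < s) :
    (bitonicStages t).foldl (countStage s) c j = 0 := by
  by_contra hne
  set c' := (bitonicStages t).foldl (countStage s) c
  -- Line `i` is not full, so it may read zero, while every other nonempty line, in particular line
  -- `j`, reads one. This reading is not sorted.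
  have hrep : Represents s c' fun k => if k = i then false else decide (0 < c' k) := by
    intro k
    by_cases hk : k = i
    · subst hk; simpa using hi
    · simp [hk]; omega
  obtain ⟨b, -, hb⟩ := exists_represents_foldl (fun μ hμ => bitonicStages_ne_zero hμ) hc hrep
  obtain ⟨l, -, hl⟩ := foldl_bitonicStages_sorted b t 0
  rw [hb] at hl
  have h1 := hl j hj
  have h2 := hl i (hij.trans hj)
  simp only [zero_mul, zero_add, if_neg hij.ne', if_pos] at h1 h2
  have h3 := h1.1 (by simp; omega)
  have h4 := h2.2 (hij.trans h3)
  simp at h4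

end IRan

/-! ### Rounds and their costs -/

section Machine

variable {p : ℕ} {S W : Type*}

/-- Processor memories after a round. -/
def Round.next (r : Round p S W) (m : Fin p → S) (k : Fin p) : S :=
  (r.compute k (m k) fun j => r.send j (m j) k).val

/-- The maximum local computation time in a round. -/
noncomputable def Round.work (r : Round p S W) (m : Fin p → S) : ℝ :=
  ⨆ k : Fin p, (r.compute k (m k) fun j => r.send j (m j) k).time

/-- The maximum number of words sent or received by a processor in a round. -/
def Round.relation (r : Round p S W) (m : Fin p → S) : ℕ :=
  Finset.univ.sup fun k : Fin p =>
    max (∑ j, (r.send k (m k) j).length) (∑ j, (r.send j (m j) k).length)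

/-- The total computation time of a list of rounds. -/
noncomputable def roundsWork : List (Round p S W) → (Fin p → S) → ℝ
  | [], _ => 0
  | r :: l, m => r.work m + roundsWork l (r.next m)

/-- The sum of the sizes of the relations routed by a list of rounds. -/
def roundsRelation : List (Round p S W) → (Fin p → S) → ℕ
  | [], _ => 0
  | r :: l, m => r.relation m + roundsRelation l (r.next m)

/-- From memories that satisfy `A`, the rounds lead to memories that satisfy `B`, with computation
time at most `x` and communication of at most `h` words in total. -/
def Within (A : (Fin p → S) → Prop) (l : List (Round p S W)) (B : (Fin p → S) → Prop)
    (x : ℝ) (h : ℕ) : Prop :=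
  ∀ m, A m → B (l.foldl (fun m r => r.next m) m) ∧ roundsWork l m ≤ x ∧ roundsRelation l m ≤ h

theorem Within.nil (A : (Fin p → S) → Prop) : Within A ([] : List (Round p S W)) A 0 0 :=
  fun _ hm => ⟨hm, le_rfl, le_rfl⟩

theorem roundsWork_append (l l' : List (Round p S W)) (m : Fin p → S) :
    roundsWork (l ++ l') m = roundsWork l m + roundsWork l' (l.foldl (fun m r => r.next m) m) := by
  induction l generalizing m with
  | nil => simp [roundsWork]
  | cons r l ih => simp [roundsWork, ih, add_assoc]

theorem roundsRelation_append (l l' : List (Round p S W)) (m : Fin p → S) :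
    roundsRelation (l ++ l') m =
      roundsRelation l m + roundsRelation l' (l.foldl (fun m r => r.next m) m) := by
  induction l generalizing m with
  | nil => simp [roundsRelation]
  | cons r l ih => simp [roundsRelation, ih, add_assoc]

theorem Within.append {A B C : (Fin p → S) → Prop} {l l' : List (Round p S W)} {x x' : ℝ}
    {h h' : ℕ} (h1 : Within A l B x h) (h2 : Within B l' C x' h') :
    Within A (l ++ l') C (x + x') (h + h') := by
  intro m hm
  obtain ⟨a1, a2, a3⟩ := h1 m hm
  obtain ⟨b1, b2, b3⟩ := h2 _ a1
  refine ⟨by rwa [List.foldl_append], ?_, ?_⟩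
  · rw [roundsWork_append]; exact add_le_add a2 b2
  · rw [roundsRelation_append]; exact add_le_add a3 b3

/-- A single round. -/
theorem Within.single [NeZero p] {A B : (Fin p → S) → Prop} {r : Round p S W} {x : ℝ} {h : ℕ}
    (hB : ∀ m, A m → B (r.next m))
    (hx : ∀ m, A m → ∀ k, (r.compute k (m k) fun j => r.send j (m j) k).time ≤ x)
    (hs : ∀ m, A m → ∀ k, ∑ j, (r.send k (m k) j).length ≤ h)
    (hr : ∀ m, A m → ∀ k, ∑ j, (r.send j (m j) k).length ≤ h) : Within A [r] B x h := by
  intro m hm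
  refine ⟨hB m hm, ?_, ?_⟩
  · simp only [roundsWork, add_zero]
    exact ciSup_le (hx m hm)
  · simp only [roundsRelation, add_zero]
    exact Finset.sup_le fun k _ => max_le (hs m hm k) (hr m hm k)

/-- A round joins a transmission to the computation that uses it, whereas a superstep joins it to
the computation before. Regrouping leaves the first computation by itself. -/
theorem compTime_supersteps (c : Task p S W) (l : List (Round p S W)) (C : Config p S W) :
    compTime (supersteps c l) C = (⨆ k, (c k (C.mem k) (C.inbox k)).time) +
      roundsWork l fun k => (c k (C.mem k) (C.inbox k)).val := by
  induction l generalizing c C with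
  | nil => simp [supersteps, compTime, Superstep.work, roundsWork]
  | cons r l ih =>
    rw [supersteps, compTime, ih]
    rfl

/-- Replacing `max L (g h)` by `L + g h` decouples the number of supersteps from the number of
words. There is one superstep more than there are rounds, and the last one sends nothing. -/
theorem commTime_supersteps_le {L g : ℝ} (hL : 0 ≤ L) (hg : 0 ≤ g) (c : Task p S W)
    (l : List (Round p S W)) (C : Config p S W) :
    commTime L g (supersteps c l) C ≤ (l.length + 1) * L +
      g * roundsRelation l fun k => (c k (C.mem k) (C.inbox k)).val := by
  induction l generalizing c C with
  | nil =>
    have h : (Finset.univ.sup fun _ : Fin p => 0) = 0 := (Finset.sup_eq_bot_iff _ _).2 fun _ _ => rfl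
    simp [supersteps, commTime, Superstep.relation, roundsRelation, hL, h]
  | cons r l ih =>
    rw [supersteps, commTime]
    refine (add_le_add_right (ih _ _) _).trans ?_
    have h1 : (⟨c, r.send⟩ : Superstep p S W).relation C =
        r.relation fun k => (c k (C.mem k) (C.inbox k)).val := rfl
    have h2 : roundsRelation (r :: l) (fun k => (c k (C.mem k) (C.inbox k)).val) =
        r.relation (fun k => (c k (C.mem k) (C.inbox k)).val) +
        roundsRelation l fun k => (r.compute k ((⟨c, r.send⟩ : Superstep p S W).next C |>.mem k)
          ((⟨c, r.send⟩ : Superstep p S W).next C |>.inbox k)).val := rfl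
    rw [h1, h2]
    have h3 : max L (g * (r.relation fun k => (c k (C.mem k) (C.inbox k)).val)) ≤
        L + g * (r.relation fun k => (c k (C.mem k) (C.inbox k)).val) :=
      max_le (le_add_of_nonneg_right (by positivity)) (le_add_of_nonneg_left hL)
    rw [List.length_cons]
    push_cast
    linarith

end Machine

/-! ### Sequential operations -/

section Sequential

variable {K : Type*} [LinearOrder K]

theorem sortSeq_perm (l : List K) : (sortSeq l).val.Perm l := List.mergeSort_perm _ _

theorem sortSeq_sorted (l : List K) : (sortSeq l).val.Pairwise (· ≤ ·) := by
  have := List.pairwise_mergeSort (le := fun a b : K => decide (a ≤ b))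
    (by simpa using fun a b c => le_trans) (by simpa using le_total) l
  simpa [sortSeq] using this

theorem mergeSeq_pair_perm (a b : List K) : (mergeSeq [a, b]).val.Perm (a ++ b) := by
  simp only [mergeSeq, List.foldr, List.merge_right]
  exact List.merge_perm_append _

theorem mergeSeq_pair_sorted {a b : List K} (ha : a.Pairwise (· ≤ ·)) (hb : b.Pairwise (· ≤ ·)) :
    (mergeSeq [a, b]).val.Pairwise (· ≤ ·) := by
  have := List.pairwise_merge (le := fun a b : K => decide (a ≤ b))
    (by simpa using fun a b c => le_trans) (by simpa using le_total) a b
    (by simpa using ha) (by simpa using hb)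
  simpa [mergeSeq] using this

/-- Sorted permutations of each other are equal. Hence both partners of a comparator cut the same
list, and the parts that they keep are complementary. -/
theorem mergeSeq_pair_comm {a b : List K} (ha : a.Pairwise (· ≤ ·)) (hb : b.Pairwise (· ≤ ·)) :
    (mergeSeq [a, b]).val = (mergeSeq [b, a]).val :=
  (((mergeSeq_pair_perm a b).trans List.perm_append_comm).trans
    (mergeSeq_pair_perm b a).symm).eq_of_pairwise
    (fun _ _ _ _ h h' => le_antisymm h h') (mergeSeq_pair_sorted ha hb) (mergeSeq_pair_sorted hb ha)

/-- In a sorted list the keys below `y` form a prefix. With the companion for `drop`, this is what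
makes a comparator act on counts by `countStage`. -/
theorem countP_lt_take {l : List K} (hl : l.Pairwise (· ≤ ·)) (y : K) (s : ℕ) :
    (l.take s).countP (fun x => decide (x < y)) = min s (l.countP fun x => decide (x < y)) := by
  induction l generalizing s with
  | nil => simp
  | cons a l ih =>
    cases s with
    | zero => simp
    | succ s =>
      rw [List.pairwise_cons] at hl
      rw [List.take_succ_cons, List.countP_cons, List.countP_cons, ih hl.2]
      by_cases h : a < y
      · simp [h]
      · have : l.countP (fun x => decide (x < y)) = 0 := by
          rw [List.countP_eq_zero]
          intro x hx
          simpa using (not_lt.1 h).trans (hl.1 x hx)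
        simp [h, this]

theorem countP_lt_drop {l : List K} (hl : l.Pairwise (· ≤ ·)) (y : K) (s : ℕ) :
    (l.drop s).countP (fun x => decide (x < y)) = (l.countP fun x => decide (x < y)) - s := by
  have h1 := List.countP_append (p := fun x => decide (x < y)) (l₁ := l.take s) (l₂ := l.drop s)
  rw [List.take_append_drop, countP_lt_take hl] at h1
  omega

end Sequential

/-! ### Messages and the lists they form -/

namespace IRan

variable {K : Type*}

@[simp] theorem keysOf_map_key (l : List K) : keysOf (l.map Word.key) = l := by
  simp [keysOf, List.filterMap_map]

@[simp] theorem keysOf_nil : keysOf ([] : List (Word K)) = [] := rfl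

@[simp] theorem idxsOf_map_idx {α : Type*} (f : α → ℕ) (l : List α) :
    idxsOf (l.map fun d => (Word.idx (f d) : Word K)) = l.map f := by
  simp only [idxsOf, List.filterMap_map, Function.comp_def]
  exact congrFun List.filterMap_eq_map l

/-- Splitting a list into classes and concatenating the classes. -/
theorem flatMap_filter_perm {α β : Type*} {p : ℕ} (c : α → Fin p) (f : Fin p → α → Option β)
    (l : List α) :
    ((List.finRange p).flatMap fun j => (l.filter fun a => c a == j).filterMap (f j)).Perm
      (l.filterMap fun a => f (c a) a) := by
  induction l with
  | nil => simp
  | cons a l ih =>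
    have h1 : ∀ j, ((a :: l).filter fun a => c a == j).filterMap (f j) =
        (if c a = j then (f j a).toList else []) ++
          (l.filter fun a => c a == j).filterMap (f j) := by
      intro j
      by_cases h : c a = j
      · simp only [h, List.filter_cons, beq_self_eq_true, if_true, List.filterMap_cons]
        cases f j a <;> simp
      · simp [h]
    have h2 : (a :: l).filterMap (fun a => f (c a) a) =
        (f (c a) a).toList ++ l.filterMap fun a => f (c a) a := by
      rw [List.filterMap_cons]
      cases f (c a) a <;> simp
    have h3 : ((List.finRange p).flatMap fun j => if c a = j then (f j a).toList else []) =
        (f (c a) a).toList := by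
      have key : ∀ L : List (Fin p), L.Nodup →
          (L.flatMap fun j => if c a = j then (f j a).toList else []) =
            if c a ∈ L then (f (c a) a).toList else [] := by
        intro L hL
        induction L with
        | nil => simp
        | cons x L ihL =>
          rw [List.nodup_cons] at hL
          rw [List.flatMap_cons, ihL hL.2]
          by_cases hx : c a = x
          · subst hx; simp [hL.1]
          · simp [hx]
      rw [key _ (List.nodup_finRange p), if_pos (List.mem_finRange _)]
    simp only [h1, h2]
    refine (List.flatMap_append_perm _ _ _).symm.trans ?_
    rw [h3]
    exact ih.append_left _

/-- The total length of the classes of a list. -/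
theorem sum_length_filter {α : Type*} {p : ℕ} (c : α → Fin p) (l : List α) :
    ∑ j, (l.filter fun a => c a == j).length = l.length := by
  have := (flatMap_filter_perm c (fun _ a => some a) l).length_eq
  simpa [List.length_flatMap, ← Fin.sum_univ_def] using this

/-- For rounds in which a processor has at most one recipient, or at most one sender: the total is a
single message. -/
theorem sum_length_ite_le {α : Type*} {p h : ℕ} {P : Fin p → Prop} [DecidablePred P]
    {w : Fin p → List α} (hP : ∀ i j, P i → P j → i = j) (hw : ∀ j, P j → (w j).length ≤ h) :
    ∑ j, (if P j then w j else []).length ≤ h := by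
  by_cases hne : ∃ i, P i
  · obtain ⟨i, hi⟩ := hne
    rw [Finset.sum_eq_single i]
    · rw [if_pos hi]; exact hw i hi
    · intro j _ hj
      rw [if_neg fun hj' => hj (hP j i hj' hi)]
      rfl
    · simp
  · push Not at hne
    simp [hne]

theorem flatMap_finRange_ite {α : Type*} {p : ℕ} {P : Fin p → Prop} [DecidablePred P]
    {w : Fin p → List α} (i : Fin p) (hP : ∀ j, P j ↔ j = i) :
    ((List.finRange p).flatMap fun j => if P j then w j else []) = w i := by
  have key : ∀ L : List (Fin p), L.Nodup →
      (L.flatMap fun j => if P j then w j else []) = if i ∈ L then w i else [] := by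
    intro L hL
    induction L with
    | nil => simp
    | cons x L ih =>
      rw [List.nodup_cons] at hL
      rw [List.flatMap_cons, ih hL.2]
      by_cases hx : x = i
      · subst hx; simp [hL.1, hP]
      · simp [hx, hP, Ne.symm hx]
  rw [key _ (List.nodup_finRange p), if_pos (List.mem_finRange _)]

end IRan

/-! ### Monotonicity of the binary logarithm -/

theorem lg_mono {x y : ℝ} (hx : 0 < x) (h : x ≤ y) : lg x ≤ lg y :=
  Real.logb_le_logb_of_le (by norm_num) hx h

theorem lg_nonneg {x : ℝ} (hx : 1 ≤ x) : 0 ≤ lg x := Real.logb_nonneg (by norm_num) hx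

theorem lg_two : lg 2 = 1 := by simp [lg]

theorem natCast_lg_nonneg (n : ℕ) : 0 ≤ lg n := by
  rcases Nat.eq_zero_or_pos n with rfl | h
  · simp [lg]
  · exact lg_nonneg (by exact_mod_cast h)

theorem natCast_lg_mono {m n : ℕ} (h : m ≤ n) : lg m ≤ lg n := by
  rcases Nat.eq_zero_or_pos m with rfl | hm
  · simpa [lg] using natCast_lg_nonneg n
  · exact lg_mono (by exact_mod_cast hm) (by exact_mod_cast h)

theorem mul_lg_mono {m n : ℕ} (h : m ≤ n) : (m : ℝ) * lg m ≤ n * lg n :=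
  mul_le_mul (by exact_mod_cast h) (natCast_lg_mono h) (natCast_lg_nonneg m) (Nat.cast_nonneg n)

namespace IRan

theorem length_filter_finRange {n : ℕ} (q : Fin n → Bool) :
    ((List.finRange n).filter q).length = (Finset.univ.filter fun j => q j = true).card := by
  rw [Finset.card_filter, ← List.countP_eq_length_filter, List.countP_eq_length_filter]
  rw [Fin.sum_univ_def]
  induction List.finRange n with
  | nil => simp
  | cons a l ih => by_cases h : q a <;> simp [h, ih, add_comm]

theorem countP_map_finRange {n : ℕ} {α : Type*} (f : Fin n → α) (r : Fin n → Bool) (q : α → Bool) :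
    (((List.finRange n).filter r).map f).countP q =
      (Finset.univ.filter fun j => q (f j) = true ∧ r j = true).card := by
  rw [List.countP_map, List.countP_filter, List.countP_eq_length_filter, length_filter_finRange]
  simp

/-! ### Drawing and collecting the sample -/

section Sampling

variable {K : Type*} [LinearOrder K] {p s : ℕ}

/-- The draws of processor `k` are those with numbers from `s k` up to `s k + s`, cut off at `s p -
1`; the cut removes one draw, and only for the last processor. -/
theorem length_drawsOf (draw : Fin (s * p - 1) → Fin p × ℕ) (hs : 0 < s) (k : Fin p) :
    (drawsOf p s draw k).length = if k.val + 1 < p then s else s - 1 := by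
  have hk := k.isLt
  have hle : s * (k + 1) ≤ s * p := Nat.mul_le_mul_left s hk
  have hsp : s * (k + 1) = s * k + s := by ring
  rw [drawsOf, List.length_map, length_filter_finRange]
  have h1 : (Finset.univ.filter fun j : Fin (s * p - 1) => (j.val / s == k.val) = true).card =
      (Finset.Ico (s * k) (min (s * k + s) (s * p - 1))).card := by
    refine Finset.card_bij (fun j _ => j.val) ?_ ?_ ?_
    · intro j hj
      have h2 : j.val / s = k := by simpa using hj
      have h3 := Nat.div_add_mod j.val s
      have h4 := Nat.mod_lt j.val hs
      rw [h2] at h3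
      simp only [Finset.mem_Ico]
      omega
    · intro i _ j _ h; exact Fin.ext h
    · intro x hx
      simp only [Finset.mem_Ico] at hx
      refine ⟨⟨x, by omega⟩, ?_, rfl⟩
      simp only [Finset.mem_filter, Finset.mem_univ, true_and, beq_iff_eq]
      exact Nat.div_eq_of_lt_le (by rw [mul_comm]; omega) (by rw [mul_comm, hsp]; omega)
  rw [h1, Nat.card_Ico]
  split_ifs with h
  · have : s * (k + 1 + 1) ≤ s * p := Nat.mul_le_mul_left s h
    have e : s * (k + 1 + 1) = s * k + s + s := by ring
    omega
  · have : p = k + 1 := by omega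
    have : s * p = s * (k + 1) := congrArg (s * ·) this
    omega

theorem div_lt_of_lt_mul_sub_one (i : Fin (s * p - 1)) : i.val / s < p :=
  Nat.div_lt_of_lt_mul (i.isLt.trans_le (Nat.sub_le _ _))

theorem length_drawsOf_le (draw : Fin (s * p - 1) → Fin p × ℕ) (hs : 0 < s) (k : Fin p) :
    (drawsOf p s draw k).length ≤ s := by
  rw [length_drawsOf draw hs]
  split_ifs <;> omega

variable (X : Fin p → List K)

/-- The keys of a processor after the local sorting. -/
noncomputable def sortedKeys (k : Fin p) : List K := (sortSeq (X k)).val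

theorem length_sortedKeys (k : Fin p) : (sortedKeys X k).length = (X k).length :=
  (sortSeq_perm _).length_eq

/-- The key that is selected when a position of the input is drawn. -/
noncomputable def drawnKey (a : Σ k : Fin p, Fin (X k).length) : K :=
  (sortedKeys X a.1)[a.2.val]'(by rw [length_sortedKeys]; exact a.2.isLt)

variable {X} (d : Draws X s)

theorem filterMap_drawsOf (k : Fin p) :
    (drawsOf p s d.pairs k).filterMap (fun a => (sortedKeys X a.1)[a.2]?) =
      ((List.finRange (s * p - 1)).filter fun j => j.val / s == k.val).map
        fun j => drawnKey X (d j) := by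
  rw [drawsOf, List.filterMap_map]
  refine (congrFun ?_ _).trans (congrFun List.filterMap_eq_map _)
  congr 1
  funext j
  simp only [Function.comp, Draws.pairs, drawnKey]
  exact List.getElem?_eq_getElem _

theorem sum_length_filter_drawsOf {K : Type*} {X : Fin p → List K} (d : Draws X s) (k : Fin p) :
    ∑ j, ((drawsOf p s d.pairs j).filter fun a => a.1 == k).length =
      (Finset.univ.filter fun i => (d i).1 = k).card := by
  have h1 : ∀ j : Fin p, ((drawsOf p s d.pairs j).filter fun a => a.1 == k).length =
      (Finset.univ.filter fun i : Fin (s * p - 1) => (d i).1 = k ∧ i.val / s = j.val).card := by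
    intro j
    rw [← List.countP_eq_length_filter, drawsOf, countP_map_finRange]
    simp [Draws.pairs]
  rw [Finset.sum_congr rfl fun j _ => h1 j]
  rw [Finset.card_eq_sum_card_fiberwise (t := Finset.univ)
    (f := fun i : Fin (s * p - 1) => (⟨i.val / s, div_lt_of_lt_mul_sub_one i⟩ : Fin p)) (by simp)]
  refine Finset.sum_congr rfl fun j _ => ?_
  rw [Finset.filter_filter]
  simp [Fin.ext_iff]

/-- The memories after the local sorting. -/
def AfterSort (m : Fin p → Mem p K) : Prop :=
  ∀ k, m k = ⟨sortedKeys X k, fun _ => [], [], [], [], fun _ => []⟩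

/-- The memories after the requests. -/
structure AfterRequest (m : Fin p → Mem p K) : Prop where
  keys : ∀ k, (m k).keys = sortedKeys X k
  splitters : ∀ k, (m k).splitters = []
  relay : ∀ k, (m k).relay = []
  selected : ∀ k j, (m k).selected j = ((drawsOf p s d.pairs j).filter fun a => a.1 == k).filterMap
    fun a => (sortedKeys X k)[a.2]?

/-- The memories while the sample is sorted. -/
structure HasSample (m : Fin p → Mem p K) : Prop where
  keys : ∀ k, (m k).keys = sortedKeys X k
  splitters : ∀ k, (m k).splitters = []
  relay : ∀ k, (m k).relay = []
  sorted : ∀ k, (m k).sample.Pairwise (· ≤ ·)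
  length : ∀ k : Fin p, (m k).sample.length = if k.val + 1 < p then s else s - 1
  count : ∀ q : K → Bool, ∑ k, (m k).sample.countP q =
    (Finset.univ.filter fun i => q (drawnKey X (d i)) = true).card

theorem within_requestRound [NeZero p] (hs : 0 < s) {R : ℕ} (hsR : s ≤ R)
    (hR : ∀ k, (Finset.univ.filter fun i => (d i).1 = k).card ≤ R) :
    Within (AfterSort (X := X)) [requestRound p s d.pairs] (AfterRequest d) R R := by
  refine Within.single ?_ ?_ ?_ ?_
  · intro m hm
    refine ⟨fun k => ?_, fun k => ?_, fun k => ?_, fun k j => ?_⟩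
    · simp [Round.next, requestRound, hm k]
    · simp [Round.next, requestRound, hm k]
    · simp [Round.next, requestRound, hm k]
    · simp only [Round.next, requestRound, idxsOf_map_idx, List.filterMap_map, hm k]
      rfl
  · intro m hm k
    simp only [requestRound, idxsOf_map_idx, List.length_map]
    exact_mod_cast (sum_length_filter_drawsOf d k).trans_le (hR k)
  · intro m hm k
    simp only [requestRound, List.length_map]
    rw [sum_length_filter]
    exact (length_drawsOf_le _ hs k).trans hsR
  · intro m hm k
    simp only [requestRound, List.length_map]
    exact (sum_length_filter_drawsOf d k).trans_le (hR k)

/-- The replies arrive grouped by owner instead of in the order of the draws, hence only a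
permutation. -/
theorem AfterRequest.perm {d : Draws X s} {m : Fin p → Mem p K} (hm : AfterRequest d m)
    (k : Fin p) :
    ((List.finRange p).flatMap fun j => (m j).selected k).Perm
      (((List.finRange (s * p - 1)).filter fun j => j.val / s == k.val).map
        fun j => drawnKey X (d j)) := by
  simp only [hm.selected]
  rw [← filterMap_drawsOf]
  exact flatMap_filter_perm (fun a : Fin p × ℕ => a.1) (fun j a => (sortedKeys X j)[a.2]?) _

theorem within_replyRound [NeZero p] (hs : 0 < s) {R : ℕ} (hsR : s ≤ R)
    (hR : ∀ k, (Finset.univ.filter fun i => (d i).1 = k).card ≤ R) :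
    Within (AfterRequest d) [replyRound p] (HasSample d) (s * lg s) R := by
  have hlen : ∀ k : Fin p, ((((List.finRange (s * p - 1)).filter fun j => j.val / s == k.val).map
      fun j => drawnKey X (d j))).length = (drawsOf p s d.pairs k).length := by
    intro k
    simp [drawsOf]
  refine Within.single ?_ ?_ ?_ ?_
  · intro m hm
    refine ⟨fun k => ?_, fun k => ?_, fun k => ?_, fun k => ?_, fun k => ?_, fun q => ?_⟩
    · simp [Round.next, replyRound, hm.keys]
    · simp [Round.next, replyRound, hm.splitters]
    · simp [Round.next, replyRound, hm.relay]
    · exact sortSeq_sorted _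
    · simp only [Round.next, replyRound, keysOf_map_key]
      rw [(sortSeq_perm _).length_eq, (hm.perm k).length_eq, hlen, length_drawsOf _ hs]
    · simp only [Round.next, replyRound, keysOf_map_key]
      rw [Finset.card_eq_sum_card_fiberwise (t := Finset.univ)
        (f := fun i : Fin (s * p - 1) => (⟨i.val / s, div_lt_of_lt_mul_sub_one i⟩ : Fin p)) (by simp)]
      refine Finset.sum_congr rfl fun k _ => ?_
      rw [(sortSeq_perm _).countP_eq, (hm.perm k).countP_eq, countP_map_finRange,
        Finset.filter_filter]
      simp [Fin.ext_iff]
  · intro m hm k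
    simp only [replyRound, keysOf_map_key, sortSeq]
    rw [(hm.perm k).length_eq, hlen]
    exact mul_lg_mono (length_drawsOf_le _ hs k)
  · intro m hm k
    simp only [replyRound, List.length_map, hm.selected]
    refine (Finset.sum_le_sum fun j _ => List.length_filterMap_le _ _).trans ?_
    exact (sum_length_filter_drawsOf d k).trans_le (hR k)
  · intro m hm k
    simp only [replyRound, List.length_map]
    have := (hm.perm k).length_eq
    rw [List.length_flatMap, ← Fin.sum_univ_def, hlen] at this
    rw [this]
    exact (length_drawsOf_le _ hs k).trans hsR

/-! ### Sorting the sample -/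

/-- The number of sample keys below `y` on each line; absent lines have none. -/
def countBelow (m : Fin p → Mem p K) (y : K) (i : ℕ) : ℕ :=
  if h : i < p then (m ⟨i, h⟩).sample.countP (fun x => decide (x < y)) else 0

theorem HasSample.length_le {d : Draws X s} {m : Fin p → Mem p K} (hm : HasSample d m)
    (k : Fin p) : (m k).sample.length ≤ s := by
  rw [hm.length]
  split_ifs <;> omega

theorem HasSample.countBelow_le {d : Draws X s} {m : Fin p → Mem p K} (hm : HasSample d m)
    (y : K) (i : ℕ) : countBelow m y i ≤ s := by
  unfold countBelow
  split_ifs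
  · exact List.countP_le_length.trans (hm.length_le _)
  · exact Nat.zero_le _

theorem exchangeRound_sample (m : Fin p → Mem p K) (μ : ℕ) (k : Fin p) :
    ((exchangeRound p s μ).next m k).sample =
      if h : k.val ^^^ μ < p then
        if k.val < k.val ^^^ μ then
          (mergeSeq [(m k).sample, (m ⟨k.val ^^^ μ, h⟩).sample]).val.take s
        else (mergeSeq [(m k).sample, (m ⟨k.val ^^^ μ, h⟩).sample]).val.drop s
      else (m k).sample := by
  simp only [Round.next, exchangeRound, Nat.xor_xor_cancel_right, if_true, keysOf_map_key]
  split_ifs <;> rfl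

/-- Summing the hypothesis over all `i` gives twice each sum. It is applied with `σ` the partner in
a stage, to show that a stage preserves the sample as a whole. -/
theorem sum_eq_of_involutive {ι : Type*} [Fintype ι] {σ : ι → ι} (hσ : σ.Involutive)
    {f g : ι → ℕ} (h : ∀ i, f i + f (σ i) = g i + g (σ i)) : ∑ i, f i = ∑ i, g i := by
  have hf := Equiv.sum_comp hσ.toPerm f
  have hg := Equiv.sum_comp hσ.toPerm g
  have := Finset.sum_congr rfl fun i (_ : i ∈ Finset.univ) => h i
  rw [Finset.sum_add_distrib, Finset.sum_add_distrib] at this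
  simp only [Function.Involutive.coe_toPerm] at hf hg
  omega

/-- The partner of a line in a stage; a line whose partner is absent is its own partner. -/
def partner (μ : ℕ) (k : Fin p) : Fin p := if h : k.val ^^^ μ < p then ⟨k.val ^^^ μ, h⟩ else k

theorem partner_involutive (μ : ℕ) : (partner (p := p) μ).Involutive := by
  intro k
  by_cases h : k.val ^^^ μ < p
  · simp [partner, h]
  · simp [partner, h]

/-- The block lengths survive because only the last block is short and the last processor is never
the lower partner: the lower partner keeps `s` keys and the upper one what is left. Counts survive
since the two parts make up the merged list. -/
theorem HasSample.exchangeRound {d : Draws X s} {m : Fin p → Mem p K} (hm : HasSample d m)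
    {μ : ℕ} (hμ : μ ≠ 0) : HasSample d ((exchangeRound p s μ).next m) := by
  refine ⟨fun k => ?_, fun k => ?_, fun k => ?_, fun k => ?_, fun k => ?_, fun q => ?_⟩
  · simp only [Round.next, IRan.exchangeRound]; split_ifs <;> exact hm.keys k
  · simp only [Round.next, IRan.exchangeRound]; split_ifs <;> exact hm.splitters k
  · simp only [Round.next, IRan.exchangeRound]; split_ifs <;> exact hm.relay k
  · rw [exchangeRound_sample]
    split_ifs with h
    · exact (mergeSeq_pair_sorted (hm.sorted _) (hm.sorted _)).sublist (List.take_sublist _ _)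
    · exact (mergeSeq_pair_sorted (hm.sorted _) (hm.sorted _)).sublist (List.drop_sublist _ _)
    · exact hm.sorted k
  · rw [exchangeRound_sample]
    have hk := k.isLt
    have hne := xor_ne_self (i := k.val) hμ
    split_ifs with h h1 h2 h2 h3
    all_goals first
      | rw [List.length_take, (mergeSeq_pair_perm _ _).length_eq, List.length_append, hm.length,
          hm.length]
        dsimp only
        split_ifs <;> omega
      | rw [List.length_drop, (mergeSeq_pair_perm _ _).length_eq, List.length_append, hm.length,
          hm.length]
        dsimp only
        split_ifs <;> omega
      | (rw [hm.length]; simp_all)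
  · rw [← hm.count q]
    refine sum_eq_of_involutive (partner_involutive μ) fun k => ?_
    by_cases h : k.val ^^^ μ < p
    · have hpk : partner μ k = ⟨k.val ^^^ μ, h⟩ := by simp [partner, h]
      have hne := xor_ne_self (i := k.val) hμ
      have hsum : ∀ (a b : List K), ((mergeSeq [a, b]).val.take s).countP q +
          ((mergeSeq [a, b]).val.drop s).countP q = a.countP q + b.countP q := by
        intro a b
        rw [← List.countP_append, List.take_append_drop, (mergeSeq_pair_perm a b).countP_eq,
          List.countP_append]
      rw [hpk, exchangeRound_sample, exchangeRound_sample, dif_pos h]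
      have h' : (k.val ^^^ μ) ^^^ μ < p := by rw [Nat.xor_xor_cancel_right]; exact k.isLt
      have hk' : (⟨(k.val ^^^ μ) ^^^ μ, h'⟩ : Fin p) = k := Fin.ext (Nat.xor_xor_cancel_right _ _)
      rw [dif_pos h', hk']
      simp only [Nat.xor_xor_cancel_right]
      rcases Nat.lt_or_ge k.val (k.val ^^^ μ) with hlt | hge
      · rw [if_pos hlt, if_neg hlt.not_gt,
          mergeSeq_pair_comm (hm.sorted ⟨k.val ^^^ μ, h⟩) (hm.sorted k)]
        exact hsum _ _
      · have hlt : k.val ^^^ μ < k.val := by omega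
        rw [if_neg hge.not_gt, if_pos hlt,
          mergeSeq_pair_comm (hm.sorted ⟨k.val ^^^ μ, h⟩) (hm.sorted k), add_comm]
        exact hsum _ _
    · have hpk : partner μ k = k := by simp [partner, h]
      rw [hpk, exchangeRound_sample, dif_neg h]

theorem HasSample.countBelow_exchangeRound {d : Draws X s} {m : Fin p → Mem p K}
    (hm : HasSample d m) {μ : ℕ} (hμ : μ ≠ 0) (y : K) :
    countBelow ((IRan.exchangeRound p s μ).next m) y = countStage s (countBelow m y) μ := by
  funext i
  have hle := hm.countBelow_le y
  have hne := xor_ne_self (i := i) hμ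
  by_cases hi : i < p
  · rw [countBelow, dif_pos hi, exchangeRound_sample]
    have hci : countBelow m y i = (m ⟨i, hi⟩).sample.countP (fun x => decide (x < y)) := by
      simp [countBelow, hi]
    by_cases hj : i ^^^ μ < p
    · have hcj : countBelow m y (i ^^^ μ) =
          (m ⟨i ^^^ μ, hj⟩).sample.countP (fun x => decide (x < y)) := by
        simp [countBelow, hj]
      have hsorted := mergeSeq_pair_sorted (hm.sorted ⟨i, hi⟩) (hm.sorted ⟨i ^^^ μ, hj⟩)
      have hcount : (mergeSeq [(m ⟨i, hi⟩).sample, (m ⟨i ^^^ μ, hj⟩).sample]).val.countP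
          (fun x => decide (x < y)) = countBelow m y i + countBelow m y (i ^^^ μ) := by
        rw [(mergeSeq_pair_perm _ _).countP_eq, List.countP_append, hci, hcj]
      rw [dif_pos hj]
      by_cases hlt : i < i ^^^ μ
      · rw [if_pos hlt, countP_lt_take hsorted, hcount, countStage, if_pos hlt]
      · rw [if_neg hlt, countP_lt_drop hsorted, hcount, countStage, if_neg hlt]
    -- An absent line has a number at least `p`, so it is the upper partner and counts as empty; the
    -- present line keeps its block, as `countStage` prescribes.
    · have hcj : countBelow m y (i ^^^ μ) = 0 := by simp [countBelow, hj]
      rw [dif_neg hj, countStage, if_pos (by omega), hcj, add_zero, ← hci, min_eq_right (hle i)]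
  · have hci : countBelow m y i = 0 := by simp [countBelow, hi]
    have h0 : countBelow ((IRan.exchangeRound p s μ).next m) y i = 0 := by simp [countBelow, hi]
    rw [h0, countStage, hci, zero_add]
    split_ifs with hlt
    -- The partner of an absent line with a higher number is absent too. In the other case the
    -- partner has at most `s` keys, and subtracting `s` leaves none.
    · have hcj : countBelow m y (i ^^^ μ) = 0 := by
        rw [countBelow, dif_neg]; omega
      rw [hcj]; simp
    · have := hle (i ^^^ μ)
      omega

/-- All thresholds are tracked at once, so that the threshold can be chosen after the network has
run. Merging two blocks costs at most `2 s` because `lg 2 = 1`. -/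
theorem within_exchangeRounds [NeZero p] {l : List ℕ} (hl : ∀ μ ∈ l, μ ≠ 0) (c : K → ℕ → ℕ) :
    Within (fun m => HasSample d m ∧ ∀ y, countBelow m y = c y) (l.map (exchangeRound p s))
      (fun m => HasSample d m ∧ ∀ y, countBelow m y = l.foldl (countStage s) (c y))
      (l.length * (2 * s)) (l.length * s) := by
  induction l generalizing c with
  | nil => simpa using Within.nil (fun m => HasSample d m ∧ ∀ y, countBelow m y = c y)
  | cons μ l ih =>
    have hμ : μ ≠ 0 := hl μ (by simp)
    have h1 : Within (fun m => HasSample d m ∧ ∀ y, countBelow m y = c y) [exchangeRound p s μ]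
        (fun m => HasSample d m ∧ ∀ y, countBelow m y = countStage s (c y) μ) (2 * s) s := by
      refine Within.single ?_ ?_ ?_ ?_
      · rintro m ⟨hm, hc⟩
        exact ⟨hm.exchangeRound hμ, fun y => by
          rw [hm.countBelow_exchangeRound hμ, hc]⟩
      · rintro m ⟨hm, -⟩ k
        simp only [exchangeRound, Nat.xor_xor_cancel_right, if_true, keysOf_map_key]
        by_cases h : k.val ^^^ μ < p
        · rw [dif_pos h]
          have h2 := hm.length_le k
          have h3 := hm.length_le ⟨k.val ^^^ μ, h⟩
          simp only [mergeSeq, List.flatten_cons,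
            List.flatten_nil, List.append_nil, List.length_append, List.length_cons,
            List.length_nil]
          norm_num [lg_two]
          have : (((m k).sample.length + (m ⟨k.val ^^^ μ, h⟩).sample.length : ℕ) : ℝ) ≤
            ((s + s : ℕ) : ℝ) := by exact_mod_cast add_le_add h2 h3
          push_cast at this
          linarith
        · rw [dif_neg h]
          positivity
      · rintro m ⟨hm, -⟩ k
        simp only [exchangeRound]
        refine sum_length_ite_le (fun i j hi hj => Fin.ext (hi.trans hj.symm)) fun j _ => ?_
        rw [List.length_map]
        exact hm.length_le k
      · rintro m ⟨hm, -⟩ k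
        simp only [exchangeRound]
        refine sum_length_ite_le (fun i j hi hj => Fin.ext ?_) fun j _ => ?_
        · simpa using congrArg (· ^^^ μ) (hi.symm.trans hj)
        · rw [List.length_map]
          exact hm.length_le j
    have h2 := h1.append (ih (fun x hx => hl x (by simp [hx])) fun y => countStage s (c y) μ)
    have e1 : ((2 : ℝ) * s + l.length * (2 * s)) = ((μ :: l).length : ℕ) * (2 * s) := by
      rw [List.length_cons]; push_cast; ring
    have e2 : s + l.length * s = (μ :: l).length * s := by
      rw [List.length_cons]; ring
    rw [e1, e2] at h2
    exact h2

/-- The memories after the sorting of the sample. -/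
structure HasSortedSample (m : Fin p → Mem p K) : Prop extends HasSample d m where
  ordered : ∀ i j : Fin p, i < j → ∀ x ∈ (m i).sample, ∀ y ∈ (m j).sample, x ≤ y

/-- If `y < x` with `x` in block `i` and `y` in a later block `j`, then for the threshold `x` block
`i` is not full and block `j` is not empty, against `foldl_countStage_sorted`. -/
theorem within_bitonicSorter [NeZero p] :
    Within (HasSample d) ((bitonicStages (Nat.clog 2 p)).map (exchangeRound p s))
      (HasSortedSample d) ((bitonicStages (Nat.clog 2 p)).length * (2 * s))
      ((bitonicStages (Nat.clog 2 p)).length * s) := by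
  intro m hm
  obtain ⟨⟨h1, h2⟩, h3⟩ := within_exchangeRounds d (fun μ hμ => bitonicStages_ne_zero hμ)
    (countBelow m) m ⟨hm, fun _ => rfl⟩
  refine ⟨⟨h1, fun i j hij x hx y hy => ?_⟩, h3⟩
  by_contra! hlt
  set m' := ((bitonicStages (Nat.clog 2 p)).map (exchangeRound p s)).foldl
    (fun m r => r.next m) m
  have hi : countBelow m' x i = (m' i).sample.countP fun z => decide (z < x) := by
    simp [countBelow]
  have hj : countBelow m' x j = (m' j).sample.countP fun z => decide (z < x) := by
    simp [countBelow]
  have hi' : countBelow m' x i < s := by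
    rw [hi]
    refine lt_of_lt_of_le ?_ (h1.length_le i)
    rw [List.countP_lt_length_iff]
    exact ⟨x, hx, by simp⟩
  have hj' : 0 < countBelow m' x j := by
    rw [hj, List.countP_pos_iff]
    exact ⟨y, hy, by simpa using hlt⟩
  rw [h2] at hi' hj'
  have := foldl_countStage_sorted (hm.countBelow_le x) hij
    (j.isLt.trans_le (Nat.le_pow_clog (by norm_num) p)) hi'
  omega

end Sampling

/-! ### Splitters and the sample keys between them -/

section Splitters

variable {K : Type*} {p s : ℕ}

/-- The last keys of all blocks but the last. -/
def lastKeys (A : Fin p → List K) : List K :=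
  (List.finRange p).flatMap fun j => if j.val + 1 < p then (A j).getLast?.toList else []

/-- Every block but the last contributes exactly one key, so entry `i` comes from block `i`; the
`pmap` form exposes this to indexing. -/
theorem lastKeys_eq {P : ℕ} {A : Fin (P + 1) → List K} (hA : ∀ j, j.val + 1 < P + 1 → A j ≠ []) :
    lastKeys A = (List.finRange P).pmap
      (fun j h => (A (Fin.castSucc j)).getLast (hA _ h)) (fun j _ => by simp) := by
  rw [lastKeys, List.finRange_succ_last, List.flatMap_append, List.flatMap_map]
  simp only [List.flatMap_cons, Fin.val_last, lt_irrefl, if_false, List.flatMap_nil,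
    List.append_nil]
  induction List.finRange P with
  | nil => rfl
  | cons a l ih =>
    rw [List.flatMap_cons, List.pmap_cons, ih]
    have h : a.val + 1 < P + 1 := by omega
    simp [List.getLast?_eq_some_getLast (hA (Fin.castSucc a) h)]

theorem length_lastKeys {A : Fin p → List K} (hA : ∀ j, j.val + 1 < p → A j ≠ []) :
    (lastKeys A).length = p - 1 := by
  cases p with
  | zero => rfl
  | succ P => rw [lastKeys_eq hA]; simp

theorem lastKeys_getElem? {A : Fin p → List K} (hA : ∀ j, j.val + 1 < p → A j ≠ []) {i : ℕ} {y : K}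
    (hy : (lastKeys A)[i]? = some y) :
    ∃ (h : i + 1 < p) (hne : A ⟨i, by omega⟩ ≠ []), (A ⟨i, by omega⟩).getLast hne = y := by
  cases p with
  | zero => simp [lastKeys] at hy
  | succ P =>
    obtain ⟨h, rfl⟩ := List.getElem?_eq_some_iff.1 hy
    rw [length_lastKeys hA] at h
    refine ⟨by omega, hA _ (by simpa using h), ?_⟩
    simp only [lastKeys_eq hA]
    simp

variable [LinearOrder K]

/-- The keys of subsequence number `j`, for the splitters `Y`. -/
def InBucket (Y : List K) (j : ℕ) (x : K) : Prop :=
  (∀ i y, i + 1 = j → Y[i]? = some y → y ≤ x) ∧ ∀ y, Y[j]? = some y → x < y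

/-- Allows the estimate for intervals to be applied to buckets, although the splitters depend on the
sample: that estimate is uniform over all intervals. -/
theorem ordConnected_inBucket (Y : List K) (j : ℕ) : {x | InBucket Y j x}.OrdConnected := by
  refine ⟨fun x hx y hy z hz => ⟨fun i w hi hw => (hx.1 i w hi hw).trans hz.1, fun w hw => ?_⟩⟩
  exact hz.2.trans_lt (hy.2 w hw)

variable {X : Fin p → List K} (d : Draws X s)

/-- Splitters that leave at most `s` sample keys in each subsequence. -/
structure GoodSplitters (Y : List K) : Prop where
  length : Y.length = p - 1
  sorted : Y.Pairwise (· ≤ ·)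
  few : ∀ j : Fin p, {i | InBucket Y j (drawnKey X (d i))}.ncard ≤ s

/-- Sample keys in bucket `j`: blocks after `j` give none, since their keys are at least the last
key of block `j`. Block `j` gives at most `s - 1`, since its last key is excluded or, for the last
block, there are only `s - 1` keys. The blocks before `j` give at most the single key of splitter
`j`, which occurs once as the drawn keys are distinct. -/
theorem HasSortedSample.goodSplitters {d : Draws X s} {m : Fin p → Mem p K}
    (hm : HasSortedSample d m) (hs : 0 < s) (hX : Function.Injective (drawnKey X)) :
    GoodSplitters d (lastKeys fun k => (m k).sample) := by
  classical
  have hne : ∀ j : Fin p, j.val + 1 < p → (m j).sample ≠ [] := by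
    intro j hj h0
    have := hm.length j
    rw [h0, if_pos hj] at this
    simp at this
    omega
  refine ⟨length_lastKeys hne, ?_, fun j => ?_⟩
  · rw [List.pairwise_iff_getElem]
    intro i i' hi hi' hlt
    obtain ⟨h1, h2, h3⟩ := lastKeys_getElem? hne (List.getElem?_eq_getElem hi)
    obtain ⟨h1', h2', h3'⟩ := lastKeys_getElem? hne (List.getElem?_eq_getElem hi')
    rw [← h3, ← h3']
    exact hm.ordered ⟨i, by omega⟩ ⟨i', by omega⟩ hlt _ (List.getLast_mem _) _ (List.getLast_mem _)
  · set Y := lastKeys fun k => (m k).sample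
    have hcount : {i | InBucket Y j (drawnKey X (d i))}.ncard =
        ∑ k, (m k).sample.countP (fun x => decide (InBucket Y j x)) := by
      rw [hm.count, ← Set.ncard_coe_finset]
      congr 1
      ext i
      simp
    rw [hcount]
    have hlast : ∀ (k : Fin p) (h : (m k).sample ≠ []), ∀ x ∈ (m k).sample,
        x ≤ (m k).sample.getLast h := by
      intro k h x hx
      have h1 := hm.sorted k
      rw [← List.dropLast_append_getLast h] at h1 hx
      rw [List.pairwise_append] at h1
      rcases List.mem_append.1 hx with hx | hx
      · exact h1.2.2 x hx _ (by simp)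
      · simp at hx; exact hx.le
    have hYlen : Y.length = p - 1 := length_lastKeys hne
    have hY : ∀ i : ℕ, i + 1 < p → ∃ y, Y[i]? = some y := fun i hi =>
      ⟨_, List.getElem?_eq_getElem (by omega)⟩
    have habove : ∀ k : Fin p, j < k → (m k).sample.countP (fun x => decide (InBucket Y j x)) = 0 := by
      intro k hk
      rw [List.countP_eq_zero]
      intro x hx
      have hj1 : j.val + 1 < p := by have := k.isLt; have : j.val < k.val := hk; omega
      obtain ⟨y, hy⟩ := hY j hj1
      obtain ⟨h1, h2, h3⟩ := lastKeys_getElem? hne hy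
      simp only [decide_eq_true_eq]
      rintro ⟨-, h⟩
      have := hm.ordered j k hk y (h3 ▸ List.getLast_mem h2) x hx
      exact absurd (h y hy) this.not_gt
    have hself : j.val + 1 < p →
        (m j).sample.countP (fun x => decide (InBucket Y j x)) + 1 ≤ s := by
      intro hj1
      obtain ⟨y, hy⟩ := hY j hj1
      obtain ⟨h1, h2, h3⟩ := lastKeys_getElem? hne hy
      refine lt_of_lt_of_le ?_ (hm.length_le j)
      rw [List.countP_lt_length_iff]
      refine ⟨y, h3 ▸ List.getLast_mem h2, ?_⟩
      simp only [decide_eq_false_iff_not]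
      exact fun h => lt_irrefl _ (h.2 y hy)
    have hself' : (m j).sample.countP (fun x => decide (InBucket Y j x)) + 1 ≤ s := by
      by_cases hj1 : j.val + 1 < p
      · exact hself hj1
      · have := hm.length j
        rw [if_neg hj1] at this
        have h2 := List.countP_le_length (p := fun x => decide (InBucket Y j x)) (l := (m j).sample)
        omega
    have hbelow : ∑ k ∈ Finset.univ.erase j,
        (m k).sample.countP (fun x => decide (InBucket Y j x)) ≤ 1 := by
      rcases Nat.eq_zero_or_pos j.val with h0 | hpos
      · rw [Finset.sum_eq_zero]
        · omega
        intro k hk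
        refine habove k ?_
        have h1 : k ≠ j := (Finset.mem_erase.1 hk).1
        have : k.val ≠ j.val := fun h => h1 (Fin.ext h)
        exact Fin.lt_def.2 (by omega)
      obtain ⟨i, hi⟩ : ∃ i, i + 1 = j.val := ⟨j.val - 1, by omega⟩
      obtain ⟨y, hy⟩ := hY i (by have := j.isLt; omega)
      obtain ⟨h1, h2, h3⟩ := lastKeys_getElem? hne hy
      have hle : ∀ k ∈ Finset.univ.erase j,
          (m k).sample.countP (fun x => decide (InBucket Y j x)) ≤
            (m k).sample.countP (fun x => decide (x = y)) := by
        intro k hk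
        rcases lt_or_ge j k with hjk | hjk
        · rw [habove k hjk]; exact Nat.zero_le _
        · refine List.countP_mono_left fun x hx hxb => ?_
          simp only [decide_eq_true_eq] at hxb ⊢
          refine le_antisymm ?_ (hxb.1 i y hi hy)
          have hkj : k.val ≠ j.val := fun h => (Finset.mem_erase.1 hk).1 (Fin.ext h)
          have hkj' : k.val ≤ j.val := hjk
          rcases eq_or_lt_of_le (show k.val ≤ i by omega) with h | h
          · rw [show k = ⟨i, by omega⟩ from Fin.ext h] at hx
            rw [← h3]
            exact hlast _ h2 x hx
          · exact hm.ordered k ⟨i, by omega⟩ h x hx y (h3 ▸ List.getLast_mem h2)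
      refine (Finset.sum_le_sum hle).trans ?_
      refine (Finset.sum_le_sum_of_subset (Finset.subset_univ _)).trans ?_
      rw [hm.count, Finset.card_le_one]
      intro a ha b hb
      simp only [Finset.mem_filter, Finset.mem_univ, true_and, decide_eq_true_eq] at ha hb
      exact d.injective (hX (ha.trans hb.symm))
    rw [← Finset.add_sum_erase _ _ (Finset.mem_univ j)]
    omega

/-! ### Broadcasting the splitters -/

/-- The memories after `τ` rounds of the broadcast of the splitters `Y`. -/
structure Broadcasting (X : Fin p → List K) (Y : List K) (τ : ℕ) (m : Fin p → Mem p K) : Prop where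
  keys : ∀ k, (m k).keys = sortedKeys X k
  root : ∀ k : Fin p, k.val = 0 → (m k).splitters = Y
  splitters : ∀ k : Fin p, k.val ≠ 0 →
    (m k).splitters = Y.take ((τ + 1 - Nat.log 2 (k + 1)) * segment p)
  relay : ∀ k : Fin p, k.val ≠ 0 → (m k).relay =
    if Nat.log 2 (k + 1) ≤ τ then (Y.drop ((τ - Nat.log 2 (k + 1)) * segment p)).take (segment p)
    else []

theorem one_le_log_succ {k : ℕ} (hk : k ≠ 0) : 1 ≤ Nat.log 2 (k + 1) :=
  Nat.log_pos (by norm_num) (by omega)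

theorem log_child {j k : ℕ} (h : k = 2 * j + 1 ∨ k = 2 * j + 2) :
    Nat.log 2 (k + 1) = Nat.log 2 (j + 1) + 1 := by
  rw [Nat.log_of_one_lt_of_le (by norm_num) (by omega)]
  congr 2
  omega

/-- From a sorted sample to the beginning of the broadcast. -/
theorem within_gatherRound [NeZero p] (hp : 2 ≤ p) (hs : 0 < s)
    (hX : Function.Injective (drawnKey X)) :
    Within (HasSortedSample d) [gatherRound p]
      (fun m => ∃ Y, GoodSplitters d Y ∧ Broadcasting X Y 0 m) ((p - 1 : ℕ) : ℝ) (p - 1) := by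
  have hne : ∀ m, HasSortedSample d m → ∀ j : Fin p, j.val + 1 < p → (m j).sample ≠ [] := by
    intro m hm j hj h0
    have := hm.length j
    rw [h0, if_pos hj] at this
    simp at this
    omega
  have hr : ∀ m : Fin p → Mem p K, ∀ k : Fin p, k.val = 0 →
      ((List.finRange p).flatMap fun j => keysOf ((gatherRound (K := K) p).send j (m j) k)) =
        lastKeys fun k => (m k).sample := by
    intro m k hk
    simp only [gatherRound, lastKeys, hk, true_and]
    congr 1
    funext j
    split_ifs <;> simp
  refine Within.single ?_ ?_ ?_ ?_
  · intro m hm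
    refine ⟨_, hm.goodSplitters hs hX, fun k => ?_, fun k hk => ?_, fun k hk => ?_, fun k hk => ?_⟩
    · simp only [Round.next, gatherRound]
      split_ifs <;> exact hm.keys k
    · rw [← hr m k hk]
      simp only [Round.next, gatherRound, if_pos hk]
    · simp only [Round.next, gatherRound, if_neg hk]
      rw [hm.splitters k]
      have := one_le_log_succ hk
      rw [show 0 + 1 - Nat.log 2 (k.val + 1) = 0 by omega]
      simp
    · simp only [Round.next, gatherRound, if_neg hk]
      rw [hm.relay k, if_neg]
      have := one_le_log_succ hk
      omega
  · intro m hm k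
    by_cases hk : k.val = 0
    · have := hr m k hk
      have hlen := length_lastKeys (hne m hm)
      rw [← this] at hlen
      rw [← hlen]
      simp only [gatherRound, if_pos hk]
      exact le_rfl
    · simp only [gatherRound, if_neg hk]
      positivity
  · intro m hm k
    have h1 : ∀ j : Fin p, ((gatherRound (K := K) p).send k (m k) j).length ≤
        (if j.val = 0 then [()] else []).length := by
      intro j
      simp only [gatherRound]
      by_cases hj : j.val = 0
      · by_cases hk : k.val + 1 < p
        · cases h : (m k).sample.getLast? <;> simp [hj, hk]
        · simp [hk]
      · simp [hj]
    refine (Finset.sum_le_sum fun j _ => h1 j).trans ?_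
    refine (sum_length_ite_le (w := fun _ => [()]) (h := 1)
      (fun i j hi hj => Fin.ext (hi.trans hj.symm)) (by simp)).trans (by omega)
  · intro m hm k
    by_cases hk : k.val = 0
    · have := congrArg List.length (hr m k hk)
      rw [length_lastKeys (hne m hm), List.length_flatMap, ← Fin.sum_univ_def] at this
      rw [← this]
      refine Finset.sum_le_sum fun j _ => ?_
      simp only [gatherRound]
      split_ifs <;> simp
    · simp only [gatherRound, hk, false_and, if_false]
      simp

/-- The keys sent by processor `j` to its children in round `τ` of the broadcast. -/
theorem Broadcasting.sent {Y : List K} {τ : ℕ} {m : Fin p → Mem p K}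
    (hm : Broadcasting X Y τ m) (j : Fin p) :
    (if j.val = 0 then ((m j).splitters.drop (τ * segment p)).take (segment p) else (m j).relay) =
      if Nat.log 2 (j + 1) ≤ τ then (Y.drop ((τ - Nat.log 2 (j + 1)) * segment p)).take (segment p)
      else [] := by
  by_cases hj : j.val = 0
  · rw [if_pos hj, hm.root j hj, hj]
    simp
  · rw [if_neg hj, hm.relay j hj]

theorem Broadcasting.length_sent_le {Y : List K} {τ : ℕ} {m : Fin p → Mem p K}
    (hm : Broadcasting X Y τ m) (j : Fin p) :
    (if j.val = 0 then ((m j).splitters.drop (τ * segment p)).take (segment p)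
      else (m j).relay).length ≤ segment p := by
  rw [hm.sent]
  split_ifs
  · exact List.length_take_le _ _
  · simp

/-- The only sender to `k` is its parent `(k - 1) / 2`, one level higher in the tree, so the segment
reaches depth `D` exactly `D` rounds after the root has selected it. -/
theorem Broadcasting.received {Y : List K} {τ : ℕ} {m : Fin p → Mem p K}
    (hm : Broadcasting X Y τ m) (k : Fin p) (hk : k.val ≠ 0) :
    ((List.finRange p).flatMap fun j => keysOf ((broadcastRound (K := K) p τ).send j (m j) k)) =
      if Nat.log 2 (k + 1) ≤ τ + 1 then
        (Y.drop ((τ + 1 - Nat.log 2 (k + 1)) * segment p)).take (segment p) else [] := by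
  have hpar : ∀ j : Fin p, (k.val = 2 * j.val + 1 ∨ k.val = 2 * j.val + 2) ↔
      j = ⟨(k.val - 1) / 2, by have := k.isLt; omega⟩ := by
    intro j
    rw [Fin.ext_iff]
    simp only
    omega
  have h1 : ∀ j : Fin p, keysOf ((broadcastRound (K := K) p τ).send j (m j) k) =
      if k.val = 2 * j.val + 1 ∨ k.val = 2 * j.val + 2 then
        (if j.val = 0 then ((m j).splitters.drop (τ * segment p)).take (segment p)
          else (m j).relay) else [] := by
    intro j
    simp only [broadcastRound]
    by_cases h : k.val = 2 * j.val + 1 ∨ k.val = 2 * j.val + 2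
    · rw [if_pos h, if_pos h, keysOf_map_key]
    · rw [if_neg h, if_neg h, keysOf_nil]
  simp only [h1]
  rw [flatMap_finRange_ite _ hpar, hm.sent,
    log_child (k := k.val) (j := (k.val - 1) / 2) (by omega)]
  simp only [Nat.add_le_add_iff_right, Nat.add_sub_add_right]

/-- The factor `2` in the communication is for the two children; every processor receives at most
one segment. -/
theorem within_broadcastRound [NeZero p] (Y : List K) (τ : ℕ) :
    Within (Broadcasting X Y τ) [broadcastRound p τ] (Broadcasting X Y (τ + 1))
      (segment p) (2 * segment p) := by
  refine Within.single ?_ ?_ ?_ ?_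
  · intro m hm
    refine ⟨fun k => ?_, fun k hk => ?_, fun k hk => ?_, fun k hk => ?_⟩
    · simp only [Round.next, broadcastRound]
      split_ifs <;> exact hm.keys k
    · simp only [Round.next, broadcastRound, if_pos hk]
      exact hm.root k hk
    · have h1 := hm.received k hk
      have h2 : ((broadcastRound p τ).next m k).splitters = (m k).splitters ++
          (List.finRange p).flatMap fun j =>
            keysOf ((broadcastRound (K := K) p τ).send j (m j) k) := by
        simp only [Round.next, broadcastRound, if_neg hk]
      rw [h2, h1, hm.splitters k hk]
      split_ifs with h
      · rw [show τ + 1 + 1 - Nat.log 2 (k.val + 1) = τ + 1 - Nat.log 2 (k.val + 1) + 1 by omega,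
          add_mul _ 1, one_mul, List.take_add]
      · rw [show τ + 1 + 1 - Nat.log 2 (k.val + 1) = 0 by omega,
          show τ + 1 - Nat.log 2 (k.val + 1) = 0 by omega]
        simp
    · have h1 := hm.received k hk
      rw [← h1]
      simp only [Round.next, broadcastRound, if_neg hk]
  · intro m hm k
    by_cases hk : k.val = 0
    · simp only [broadcastRound, if_pos hk]
      positivity
    · have h1 := congrArg List.length (hm.received k hk)
      have h2 : ((List.finRange p).flatMap fun j =>
          keysOf ((broadcastRound (K := K) p τ).send j (m j) k)).length ≤ segment p := by
        rw [h1]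
        split_ifs
        · exact List.length_take_le _ _
        · simp
      simp only [broadcastRound, if_neg hk] at h2 ⊢
      exact_mod_cast h2
  · intro m hm k
    have h1 : ∀ j : Fin p, ((broadcastRound (K := K) p τ).send k (m k) j).length ≤
        (if j.val = 2 * k.val + 1 then List.replicate (segment p) () else []).length +
        (if j.val = 2 * k.val + 2 then List.replicate (segment p) () else []).length := by
      intro j
      have := hm.length_sent_le k
      simp only [broadcastRound]
      split_ifs <;> simp_all
    refine (Finset.sum_le_sum fun j _ => h1 j).trans ?_
    rw [Finset.sum_add_distrib, two_mul (segment p)]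
    refine add_le_add ?_ ?_
    · exact sum_length_ite_le (fun i j hi hj => Fin.ext (hi.trans hj.symm)) (by simp)
    · exact sum_length_ite_le (fun i j hi hj => Fin.ext (hi.trans hj.symm)) (by simp)
  · intro m hm k
    have h1 : ∑ j, ((broadcastRound (K := K) p τ).send j (m j) k).length ≤ segment p := by
      simp only [broadcastRound]
      refine sum_length_ite_le (fun i j hi hj => Fin.ext (by omega)) fun j _ => ?_
      rw [List.length_map]
      exact hm.length_sent_le j
    omega

theorem within_broadcastRounds [NeZero p] (Y : List K) (T : ℕ) :
    Within (Broadcasting X Y 0) ((List.range T).map (broadcastRound p)) (Broadcasting X Y T)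
      (T * segment p) (T * (2 * segment p)) := by
  induction T with
  | zero => simpa using Within.nil (Broadcasting X Y 0)
  | succ T ih =>
    have h := ih.append (within_broadcastRound Y T)
    rw [List.range_succ, List.map_append]
    have e1 : (T : ℝ) * segment p + segment p = (T + 1 : ℕ) * segment p := by push_cast; ring
    have e2 : T * (2 * segment p) + 2 * segment p = (T + 1) * (2 * segment p) := by ring
    rw [e1, e2] at h
    exact h

end Splitters

/-! ### Partition, routing and the total cost -/

section Routing

variable {K : Type*} [LinearOrder K] {p s : ℕ} {X : Fin p → List K} (d : Draws X s)

/-- The memories after the broadcast of the splitters `Y`. -/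
structure AfterBroadcast (X : Fin p → List K) (Y : List K) (m : Fin p → Mem p K) : Prop where
  keys : ∀ k, (m k).keys = sortedKeys X k
  splitters : ∀ k, (m k).splitters = Y

theorem treeDepth_pos (hp : 2 ≤ p) : 0 < treeDepth p := Nat.log_pos (by norm_num) hp

theorem segment_pos (hp : 2 ≤ p) : 0 < segment p := by
  have h1 : p - 1 ≤ treeDepth p • segment p := le_smul_ceilDiv (treeDepth_pos hp)
  rw [smul_eq_mul] at h1
  by_contra! h0
  rw [Nat.le_zero.1 h0, mul_zero] at h1
  omega

/-- After `T` rounds depth `D` has `T + 1 - D` segments. Since `D ≤ treeDepth p`, the chosen `T`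
leaves at least as many as there are segments. -/
theorem Broadcasting.afterBroadcast {Y : List K} {m : Fin p → Mem p K} (hp : 2 ≤ p)
    (hY : Y.length = p - 1)
    (hm : Broadcasting X Y ((p - 1) ⌈/⌉ segment p + treeDepth p - 1) m) :
    AfterBroadcast X Y m := by
  refine ⟨hm.keys, fun k => ?_⟩
  by_cases hk : k.val = 0
  · exact hm.root k hk
  · rw [hm.splitters k hk]
    apply List.take_of_length_le
    have h1 : p - 1 ≤ segment p • ((p - 1) ⌈/⌉ segment p) := le_smul_ceilDiv (segment_pos hp)
    have h2 : Nat.log 2 (k + 1) ≤ treeDepth p := Nat.log_mono_right k.isLt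
    have h3 := treeDepth_pos hp
    rw [hY]
    refine h1.trans ?_
    rw [smul_eq_mul, mul_comm]
    exact Nat.mul_le_mul_right _ (by omega)

/-- The position in the sorted list `l` at which subsequence `j` starts, for the splitters `Y`. -/
noncomputable def cut (Y l : List K) (j : ℕ) : ℕ :=
  (0 :: Y.map fun y => (binSearch l y).val)[j]?.getD l.length

theorem cut_succ (Y l : List K) (j : ℕ) :
    cut Y l (j + 1) = (Y[j]?.map fun y => (binSearch l y).val).getD l.length := by
  simp [cut]

theorem binSearch_val_le (l : List K) (y : K) : (binSearch l y).val ≤ l.length :=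
  List.countP_le_length

theorem cut_le (Y l : List K) (j : ℕ) : cut Y l j ≤ l.length := by
  cases j with
  | zero => simp [cut]
  | succ j =>
    rw [cut_succ]
    cases Y[j]? with
    | none => simp
    | some y => exact binSearch_val_le l y

theorem cut_mono {Y : List K} (hY : Y.Pairwise (· ≤ ·)) (l : List K) : Monotone (cut Y l) := by
  refine monotone_nat_of_le_succ fun j => ?_
  cases j with
  | zero => simp [cut]
  | succ j =>
    rcases Nat.lt_or_ge (j + 1) Y.length with h | h
    · rw [cut_succ, cut_succ, List.getElem?_eq_getElem h,
        List.getElem?_eq_getElem (show j < Y.length by omega)]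
      refine List.countP_mono_left fun x _ hx => ?_
      simp only [decide_eq_true_eq] at hx ⊢
      exact hx.trans_le (List.pairwise_iff_getElem.1 hY j (j + 1) (by omega) h (by omega))
    · rw [cut_succ Y l (j + 1), List.getElem?_eq_none h]
      exact cut_le Y l _

theorem countP_le_add {α : Type*} {P Q R : α → Bool} (h : ∀ x, P x → Q x ∨ R x) (l : List α) :
    l.countP P ≤ l.countP Q + l.countP R := by
  induction l with
  | nil => simp
  | cons a l ih =>
    have := h a
    simp only [List.countP_cons]
    cases hP : P a <;> cases hQ : Q a <;> cases hR : R a <;> simp_all <;> omega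

open Classical in
-- A key below splitter `j + 1` is in bucket `j` or below splitter `j`. Comparing counts avoids
-- identifying the segment between the two cuts, so `l` need not be sorted.
theorem cut_sub_cut_le (Y l : List K) (j : ℕ) :
    cut Y l (j + 1) - cut Y l j ≤ l.countP fun x => decide (InBucket Y j x) := by
  have h1 : cut Y l (j + 1) = l.countP fun x => decide (∀ y, Y[j]? = some y → x < y) := by
    rw [cut_succ]
    cases Y[j]? with
    | none => simp
    | some y => simp [binSearch]
  have h2 : (l.countP fun x => decide (∃ i y, i + 1 = j ∧ Y[i]? = some y ∧ x < y)) ≤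
      cut Y l j := by
    cases j with
    | zero => simp
    | succ j =>
      rw [cut_succ]
      cases hy : Y[j]? with
      | none => simpa using List.countP_le_length
      | some y => simp [binSearch, hy]
  have h3 := countP_le_add (P := fun x => decide (∀ y, Y[j]? = some y → x < y))
    (Q := fun x => decide (InBucket Y j x))
    (R := fun x => decide (∃ i y, i + 1 = j ∧ Y[i]? = some y ∧ x < y)) (by
      intro x hx
      simp only [decide_eq_true_eq] at hx ⊢
      by_cases hR : ∃ i y, i + 1 = j ∧ Y[i]? = some y ∧ x < y
      · exact Or.inr hR
      · push Not at hR
        exact Or.inl ⟨hR, hx⟩) l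
  omega

/-- The memories after the partition of the keys. -/
def AfterPartition (X : Fin p → List K) (Y : List K) (m : Fin p → Mem p K) : Prop :=
  ∀ k j, (m k).buckets j = ((sortedKeys X k).drop (cut Y (sortedKeys X k) j)).take
    (cut Y (sortedKeys X k) (j + 1) - cut Y (sortedKeys X k) j)

theorem within_partitionRound [NeZero p] {Y : List K} {M : ℕ} (hM : ∀ k, (X k).length ≤ M) :
    Within (AfterBroadcast X Y) [partitionRound p] (AfterPartition X Y)
      (Y.length * ⌈lg (M + 1)⌉₊) 0 := by
  refine Within.single ?_ ?_ ?_ ?_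
  · intro m hm k j
    simp only [Round.next, partitionRound, hm.keys, hm.splitters]
    rfl
  · intro m hm k
    simp only [partitionRound, hm.keys, hm.splitters, binSearch, List.map_const', List.sum_replicate,
      nsmul_eq_mul, length_sortedKeys]
    have h1 : lg ((X k).length + 1) ≤ lg (M + 1) :=
      lg_mono (by positivity) (by exact_mod_cast Nat.add_le_add_right (hM k) 1)
    gcongr
  · intro m hm k; simp [partitionRound]
  · intro m hm k; simp [partitionRound]

theorem sortedKeys_eq_map (k : Fin p) :
    sortedKeys X k = (List.finRange (X k).length).map fun i => drawnKey X ⟨k, i⟩ := by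
  refine List.ext_getElem (by simp [length_sortedKeys]) fun i h1 h2 => ?_
  simp [drawnKey]

theorem sum_countP_sortedKeys (q : K → Bool) :
    ∑ k, (sortedKeys X k).countP q = {a | q (drawnKey X a) = true}.ncard := by
  have h1 : {a | q (drawnKey X a) = true} =
      ((Finset.univ.filter fun a => q (drawnKey X a) = true :
        Finset (Σ k : Fin p, Fin (X k).length)) : Set _) := by
    ext; simp
  rw [h1, Set.ncard_coe_finset, Finset.card_filter, Fintype.sum_sigma]
  refine Finset.sum_congr rfl fun k _ => ?_
  rw [sortedKeys_eq_map, List.countP_map, List.countP_eq_length_filter, length_filter_finRange,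
    Finset.card_filter]
  rfl

theorem injective_drawnKey (hX : ((List.finRange p).flatMap X).Nodup) :
    Function.Injective (drawnKey X) := by
  rw [List.nodup_flatMap] at hX
  obtain ⟨h1, h2⟩ := hX
  rintro ⟨k, i⟩ ⟨k', i'⟩ h
  have hmem : ∀ a : Σ k : Fin p, Fin (X k).length, drawnKey X a ∈ X a.1 := fun a =>
    (sortSeq_perm (X a.1)).mem_iff.1 (List.getElem_mem _)
  have hk : k = k' := by
    by_contra hne
    have h3 := (List.pairwise_iff_getElem.1 h2)
    have key : ∀ a b : Fin p, a < b → List.Disjoint (X a) (X b) := fun a b hab => by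
      simpa using h3 a b (by simp) (by simp) hab
    rcases lt_or_gt_of_ne hne with hlt | hlt
    · exact key _ _ hlt (hmem ⟨k, i⟩) (h ▸ hmem ⟨k', i'⟩)
    · exact key _ _ hlt (hmem ⟨k', i'⟩) (h ▸ hmem ⟨k, i⟩)
  subst hk
  have hnd : (sortedKeys X k).Nodup := (sortSeq_perm (X k)).nodup_iff.2 (h1 k (List.mem_finRange k))
  have : i.val = i'.val := (List.Nodup.getElem_inj_iff hnd).1 h
  rw [Fin.ext this]

/-- What a processor receives is at most its whole bucket, an interval with at most `s` sample keys.
What it sends telescopes over the cuts to at most its own list. -/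
theorem within_routeRound [NeZero p] {Y : List K} (hY : GoodSplitters d Y) {M B : ℕ}
    (hM : ∀ k, (X k).length ≤ M) (hMB : M ≤ B)
    (hB : ∀ I : Set K, I.OrdConnected → {i | drawnKey X (d i) ∈ I}.ncard ≤ s →
      {a | drawnKey X a ∈ I}.ncard ≤ B) :
    Within (AfterPartition X Y) [routeRound p] (fun _ => True) (B * lg p) B := by
  classical
  have hlen : ∀ m : Fin p → Mem p K, AfterPartition X Y m → ∀ k j, ((m k).buckets j).length ≤
      cut Y (sortedKeys X k) (j + 1) - cut Y (sortedKeys X k) j := by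
    intro m hm k j
    rw [hm k j]
    exact List.length_take_le _ _
  have hrec : ∀ m : Fin p → Mem p K, AfterPartition X Y m → ∀ k,
      ∑ j, ((m j).buckets k).length ≤ B := by
    intro m hm k
    have h1 := hB _ (ordConnected_inBucket Y k) (hY.few k)
    refine le_trans ?_ h1
    have h2 := sum_countP_sortedKeys (X := X) fun x => decide (InBucket Y k x)
    simp only [decide_eq_true_eq] at h2
    change _ ≤ {a | InBucket Y k (drawnKey X a)}.ncard
    rw [← h2]
    exact Finset.sum_le_sum fun j _ => (hlen m hm j k).trans (cut_sub_cut_le Y _ k)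
  refine Within.single (fun _ _ => trivial) ?_ ?_ ?_
  · intro m hm k
    have h1 := hrec m hm k
    simp only [routeRound, mergeSeq, keysOf_map_key, List.length_map, List.length_finRange,
      List.length_flatten, List.map_map, Function.comp_def]
    rw [← Fin.sum_univ_def]
    exact mul_le_mul_of_nonneg_right (by exact_mod_cast h1) (natCast_lg_nonneg p)
  · intro m hm k
    simp only [routeRound, List.length_map]
    refine (Finset.sum_le_sum fun j _ => hlen m hm k j).trans ?_
    rw [Fin.sum_univ_eq_sum_range
      (fun j => cut Y (sortedKeys X k) (j + 1) - cut Y (sortedKeys X k) j) p,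
      Finset.sum_range_tsub (cut_mono hY.sorted _)]
    refine (Nat.sub_le _ _).trans ((cut_le _ _ _).trans ?_)
    rw [length_sortedKeys]
    exact (hM k).trans hMB
  · intro m hm k
    simp only [routeRound, List.length_map]
    exact hrec m hm k

/-- The number of rounds of the broadcast. -/
def broadcastLength (p : ℕ) : ℕ := (p - 1) ⌈/⌉ segment p + treeDepth p - 1

theorem within_rounds [NeZero p] (hp : 2 ≤ p) (hs : 0 < s) (hX : Function.Injective (drawnKey X))
    {R M B : ℕ} (hsR : s ≤ R) (hR : ∀ k, (Finset.univ.filter fun i => (d i).1 = k).card ≤ R)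
    (hM : ∀ k, (X k).length ≤ M) (hMB : M ≤ B)
    (hB : ∀ I : Set K, I.OrdConnected → {i | drawnKey X (d i) ∈ I}.ncard ≤ s →
      {a | drawnKey X a ∈ I}.ncard ≤ B) :
    Within (AfterSort (X := X)) ([requestRound p s d.pairs, replyRound p]
      ++ (bitonicStages (Nat.clog 2 p)).map (exchangeRound p s)
      ++ [gatherRound p]
      ++ (List.range ((p - 1) ⌈/⌉ segment p + treeDepth p - 1)).map (broadcastRound p)
      ++ [partitionRound p, routeRound p]) (fun _ => True)
      (R + s * lg s + (bitonicStages (Nat.clog 2 p)).length * (2 * s) + (p - 1 : ℕ) +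
        (broadcastLength p * segment p + ((p - 1 : ℕ) * ⌈lg (M + 1)⌉₊ + B * lg p)))
      (R + R + (bitonicStages (Nat.clog 2 p)).length * s + (p - 1) +
        (broadcastLength p * (2 * segment p) + (0 + B))) := by
  have h1 := (((within_requestRound d hs hsR hR).append (within_replyRound d hs hsR hR)).append
    (within_bitonicSorter d)).append (within_gatherRound d hp hs hX)
  have h2 : Within (fun m => ∃ Y, GoodSplitters d Y ∧ Broadcasting X Y 0 m)
      ((List.range ((p - 1) ⌈/⌉ segment p + treeDepth p - 1)).map (broadcastRound p) ++
        ([partitionRound p] ++ [routeRound p])) (fun _ => True)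
      (broadcastLength p * segment p + ((p - 1 : ℕ) * ⌈lg (M + 1)⌉₊ + B * lg p))
      (broadcastLength p * (2 * segment p) + (0 + B)) := by
    -- The splitters are fixed only here, as they depend on the memories after the gathering round;
    -- the remaining triples hold for each fixed `Y`.
    rintro m ⟨Y, hY, hm⟩
    have h3 : Within (Broadcasting X Y (broadcastLength p)) [partitionRound p]
        (AfterPartition X Y) ((p - 1 : ℕ) * ⌈lg (M + 1)⌉₊) 0 := by
      intro m hm
      have := within_partitionRound hM m (hm.afterBroadcast hp hY.length)
      rwa [hY.length] at this
    exact (within_broadcastRounds Y (broadcastLength p)).append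
      (h3.append (within_routeRound d hY hM hMB hB)) m hm
  have h3 := h1.append h2
  simpa only [List.append_assoc, List.cons_append, List.nil_append] using h3

/-- The cost of the algorithm when no processor receives more than `R` requests and no
subsequence has more than `B` keys. -/
theorem cost_le (hp : 2 ≤ p) (hs : 0 < s) (hX : Function.Injective (drawnKey X))
    {R M B : ℕ} (hsR : s ≤ R) (hR : ∀ k, (Finset.univ.filter fun i => (d i).1 = k).card ≤ R)
    (hM : ∀ k, (X k).length ≤ M) (hMB : M ≤ B)
    (hB : ∀ I : Set K, I.OrdConnected → {i | drawnKey X (d i) ∈ I}.ncard ≤ s →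
      {a | drawnKey X a ∈ I}.ncard ≤ B) {L g : ℝ} (hL : 0 ≤ L) (hg : 0 ≤ g) :
    compTime (algorithm p s d.pairs) (initial X) ≤ (M * lg M + s) +
      (R + s * lg s + (bitonicStages (Nat.clog 2 p)).length * (2 * s) + (p - 1 : ℕ) +
        (broadcastLength p * segment p + ((p - 1 : ℕ) * ⌈lg (M + 1)⌉₊ + B * lg p))) ∧
    commTime L g (algorithm p s d.pairs) (initial X) ≤
      (((bitonicStages (Nat.clog 2 p)).length + broadcastLength p + 5 : ℕ) + 1) * L +
      g * (R + R + (bitonicStages (Nat.clog 2 p)).length * s + (p - 1) +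
        (broadcastLength p * (2 * segment p) + (0 + B)) : ℕ) := by
  have : NeZero p := ⟨by omega⟩
  have hW := within_rounds d hp hs hX hsR hR hM hMB hB
    (fun k => (localSort p s d.pairs k ((initial X).mem k) ((initial X).inbox k)).val)
    (fun k => rfl)
  constructor
  · rw [algorithm, compTime_supersteps]
    refine add_le_add (ciSup_le fun k => add_le_add ?_ ?_) hW.2.1
    · exact mul_lg_mono (hM k)
    · exact_mod_cast length_drawsOf_le _ hs k
  · rw [algorithm]
    refine (commTime_supersteps_le hL hg _ _ _).trans ?_
    refine add_le_add (mul_le_mul_of_nonneg_right ?_ hL)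
      (mul_le_mul_of_nonneg_left (by exact_mod_cast hW.2.2) hg)
    -- The `5` stands for the rounds of requests, replies, gathering, partition and routing; the
    -- further `1` is the initial superstep.
    simp only [List.length_append, List.length_map, List.length_range, List.length_cons,
      List.length_nil, broadcastLength]
    push_cast
    linarith

end Routing

/-! ### Numerical estimates of the cost -/

/-- The range of the parameters, for large `n`. -/
structure Admissible (n p : ℕ) (ω : ℝ) : Prop where
  large : 2 ^ 20 ≤ n
  log_le : 6 * lg n ≤ (n : ℝ) ^ (0.06 : ℝ)
  two_le : 2 ≤ p
  one_le : 1 ≤ ω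
  sample : 4 * p * ω ^ 2 * lg n < n
  procs : (p : ℝ) ^ 2 * ω * lg n ≤ n

namespace Admissible

variable {n p : ℕ} {ω : ℝ}

theorem pos (h : Admissible n p ω) : (0 : ℝ) < n := by
  have := h.large
  exact_mod_cast (show 0 < n by omega)

theorem twenty_le_lg (h : Admissible n p ω) : 20 ≤ lg n := by
  have h1 : (2 : ℝ) ^ (20 : ℝ) ≤ n := by
    have := h.large
    rw [show (20 : ℝ) = ((20 : ℕ) : ℝ) by norm_num, Real.rpow_natCast]
    exact_mod_cast this
  exact (Real.le_logb_iff_rpow_le (by norm_num) h.pos).2 h1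

theorem p_pos (h : Admissible n p ω) : (2 : ℝ) ≤ p := by exact_mod_cast h.two_le

theorem one_le_lg_p (h : Admissible n p ω) : 1 ≤ lg p := by
  rw [← lg_two]
  exact lg_mono (by norm_num) h.p_pos

theorem p_sq_le (h : Admissible n p ω) : (p : ℝ) ^ 2 ≤ n := by
  have h1 := h.twenty_le_lg
  have h2 := h.one_le
  have h3 : (1 : ℝ) ≤ ω * lg n := by nlinarith
  have h4 := h.procs
  have h5 : (0 : ℝ) ≤ (p : ℝ) ^ 2 := by positivity
  nlinarith

theorem p_le (h : Admissible n p ω) : p ≤ n := by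
  have h1 := h.p_sq_le
  have h2 := h.p_pos
  have : (p : ℝ) ≤ n := by nlinarith
  exact_mod_cast this

theorem lg_p_le (h : Admissible n p ω) : lg p ≤ lg n := natCast_lg_mono h.p_le

theorem omega_sq_le (h : Admissible n p ω) : ω ^ 2 ≤ n := by
  have h1 := h.twenty_le_lg
  have h2 := h.p_pos
  have h4 := h.sample
  have h5 : 1 ≤ 4 * p * lg n := by nlinarith
  have h6 : 0 ≤ ω ^ 2 := by positivity
  nlinarith

theorem le_oversampling (ω : ℝ) (n : ℕ) : 2 * ω ^ 2 * lg n ≤ oversampling ω n := Nat.le_ceil _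

theorem oversampling_le (h : Admissible n p ω) :
    (oversampling ω n : ℝ) ≤ 2 * ω ^ 2 * lg n + 1 := by
  have h1 := h.twenty_le_lg
  exact (Nat.ceil_lt_add_one (by positivity)).le

theorem one_le_sq_mul_lg (h : Admissible n p ω) : 1 ≤ ω ^ 2 * lg n := by
  have h1 := h.twenty_le_lg
  have h2 := h.one_le
  have : 1 ≤ ω ^ 2 := by nlinarith
  nlinarith

theorem oversampling_le' (h : Admissible n p ω) :
    (oversampling ω n : ℝ) ≤ 3 * (ω ^ 2 * lg n) := by
  have h1 := h.oversampling_le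
  have h2 := h.one_le_sq_mul_lg
  linarith

theorem oversampling_mul_le (h : Admissible n p ω) : oversampling ω n * p ≤ n := by
  have h1 := h.oversampling_le'
  have h2 := h.sample
  have h3 := h.p_pos
  have : (oversampling ω n : ℝ) * p ≤ n := by nlinarith
  exact_mod_cast this

theorem two_lg_le_oversampling (h : Admissible n p ω) : 2 * lg n ≤ oversampling ω n := by
  have h1 := h.twenty_le_lg
  have h2 := h.one_le
  have h3 : 1 ≤ ω ^ 2 := by nlinarith
  have := le_oversampling ω n
  nlinarith

theorem oversampling_pos (h : Admissible n p ω) : 0 < oversampling ω n := by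
  have h1 := h.twenty_le_lg
  have h2 := h.two_lg_le_oversampling
  have : (0 : ℝ) < oversampling ω n := by linarith
  exact_mod_cast this

theorem p_div_le (h : Admissible n p ω) : (p : ℝ) / n ≤ 1 / (ω * lg n) := by
  have h1 := h.twenty_le_lg
  have h2 := h.one_le
  have h3 := h.procs
  have h4 := h.p_pos
  have h5 : 0 ≤ ω * lg n := by positivity
  rw [div_le_div_iff₀ h.pos (by positivity)]
  have : (p : ℝ) * (ω * lg n) ≤ (p : ℝ) ^ 2 * (ω * lg n) := by
    apply mul_le_mul_of_nonneg_right _ h5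
    nlinarith
  linarith

theorem p_sq_div_le (h : Admissible n p ω) : (p : ℝ) ^ 2 / n ≤ 1 / (ω * lg n) := by
  have h1 := h.twenty_le_lg
  have h2 := h.one_le
  have h3 := h.procs
  rw [div_le_div_iff₀ h.pos (by positivity)]
  linarith

theorem rpow_div_sqrt_sq (h : Admissible n p ω) :
    (ω ^ (3 / 2 : ℝ) / √(n * lg n)) ^ 2 = ω ^ 3 / (n * lg n) := by
  have h1 := h.twenty_le_lg
  have h2 := h.one_le
  have h3 := h.pos
  rw [div_pow, Real.sq_sqrt (by positivity), ← Real.rpow_natCast, ← Real.rpow_mul (by positivity)]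
  norm_num

/-- After squaring, this is the hypothesis `p² ω lg n ≤ n`. -/
theorem sample_div_le (h : Admissible n p ω) :
    p * ω ^ 2 / n ≤ ω ^ (3 / 2 : ℝ) / √(n * lg n) := by
  have h1 := h.twenty_le_lg
  have h2 := h.one_le
  have h3 := h.pos
  refine (pow_le_pow_iff_left₀ (by positivity) (by positivity) two_ne_zero).1 ?_
  rw [h.rpow_div_sqrt_sq, div_pow, div_le_div_iff₀ (by positivity) (by positivity)]
  have h4 := h.procs
  have h5 : (0 : ℝ) ≤ ω ^ 3 * n := by positivity
  have := mul_le_mul_of_nonneg_left h4 h5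
  nlinarith

theorem lg_cube_le (h : Admissible n p ω) : lg n ^ 3 ≤ (n : ℝ) ^ (1 / 4 : ℝ) := by
  have h1 := h.twenty_le_lg
  have h2 := h.log_le
  have hn : (1 : ℝ) ≤ n := by
    have := h.large
    exact_mod_cast (show 1 ≤ n by omega)
  calc lg n ^ 3 ≤ ((n : ℝ) ^ (0.06 : ℝ)) ^ 3 := by
        gcongr
        linarith
    _ = (n : ℝ) ^ (0.18 : ℝ) := by
        rw [← Real.rpow_natCast, ← Real.rpow_mul (by positivity)]
        norm_num
    _ ≤ _ := Real.rpow_le_rpow_of_exponent_le hn (by norm_num)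

/-- Sorting a block of the sample costs a factor `lg n`, but the error term offers only `lg p`. If
`lg n ≤ 8 lg p`, the loss is constant. Otherwise `p² ≤ n ^ (1/4)`, and with `ω ≤ √n` and `lg³ n ≤ n
^ (1/4)` even the bound without `lg p` holds. -/
theorem sample_lg_div_le (h : Admissible n p ω) :
    p * ω ^ 2 * lg n / n ≤ 8 * (ω ^ (3 / 2 : ℝ) / √(n * lg n) * lg p) := by
  have h1 := h.twenty_le_lg
  have h2 := h.one_le
  have h3 := h.pos
  have hlp := h.one_le_lg_p
  set W := ω ^ (3 / 2 : ℝ) / √(n * lg n)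
  have hW : 0 ≤ W := by positivity
  rcases le_total (lg n) (8 * lg p) with hle | hle
  · have h4 := h.sample_div_le
    calc p * ω ^ 2 * lg n / n = p * ω ^ 2 / n * lg n := by ring
      _ ≤ W * (8 * lg p) := by gcongr
      _ = _ := by ring
  · have hp8 : (p : ℝ) ^ 2 ≤ (n : ℝ) ^ (1 / 4 : ℝ) := by
      have h5 : lg ((p : ℝ) ^ 8) ≤ lg n := by
        rw [lg, Real.logb_pow]; exact_mod_cast hle
      have hp0 : (0 : ℝ) < p := by linarith [h.p_pos]
      have h6 : (p : ℝ) ^ 8 ≤ n :=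
        (Real.logb_le_logb (by norm_num) (by positivity) h3).1 h5
      calc (p : ℝ) ^ 2 = ((p : ℝ) ^ 8) ^ (1 / 4 : ℝ) := by
            rw [← Real.rpow_natCast, ← Real.rpow_natCast, ← Real.rpow_mul hp0.le]
            norm_num
        _ ≤ _ := Real.rpow_le_rpow (by positivity) h6 (by norm_num)
    have hω : ω ≤ (n : ℝ) ^ (1 / 2 : ℝ) := by
      rw [← Real.sqrt_eq_rpow]
      exact Real.le_sqrt_of_sq_le h.omega_sq_le
    have key : (p : ℝ) ^ 2 * ω * lg n ^ 3 ≤ n := by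
      calc (p : ℝ) ^ 2 * ω * lg n ^ 3 ≤
          (n : ℝ) ^ (1 / 4 : ℝ) * (n : ℝ) ^ (1 / 2 : ℝ) * (n : ℝ) ^ (1 / 4 : ℝ) := by
            have := h.lg_cube_le
            gcongr
        _ = n := by
            rw [← Real.rpow_add h3, ← Real.rpow_add h3]
            norm_num
    have h7 : p * ω ^ 2 * lg n / n ≤ W := by
      refine (pow_le_pow_iff_left₀ (by positivity) hW two_ne_zero).1 ?_
      rw [h.rpow_div_sqrt_sq, div_pow, div_le_div_iff₀ (by positivity) (by positivity)]
      have h5 : (0 : ℝ) ≤ ω ^ 3 * n := by positivity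
      have := mul_le_mul_of_nonneg_left key h5
      nlinarith
    nlinarith

/-- The number of words of the sample per processor. -/
theorem oversampling_cost (h : Admissible n p ω) :
    p * oversampling ω n / (n * lg n) ≤ 3 * (ω ^ (3 / 2 : ℝ) / √(n * lg n) * lg p) := by
  have h1 := h.twenty_le_lg
  have h2 := h.one_le
  have h3 := h.pos
  have hlp := h.one_le_lg_p
  have h4 := h.sample_div_le
  have h5 := h.oversampling_le'
  calc p * oversampling ω n / (n * lg n) ≤ p * (3 * (ω ^ 2 * lg n)) / (n * lg n) := by gcongr
    _ = 3 * (p * ω ^ 2 / n * 1) := by field_simp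
    _ ≤ _ := by gcongr

theorem sampleSort_cost (h : Admissible n p ω) :
    p * (oversampling ω n * lg (oversampling ω n)) / (n * lg n) ≤
      24 * (ω ^ (3 / 2 : ℝ) / √(n * lg n) * lg p) := by
  have h1 := h.twenty_le_lg
  have h2 := h.one_le
  have h3 := h.pos
  have h4 := h.sample_lg_div_le
  have h5 := h.oversampling_le'
  have hs : oversampling ω n ≤ n := by
    have := h.oversampling_mul_le
    have := h.two_le
    nlinarith
  have h6 := natCast_lg_mono hs
  have h7 := natCast_lg_nonneg (oversampling ω n)
  calc p * (oversampling ω n * lg (oversampling ω n)) / (n * lg n) ≤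
        p * (3 * (ω ^ 2 * lg n) * lg n) / (n * lg n) := by gcongr
    _ = 3 * (p * ω ^ 2 * lg n / n) := by field_simp
    _ ≤ _ := by linarith

theorem clog_le_lg (hp : 2 ≤ p) : (Nat.clog 2 p : ℝ) ≤ lg p + 1 := by
  have h := Real.natCeil_logb_natCast 2 p
  rw [← h]
  exact (Nat.ceil_lt_add_one (lg_nonneg (by exact_mod_cast (by omega : 1 ≤ p)))).le

theorem two_mul_stages_le (h : Admissible n p ω) :
    2 * ((bitonicStages (Nat.clog 2 p)).length : ℝ) ≤ lg p ^ 2 + 3 * lg p + 2 := by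
  have h1 := clog_le_lg h.two_le
  have h2 : ((bitonicStages (Nat.clog 2 p)).length : ℝ) * 2 =
      Nat.clog 2 p * (Nat.clog 2 p + 1) := by exact_mod_cast length_bitonicStages _
  have h3 := h.one_le_lg_p
  nlinarith [Nat.cast_nonneg (α := ℝ) (Nat.clog 2 p)]

/-- The leading product `(lg² p / 2) (2 ω² lg n)` gives the main term. The lower-order stages and
the rounding of `s` cost at most `8 ω² lg p lg n`. -/
theorem bitonic_cost (h : Admissible n p ω) :
    p * ((bitonicStages (Nat.clog 2 p)).length * oversampling ω n) / (n * lg n) ≤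
      p * ω ^ 2 * lg p ^ 2 / n + 8 * (ω ^ (3 / 2 : ℝ) / √(n * lg n) * lg p) := by
  have h1 := h.twenty_le_lg
  have h2 := h.one_le
  have h3 := h.pos
  have h4 := h.oversampling_le
  have h5 := h.two_mul_stages_le
  have h6 := h.one_le_lg_p
  have h7 := h.lg_p_le
  have h8 := h.sample_div_le
  have h9 : 1 ≤ ω ^ 2 := by nlinarith
  have key : ((bitonicStages (Nat.clog 2 p)).length * oversampling ω n : ℝ) ≤
      ω ^ 2 * lg p ^ 2 * lg n + 8 * (ω ^ 2 * lg p * lg n) := by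
    have hb : ((bitonicStages (Nat.clog 2 p)).length : ℝ) ≤ (lg p ^ 2 + 3 * lg p + 2) / 2 := by
      linarith
    have e1 : lg p ^ 2 ≤ lg p * lg n := by nlinarith
    have e2 : lg p ≤ lg p * lg n := by nlinarith
    have e3 : lg p * lg n ≤ ω ^ 2 * (lg p * lg n) := by
      apply le_mul_of_one_le_left (by positivity) h9
    have e4 : ω ^ 2 * lg n ≤ ω ^ 2 * lg p * lg n := by
      have : 0 ≤ ω ^ 2 * lg n := by positivity
      nlinarith
    calc ((bitonicStages (Nat.clog 2 p)).length * oversampling ω n : ℝ) ≤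
        (lg p ^ 2 + 3 * lg p + 2) / 2 * (2 * ω ^ 2 * lg n + 1) := by gcongr
      _ ≤ _ := by nlinarith
  calc p * ((bitonicStages (Nat.clog 2 p)).length * oversampling ω n) / (n * lg n) ≤
      p * (ω ^ 2 * lg p ^ 2 * lg n + 8 * (ω ^ 2 * lg p * lg n)) / (n * lg n) := by gcongr
    _ = p * ω ^ 2 * lg p ^ 2 / n + 8 * (p * ω ^ 2 / n * lg p) := by field_simp
    _ ≤ _ := by gcongr

theorem ceilDiv_le (h : Admissible n p ω) : ((n ⌈/⌉ p : ℕ) : ℝ) ≤ n / p + 1 := by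
  have hp := h.two_le
  have hp0 := h.p_pos
  rw [Nat.ceilDiv_eq_add_pred_div]
  refine Nat.cast_div_le.trans ?_
  have h1 : ((n + p - 1 : ℕ) : ℝ) ≤ n + p := by
    exact_mod_cast Nat.sub_le (n + p) 1
  calc ((n + p - 1 : ℕ) : ℝ) / p ≤ (n + p) / p := by gcongr
    _ = _ := by field_simp

/-- A local list has at most `(n / p)(1 + x)` keys with `x = p / n`. The gain `-lg p / lg n` must be
kept, since it cancels the main term of the final merge. -/
theorem localSort_cost (h : Admissible n p ω) :
    p * ((n ⌈/⌉ p : ℕ) * lg (n ⌈/⌉ p : ℕ)) / (n * lg n) ≤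
      1 - lg p / lg n + 5 * (1 / (ω * lg n)) := by
  have h1 := h.twenty_le_lg
  have h2 := h.one_le
  have h3 := h.pos
  have hp0 := h.p_pos
  have hp : (0 : ℝ) < p := by linarith
  have hlp := h.one_le_lg_p
  have hM := h.ceilDiv_le
  have hx := h.p_div_le
  set x : ℝ := p / n with hxdef
  have hx0 : 0 < x := by positivity
  have hM1 : 0 < n ⌈/⌉ p := by
    have := le_smul_ceilDiv (b := n) (a := p) (by have := h.two_le; omega)
    rw [smul_eq_mul] at this
    by_contra! h0
    rw [Nat.le_zero.1 h0, mul_zero] at this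
    have := h.large
    omega
  have hM2 : ((n ⌈/⌉ p : ℕ) : ℝ) ≤ n / p * (1 + x) := by
    refine hM.trans_eq ?_
    rw [hxdef]; field_simp
  have hlgM : lg (n ⌈/⌉ p : ℕ) ≤ lg n - lg p + 2 * x := by
    refine (lg_mono (by exact_mod_cast hM1) hM2).trans ?_
    have e : lg (n / p * (1 + x)) = lg n - lg p + lg (1 + x) := by
      simp only [lg]
      rw [Real.logb_mul (by positivity) (by positivity), Real.logb_div (by positivity) (by positivity)]
    rw [e]
    have : lg (1 + x) ≤ 2 * x := by
      rw [lg, Real.logb, div_le_iff₀ (Real.log_pos (by norm_num))]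
      -- The factor `2` suffices because `1 / log 2 < 2`.
      have e1 := Real.log_le_sub_one_of_pos (show 0 < 1 + x by linarith)
      have e2 := Real.log_two_gt_d9
      nlinarith
    linarith
  have hωl : 1 / (ω * lg n) ≤ 1 := by
    rw [div_le_one (by positivity)]; nlinarith
  have hlg0 : 0 ≤ lg (n ⌈/⌉ p : ℕ) := natCast_lg_nonneg _
  calc p * ((n ⌈/⌉ p : ℕ) * lg (n ⌈/⌉ p : ℕ)) / (n * lg n) ≤
        p * (n / p * (1 + x) * (lg n - lg p + 2 * x)) / (n * lg n) := by gcongr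
    _ = (1 + x) * (lg n - lg p + 2 * x) / lg n := by field_simp
    _ ≤ (lg n - lg p + 5 * x * lg n) / lg n := by
        gcongr
        nlinarith
    _ = 1 - lg p / lg n + 5 * x := by field_simp
    _ ≤ _ := by linarith

theorem treeDepth_le_lg (p : ℕ) : (treeDepth p : ℝ) ≤ lg p := by
  exact_mod_cast Real.natLog_le_logb p 2

/-- The segment length is chosen so that there are at most as many segments as levels, which
balances pipeline length and latency. -/
theorem broadcastLength_le (h : Admissible n p ω) : broadcastLength p ≤ 2 * treeDepth p := by
  have h1 : (p - 1) ⌈/⌉ segment p ≤ treeDepth p := by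
    rw [ceilDiv_le_iff_le_smul (segment_pos h.two_le), smul_eq_mul, mul_comm]
    exact le_smul_ceilDiv (treeDepth_pos h.two_le)
  unfold broadcastLength
  omega

theorem broadcastLength_mul_le (h : Admissible n p ω) : broadcastLength p * segment p ≤ 4 * p := by
  have h1 := h.broadcastLength_le
  have h2 : treeDepth p * segment p ≤ p - 1 + treeDepth p - 1 := by
    rw [segment, Nat.ceilDiv_eq_add_pred_div]
    exact Nat.mul_div_le _ _
  have h3 : treeDepth p ≤ p := Nat.log_le_self 2 p
  have h4 := Nat.mul_le_mul_right (segment p) h1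
  rw [mul_assoc] at h4
  omega

theorem procs_cost (h : Admissible n p ω) : (p : ℝ) * p / (n * lg n) ≤ 1 / (ω * lg n ^ 2) := by
  have h1 := h.twenty_le_lg
  have h2 := h.p_sq_div_le
  have h3 := h.pos
  have h4 := h.one_le
  calc (p : ℝ) * p / (n * lg n) = (p : ℝ) ^ 2 / n / lg n := by field_simp
    _ ≤ 1 / (ω * lg n) / lg n := by gcongr
    _ = _ := by field_simp

/-- Fewer than `p` searches of at most `2 lg n` each give `2 p² / n`, which is small by the
hypothesis on `p`. -/
theorem search_cost (h : Admissible n p ω) :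
    p * ((p - 1 : ℕ) * (⌈lg ((n ⌈/⌉ p : ℕ) + 1)⌉₊ : ℝ)) / (n * lg n) ≤
      2 * (1 / (ω * lg n)) := by
  have h1 := h.twenty_le_lg
  have h2 := h.p_sq_div_le
  have h3 := h.pos
  have h4 := h.p_pos
  have hM := h.ceilDiv_le
  have h5 : lg ((n ⌈/⌉ p : ℕ) + 1) ≤ lg n := by
    refine lg_mono (by positivity) ?_
    have : (n : ℝ) / p ≤ n / 2 := by gcongr
    have h6 : (2 : ℝ) ^ 20 ≤ n := by exact_mod_cast h.large
    linarith
  have h6 : (⌈lg ((n ⌈/⌉ p : ℕ) + 1)⌉₊ : ℝ) ≤ 2 * lg n := by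
    have h7 : (0 : ℝ) ≤ lg ((n ⌈/⌉ p : ℕ) + 1) := lg_nonneg (by simp)
    have := (Nat.ceil_lt_add_one h7).le
    linarith
  have h7 : ((p - 1 : ℕ) : ℝ) ≤ p := by exact_mod_cast Nat.sub_le p 1
  calc _ ≤ p * (p * (2 * lg n)) / (n * lg n) := by gcongr
    _ = 2 * ((p : ℝ) ^ 2 / n) := by field_simp
    _ ≤ _ := by linarith

theorem bucket_cost (h : Admissible n p ω) {B : ℕ}
    (hB : (B : ℝ) ≤ n / p * (1 + 1 / ω + 3 / (ω * lg n))) :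
    p * (B : ℝ) / (n * lg n) ≤ (1 + 1 / ω) / lg n + 3 * (1 / (ω * lg n ^ 2)) := by
  have h1 := h.twenty_le_lg
  have h3 := h.pos
  have h4 := h.p_pos
  have h2 := h.one_le
  calc p * (B : ℝ) / (n * lg n) ≤ p * (n / p * (1 + 1 / ω + 3 / (ω * lg n))) / (n * lg n) := by
        gcongr
    _ = _ := by field_simp

/-- The term `lg p / lg n` of the final merge cancels against local sorting, leaving `1 + lg p / (ω
lg n)`. Twice the bitonic cost is the other main term; the rest is of the order of the two error
terms. -/
theorem comp_ratio_le (h : Admissible n p ω) {B : ℕ}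
    (hB : (B : ℝ) ≤ n / p * (1 + 1 / ω + 3 / (ω * lg n))) :
    p * (((n ⌈/⌉ p : ℕ) * lg (n ⌈/⌉ p : ℕ) + oversampling ω n) +
      ((4 * oversampling ω n : ℕ) + oversampling ω n * lg (oversampling ω n) +
        (bitonicStages (Nat.clog 2 p)).length * (2 * oversampling ω n) + (p - 1 : ℕ) +
        (broadcastLength p * segment p +
          ((p - 1 : ℕ) * ⌈lg ((n ⌈/⌉ p : ℕ) + 1)⌉₊ + B * lg p)))) / (n * lg n) ≤
      1 + lg p / (ω * lg n) + 2 * p * ω ^ 2 * lg p ^ 2 / n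
        + 100 * (1 / (ω * lg n) + ω ^ (3 / 2 : ℝ) * lg p / √(n * lg n)) := by
  have h1 := h.twenty_le_lg
  have h2 := h.one_le
  have h3 := h.pos
  have hlp := h.one_le_lg_p
  have hlpn := h.lg_p_le
  have a1 := h.localSort_cost
  have a2 := h.oversampling_cost
  have a3 := h.sampleSort_cost
  have a4 := h.bitonic_cost
  have a5 := h.procs_cost
  have a6 := h.search_cost
  have a7 := mul_le_mul_of_nonneg_right (h.bucket_cost hB) (zero_le_one.trans hlp)
  have a8 : ((broadcastLength p : ℝ) * segment p) ≤ 4 * p := by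
    exact_mod_cast h.broadcastLength_mul_le
  have a9 : ((p - 1 : ℕ) : ℝ) ≤ p := by exact_mod_cast Nat.sub_le p 1
  have a10 : p * ((p - 1 : ℕ) + (broadcastLength p : ℝ) * segment p) / (n * lg n) ≤
      5 * ((p : ℝ) * p / (n * lg n)) := by
    calc _ ≤ p * ((p : ℝ) + 4 * p) / (n * lg n) := by gcongr
      _ = _ := by ring
  have a11 : 1 / (ω * lg n ^ 2) ≤ 1 / (ω * lg n) := by
    apply one_div_le_one_div_of_le (by positivity)
    have : ω * lg n ≤ ω * lg n * lg n :=
      le_mul_of_one_le_right (by positivity) (by linarith)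
    linarith
  have a12 : 1 / (ω * lg n ^ 2) * lg p ≤ 1 / (ω * lg n) := by
    rw [div_mul_eq_mul_div, div_le_div_iff₀ (by positivity) (by positivity)]
    have : 0 ≤ ω * lg n := by positivity
    nlinarith
  have e1 : (1 + 1 / ω) / lg n * lg p = lg p / lg n + lg p / (ω * lg n) := by field_simp
  have e2 : ω ^ (3 / 2 : ℝ) * lg p / √(n * lg n) = ω ^ (3 / 2 : ℝ) / √(n * lg n) * lg p := by ring
  have hE : 0 ≤ 1 / (ω * lg n) := by positivity
  have hF : 0 ≤ ω ^ (3 / 2 : ℝ) / √(n * lg n) * lg p := by positivity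
  rw [e2]
  rw [add_mul, e1] at a7
  push_cast
  have e3 : ∀ a b c d e f u v : ℝ, p * ((a + b) + (4 * b + c + d * (2 * b) + e +
      (f + (u + v * lg p)))) / (n * lg n) = p * a / (n * lg n) + 5 * (p * b / (n * lg n)) +
      p * c / (n * lg n) + 2 * (p * (d * b) / (n * lg n)) + p * (e + f) / (n * lg n) +
      p * u / (n * lg n) + p * v / (n * lg n) * lg p := by
    intros; ring
  rw [e3]
  have e4 : 2 * p * ω ^ 2 * lg p ^ 2 / n = 2 * (p * ω ^ 2 * lg p ^ 2 / n) := by ring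
  rw [e4]
  linarith

/-- The `L` terms and the `g` terms are separated: the former count supersteps, the latter words. -/
theorem comm_ratio_le (h : Admissible n p ω) {B : ℕ}
    (hB : (B : ℝ) ≤ n / p * (1 + 1 / ω + 3 / (ω * lg n))) {L g : ℝ} (hL : 0 ≤ L) (hg : 0 ≤ g)
    (hLn : L * (p * lg p ^ 2) ≤ 2 * n) :
    p * ((((bitonicStages (Nat.clog 2 p)).length + broadcastLength p + 5 : ℕ) + 1) * L +
      g * (4 * oversampling ω n + 4 * oversampling ω n +
        (bitonicStages (Nat.clog 2 p)).length * oversampling ω n + (p - 1) +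
        (broadcastLength p * (2 * segment p) + (0 + B)) : ℕ)) / (n * lg n) ≤
      (1 + 1 / ω) * g / lg n + g * p * ω ^ 2 * lg p ^ 2 / n
        + L * p * lg p ^ 2 / (2 * n * lg n)
        + 100 * (1 / (lg p * lg n) + g * ω ^ (3 / 2 : ℝ) * lg p / √(n * lg n)
          + g / (ω * lg n ^ 2)) := by
  have h1 := h.twenty_le_lg
  have h2 := h.one_le
  have h3 := h.pos
  have hp0 := h.p_pos
  have hlp := h.one_le_lg_p
  have a2 := h.oversampling_cost
  have a4 := h.bitonic_cost
  have a5 := h.procs_cost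
  have a7 := h.bucket_cost hB
  have a8 : ((broadcastLength p : ℝ) * (2 * segment p)) ≤ 8 * p := by
    have : ((broadcastLength p : ℝ) * segment p) ≤ 4 * p := by
      exact_mod_cast h.broadcastLength_mul_le
    linarith
  have a9 : ((p - 1 : ℕ) : ℝ) ≤ p := by exact_mod_cast Nat.sub_le p 1
  have a10 : p * ((p - 1 : ℕ) + (broadcastLength p : ℝ) * (2 * segment p)) / (n * lg n) ≤
      9 * ((p : ℝ) * p / (n * lg n)) := by
    calc _ ≤ p * ((p : ℝ) + 8 * p) / (n * lg n) := by gcongr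
      _ = _ := by ring
  have b1 : (broadcastLength p : ℝ) ≤ 2 * lg p := by
    have h4 : (broadcastLength p : ℝ) ≤ 2 * treeDepth p := by exact_mod_cast h.broadcastLength_le
    have := treeDepth_le_lg p
    linarith
  have b2 := h.two_mul_stages_le
  have hLterm : p * ((((bitonicStages (Nat.clog 2 p)).length : ℝ) + broadcastLength p + 5 + 1) * L)
      / (n * lg n) ≤ L * p * lg p ^ 2 / (2 * n * lg n) + 21 * (1 / (lg p * lg n)) := by
    -- The linear and constant terms `1.5 lg p + 1`, `2 lg p` and `6` are collected using `1 ≤ lg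
    -- p`.
    have b3 : ((bitonicStages (Nat.clog 2 p)).length : ℝ) + broadcastLength p + 5 + 1 ≤
        lg p ^ 2 / 2 + 10.5 * lg p := by linarith
    -- The only use of the bound on `L`: it makes the non-leading supersteps an error term.
    have b4 : L * p * lg p / (n * lg n) ≤ 2 * (1 / (lg p * lg n)) := by
      rw [← mul_one_div, mul_one_div, ← mul_div_assoc, div_le_div_iff₀ (by positivity) (by positivity)]
      have := mul_le_mul_of_nonneg_right hLn (show 0 ≤ lg n by linarith)
      nlinarith
    calc _ ≤ p * ((lg p ^ 2 / 2 + 10.5 * lg p) * L) / (n * lg n) := by gcongr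
      _ = L * p * lg p ^ 2 / (2 * n * lg n) + 10.5 * (L * p * lg p / (n * lg n)) := by
          field_simp
      _ ≤ _ := by linarith
  have hgterm : p * (4 * (oversampling ω n : ℝ) + 4 * oversampling ω n +
        (bitonicStages (Nat.clog 2 p)).length * oversampling ω n + (p - 1 : ℕ) +
        (broadcastLength p * (2 * segment p) + B)) / (n * lg n) ≤
      (1 + 1 / ω) / lg n + p * ω ^ 2 * lg p ^ 2 / n +
        100 * (ω ^ (3 / 2 : ℝ) / √(n * lg n) * lg p + 1 / (ω * lg n ^ 2)) := by
    have e3 : ∀ b d e f v : ℝ, p * (4 * b + 4 * b + d * b + e + (f + v)) / (n * lg n) =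
        8 * (p * b / (n * lg n)) + p * (d * b) / (n * lg n) + p * (e + f) / (n * lg n) +
        p * v / (n * lg n) := by
      intros; ring
    rw [e3]
    have hE : 0 ≤ 1 / (ω * lg n ^ 2) := by positivity
    have hF : 0 ≤ ω ^ (3 / 2 : ℝ) / √(n * lg n) * lg p := by positivity
    linarith
  have hgterm' := mul_le_mul_of_nonneg_left hgterm hg
  have hD : 0 ≤ 1 / (lg p * lg n) := by positivity
  push_cast
  calc _ = p * ((((bitonicStages (Nat.clog 2 p)).length : ℝ) + broadcastLength p + 5 + 1) * L)
      / (n * lg n) + g * (p * (4 * (oversampling ω n : ℝ) + 4 * oversampling ω n +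
        (bitonicStages (Nat.clog 2 p)).length * oversampling ω n + (p - 1 : ℕ) +
        (broadcastLength p * (2 * segment p) + B)) / (n * lg n)) := by ring
    _ ≤ (L * p * lg p ^ 2 / (2 * n * lg n) + 100 * (1 / (lg p * lg n))) +
        g * ((1 + 1 / ω) / lg n + p * ω ^ 2 * lg p ^ 2 / n +
        100 * (ω ^ (3 / 2 : ℝ) / √(n * lg n) * lg p + 1 / (ω * lg n ^ 2))) := by
      refine add_le_add ?_ hgterm'
      linarith
    _ = _ := by ring

end Admissible

/-! ### Interval lengths and failure probabilities -/

namespace Admissible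

variable {n p : ℕ} {ω : ℝ}

/-- The distance of the starting points of aligned intervals. -/
noncomputable def cell (n p : ℕ) (ω : ℝ) : ℕ := ⌊n / (p * ω * lg n)⌋₊

/-- The length of aligned intervals. -/
noncomputable def span (n p : ℕ) (ω : ℝ) : ℕ :=
  ⌈(1 + 1 / ω) * oversampling ω n * n / (oversampling ω n * p - 1 : ℕ)⌉₊

/-- Keeps the rounding in `cell` harmless: at least three quarters of the quotient survive. -/
theorem four_le (h : Admissible n p ω) : 4 ≤ n / (p * ω * lg n) := by
  have h1 := h.twenty_le_lg
  have h2 := h.one_le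
  have h3 := h.p_pos
  rw [le_div_iff₀ (by positivity)]
  have h4 : 0 ≤ p * ω * lg n := by positivity
  have := h.sample
  nlinarith

theorem three_quarters_le_cell (h : Admissible n p ω) :
    3 / 4 * (n / (p * ω * lg n)) ≤ cell n p ω := by
  have h1 := h.four_le
  have h2 := Nat.sub_one_lt_floor (n / (p * ω * lg n))
  rw [cell]
  linarith

theorem cell_le (h : Admissible n p ω) : (cell n p ω : ℝ) ≤ n / (p * ω * lg n) :=
  Nat.floor_le (by linarith [h.four_le])

theorem cell_pos (h : Admissible n p ω) : 0 < cell n p ω := by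
  have h1 := h.four_le
  have h2 := h.three_quarters_le_cell
  have : (0 : ℝ) < cell n p ω := by linarith
  exact_mod_cast this

theorem cast_draws (h : Admissible n p ω) :
    ((oversampling ω n * p - 1 : ℕ) : ℝ) = oversampling ω n * p - 1 := by
  have h1 := h.oversampling_pos
  have h2 := h.two_le
  rw [Nat.cast_sub (by nlinarith)]
  push_cast
  ring

theorem draws_pos (h : Admissible n p ω) : (0 : ℝ) < (oversampling ω n * p - 1 : ℕ) := by
  rw [h.cast_draws]
  have h1 : (1 : ℝ) ≤ oversampling ω n := by exact_mod_cast h.oversampling_pos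
  have h2 := h.p_pos
  nlinarith

/-- The condition on the length of the aligned blocks in the lower tail bound with deviation `e =
1/ω`; `span` is the least integer that satisfies it. -/
theorem le_draws_mul_span (h : Admissible n p ω) :
    (1 + 1 / ω) * oversampling ω n * n ≤ (oversampling ω n * p - 1 : ℕ) * (span n p ω : ℝ) := by
  rw [mul_comm ((oversampling ω n * p - 1 : ℕ) : ℝ), ← div_le_iff₀ h.draws_pos]
  exact Nat.le_ceil _

theorem le_span (h : Admissible n p ω) : (n : ℝ) / p ≤ span n p ω := by
  refine le_trans ?_ (Nat.le_ceil _)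
  have h1 := h.draws_pos
  have h2 := h.p_pos
  have h3 := h.pos
  have h4 := h.one_le
  have h5 : ((oversampling ω n * p - 1 : ℕ) : ℝ) ≤ oversampling ω n * p := by
    rw [h.cast_draws]; linarith
  rw [div_le_div_iff₀ (by positivity) h1]
  have h6 : 0 ≤ 1 / ω := by positivity
  calc (n : ℝ) * (oversampling ω n * p - 1 : ℕ) ≤ n * (oversampling ω n * p) := by gcongr
    _ = 1 * (oversampling ω n * n * p) := by ring
    _ ≤ (1 + 1 / ω) * (oversampling ω n * n * p) := by gcongr; linarith
    _ = _ := by ring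

theorem span_pos (h : Admissible n p ω) : 0 < span n p ω := by
  have h1 := h.le_span
  have h2 := h.p_pos
  have h3 := h.pos
  have : (0 : ℝ) < span n p ω := lt_of_lt_of_le (by positivity) h1
  exact_mod_cast this

/-- The term `1 / (ω lg n)` pays for the missing draw in `s p - 1`: multiplied by `s p ≥ 4 ω² lg n`
it yields at least `4`, while the missing draw costs at most `3`. -/
theorem span_le (h : Admissible n p ω) :
    (span n p ω : ℝ) ≤ n / p * (1 + 1 / ω + 1 / (ω * lg n)) + 1 := by
  have hω : 0 < ω := by linarith [h.one_le]
  have hl : 0 < lg n := by linarith [h.twenty_le_lg]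
  have h1 := h.draws_pos
  have h2 := h.p_pos
  have h3 := h.pos
  have h4 := h.one_le
  have h5 := le_oversampling ω n
  have h0 : (1 : ℝ) ≤ oversampling ω n := by exact_mod_cast h.oversampling_pos
  refine (Nat.ceil_lt_add_one (by positivity)).le.trans ?_
  rw [add_le_add_iff_right, div_le_iff₀ h1, h.cast_draws]
  have h6 : (1 + 1 / ω + 1 / (ω * lg n)) * (oversampling ω n * p - 1) ≥
      (1 + 1 / ω) * oversampling ω n * p := by
    have h7 : 1 / (ω * lg n) * (oversampling ω n * p) ≥ 4 * ω := by
      have : 2 * ω ^ 2 * lg n * 2 ≤ oversampling ω n * p := by gcongr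
      calc 4 * ω = 1 / (ω * lg n) * (2 * ω ^ 2 * lg n * 2) := by field_simp; ring
        _ ≤ _ := by gcongr
    have h8 : 1 / ω ≤ 1 := by rw [div_le_one hω]; exact h4
    have h9 : 1 / (ω * lg n) ≤ 1 := by
      rw [div_le_one (by positivity)]; nlinarith [h.twenty_le_lg]
    linarith
  calc (1 + 1 / ω) * oversampling ω n * n =
        n / p * ((1 + 1 / ω) * oversampling ω n * p) := by field_simp
    _ ≤ n / p * ((1 + 1 / ω + 1 / (ω * lg n)) * (oversampling ω n * p - 1)) := by gcongr
    _ = _ := by ring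

/-- With `u = n / (p ω lg n)`, the term `3 / (ω lg n)` consists of one `u` from `span`, one for
`cell`, and one for the rounding of `span`, as `1 ≤ u`. -/
theorem span_add_cell_le (h : Admissible n p ω) :
    ((span n p ω + cell n p ω : ℕ) : ℝ) ≤ n / p * (1 + 1 / ω + 3 / (ω * lg n)) := by
  have hω : 0 < ω := by linarith [h.one_le]
  have hl : 0 < lg n := by linarith [h.twenty_le_lg]
  have h1 := h.span_le
  have h2 := h.cell_le
  have h3 := h.four_le
  have hp : (0 : ℝ) < p := by linarith [h.p_pos]
  push_cast
  have e : (n : ℝ) / p * (1 + 1 / ω + 3 / (ω * lg n)) =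
      n / p * (1 + 1 / ω + 1 / (ω * lg n)) + 2 * (n / (p * ω * lg n)) := by
    field_simp; ring
  rw [e]
  linarith

theorem ceilDiv_le_span_add_cell (h : Admissible n p ω) :
    n ⌈/⌉ p ≤ span n p ω + cell n p ω := by
  have h1 := h.le_span
  have h2 : (1 : ℝ) ≤ cell n p ω := by exact_mod_cast h.cell_pos
  have h3 := h.ceilDiv_le
  have : ((n ⌈/⌉ p : ℕ) : ℝ) ≤ (span n p ω + cell n p ω : ℕ) := by push_cast; linarith
  exact_mod_cast this

theorem one_le_cast (h : Admissible n p ω) : (1 : ℝ) ≤ n := by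
  have := h.large
  exact_mod_cast (show 1 ≤ n by omega)

/-- As `lg` has base `2`, the left-hand side is `n ^ (-(x / log 2))`, and `1.44 < 1 / log 2`. This
gain is essential: for `ω` near `1` an exponent of only `x = 1/2` would not beat about `√n`
intervals. -/
theorem exp_neg_mul_lg_le (h : Admissible n p ω) {x y : ℝ} (hy : 0 ≤ y) (hxy : y ≤ 1.44 * x) :
    Real.exp (-(lg n * x)) ≤ (n : ℝ) ^ (-y) := by
  rw [Real.rpow_def_of_pos h.pos, Real.exp_le_exp]
  have h1 : Real.log n = lg n * Real.log 2 := by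
    rw [lg, Real.logb, div_mul_cancel₀ _ (Real.log_pos (by norm_num)).ne']
  have h2 := Real.log_two_lt_d9
  have h3 := h.twenty_le_lg
  have h4 : Real.log 2 * y ≤ 0.6931471808 * (1.44 * x) := by
    have := Real.log_pos (show (1 : ℝ) < 2 by norm_num)
    exact mul_le_mul h2.le hxy hy (by norm_num)
  have h5 : Real.log 2 * y ≤ x := by
    have : 0 ≤ x := by linarith
    linarith
  rw [h1]
  nlinarith

/-- `p ω` governs the number of aligned blocks. Near `ω = 1` the tail is weak but `p ≤ √n`; for
larger `ω`, `(p ω)² = (p² ω) ω ≤ n √n`. -/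
theorem p_mul_omega_le (h : Admissible n p ω) :
    p * ω ≤ 2 * (n : ℝ) ^ (0.5 : ℝ) ∧ ω ≤ 2 ∨ p * ω ≤ (n : ℝ) ^ (0.75 : ℝ) ∧ 2 ≤ ω := by
  have h2 := h.one_le
  have h3 := h.pos
  have hp := h.p_pos
  have hp2 : (p : ℝ) ≤ (n : ℝ) ^ (0.5 : ℝ) := by
    rw [show (0.5 : ℝ) = 1 / 2 by norm_num, ← Real.sqrt_eq_rpow]
    exact Real.le_sqrt_of_sq_le h.p_sq_le
  have hω : ω ≤ (n : ℝ) ^ (0.5 : ℝ) := by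
    rw [show (0.5 : ℝ) = 1 / 2 by norm_num, ← Real.sqrt_eq_rpow]
    exact Real.le_sqrt_of_sq_le h.omega_sq_le
  rcases le_total ω 2 with hle | hle
  · left
    refine ⟨?_, hle⟩
    calc p * ω ≤ (n : ℝ) ^ (0.5 : ℝ) * 2 := by gcongr
      _ = _ := by ring
  · right
    refine ⟨?_, hle⟩
    refine (pow_le_pow_iff_left₀ (by positivity) (by positivity) two_ne_zero).1 ?_
    have h4 : (p : ℝ) ^ 2 * ω ≤ n := by
      have := h.procs
      have h5 := h.twenty_le_lg
      have : (p : ℝ) ^ 2 * ω ≤ (p : ℝ) ^ 2 * ω * lg n :=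
        le_mul_of_one_le_right (by positivity) (by linarith)
      linarith
    calc (p * ω) ^ 2 = (p : ℝ) ^ 2 * ω * ω := by ring
      _ ≤ n * (n : ℝ) ^ (0.5 : ℝ) := by gcongr
      _ = ((n : ℝ) ^ (0.75 : ℝ)) ^ 2 := by
          rw [← Real.rpow_natCast, ← Real.rpow_mul h3.le]
          nth_rewrite 1 [← Real.rpow_one (n : ℝ)]
          rw [← Real.rpow_add h3]
          norm_num

/-- There are at most `3 p ω lg n` starting points, and each fails with probability at most `exp
(-(lg n) ω / (ω + 1))`. For `ω ≤ 2` the exponents of `n` add up to `0.5 + 0.06 - 0.72`, for `ω ≥ 2`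
to `0.75 + 0.06 - 0.96`; the `0.06` is the logarithm together with the constants. -/
theorem long_interval_tail_le (h : Admissible n p ω) :
    ((n : ℝ) / cell n p ω + 1) * Real.exp (-(oversampling ω n *
      ((1 / ω) ^ 2 / (2 * (1 + 1 / ω))))) ≤ (n : ℝ) ^ (-0.15 : ℝ) := by
  have hω : 0 < ω := by linarith [h.one_le]
  have hl : 0 < lg n := by linarith [h.twenty_le_lg]
  have h2 := h.one_le
  have h3 := h.pos
  have hp := h.p_pos
  have hp0 : (0 : ℝ) < p := by linarith
  have hstarts : (n : ℝ) / cell n p ω + 1 ≤ 3 * (p * ω) * lg n := by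
    have h4 := h.three_quarters_le_cell
    have h5 : (n : ℝ) / cell n p ω ≤ n / (3 / 4 * (n / (p * ω * lg n))) := by gcongr
    have e : (n : ℝ) / (3 / 4 * (n / (p * ω * lg n))) = 4 / 3 * (p * ω * lg n) := by
      field_simp
    have h6 : 1 ≤ p * ω * lg n := by
      have : 1 ≤ p * ω := by nlinarith
      nlinarith [h.twenty_le_lg]
    rw [e] at h5
    linarith
  have hexp : Real.exp (-(oversampling ω n * ((1 / ω) ^ 2 / (2 * (1 + 1 / ω))))) ≤
      Real.exp (-(lg n * (ω / (ω + 1)))) := by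
    rw [Real.exp_le_exp, neg_le_neg_iff]
    have := le_oversampling ω n
    calc lg n * (ω / (ω + 1)) =
        2 * ω ^ 2 * lg n * ((1 / ω) ^ 2 / (2 * (1 + 1 / ω))) := by field_simp
      _ ≤ _ := by gcongr
  have hn1 := h.one_le_cast
  have hlog := h.log_le
  refine (mul_le_mul hstarts hexp (by positivity) (by positivity)).trans ?_
  rcases h.p_mul_omega_le with ⟨h4, h5⟩ | ⟨h4, h5⟩
  · have h6 := h.exp_neg_mul_lg_le (x := ω / (ω + 1)) (y := 0.72) (by norm_num) (by
      have : 1 / 2 ≤ ω / (ω + 1) := by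
        rw [div_le_div_iff₀ (by norm_num) (by positivity)]; linarith
      linarith)
    calc _ ≤ 3 * (2 * (n : ℝ) ^ (0.5 : ℝ)) * ((n : ℝ) ^ (0.06 : ℝ) / 6) *
          (n : ℝ) ^ (-0.72 : ℝ) := by
          gcongr
          linarith
      _ = (n : ℝ) ^ (-0.16 : ℝ) := by
          rw [show 3 * (2 * (n : ℝ) ^ (0.5 : ℝ)) * ((n : ℝ) ^ (0.06 : ℝ) / 6) *
            (n : ℝ) ^ (-0.72 : ℝ) = (n : ℝ) ^ (0.5 : ℝ) * (n : ℝ) ^ (0.06 : ℝ) *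
            (n : ℝ) ^ (-0.72 : ℝ) by ring, ← Real.rpow_add h3, ← Real.rpow_add h3]
          norm_num
      _ ≤ _ := Real.rpow_le_rpow_of_exponent_le hn1 (by norm_num)
  · have h6 := h.exp_neg_mul_lg_le (x := ω / (ω + 1)) (y := 0.96) (by norm_num) (by
      have : 2 / 3 ≤ ω / (ω + 1) := by
        rw [div_le_div_iff₀ (by norm_num) (by positivity)]; linarith
      linarith)
    calc _ ≤ 3 * ((n : ℝ) ^ (0.75 : ℝ)) * ((n : ℝ) ^ (0.06 : ℝ) / 3) *
          (n : ℝ) ^ (-0.96 : ℝ) := by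
          gcongr
          linarith
      _ = (n : ℝ) ^ (-0.15 : ℝ) := by
          rw [show 3 * ((n : ℝ) ^ (0.75 : ℝ)) * ((n : ℝ) ^ (0.06 : ℝ) / 3) *
            (n : ℝ) ^ (-0.96 : ℝ) = (n : ℝ) ^ (0.75 : ℝ) * (n : ℝ) ^ (0.06 : ℝ) *
            (n : ℝ) ^ (-0.96 : ℝ) by ring, ← Real.rpow_add h3, ← Real.rpow_add h3]
          norm_num

/-- A processor owns at most `2 n / p` positions, so it expects at most `2 s` requests. Since `e² <
8`, the quotient is at most `(8 / 16) ^ s = 2 ^ (-s)`, and `s ≥ 2 lg n`. -/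
theorem request_tail_le (h : Admissible n p ω) {a : ℕ} (ha : a ≤ n ⌈/⌉ p) :
    Real.exp ((oversampling ω n * p - 1 : ℕ) * ((a : ℝ) / n)) / 2 ^ (4 * oversampling ω n) ≤
      1 / (n : ℝ) ^ 2 := by
  have h3 := h.pos
  have hp := h.p_pos
  have hp0 : (0 : ℝ) < p := by linarith
  have hN : ((oversampling ω n * p - 1 : ℕ) : ℝ) ≤ oversampling ω n * p := by
    rw [h.cast_draws]; linarith
  have ha' : (a : ℝ) ≤ 2 * (n / p) := by
    have h1 : (a : ℝ) ≤ (n ⌈/⌉ p : ℕ) := by exact_mod_cast ha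
    have h2 := h.ceilDiv_le
    have h4 : (1 : ℝ) ≤ n / p := by
      rw [le_div_iff₀ hp0, one_mul]; exact_mod_cast h.p_le
    linarith
  have h4 : ((oversampling ω n * p - 1 : ℕ) : ℝ) * ((a : ℝ) / n) ≤ oversampling ω n * 2 := by
    calc _ ≤ (oversampling ω n : ℝ) * p * (2 * (n / p) / n) := by gcongr
      _ = _ := by field_simp
  have h5 : Real.exp (oversampling ω n * 2) ≤ 8 ^ oversampling ω n := by
    rw [Real.exp_nat_mul]
    gcongr
    have h6 := Real.exp_one_lt_d9
    have h7 := Real.exp_pos 1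
    rw [show (2 : ℝ) = 1 + 1 by norm_num, Real.exp_add]
    nlinarith
  have h6 : (n : ℝ) ^ 2 ≤ 2 ^ oversampling ω n := by
    have h7 : (2 : ℝ) ^ lg n = n := Real.rpow_logb (by norm_num) (by norm_num) h3
    calc (n : ℝ) ^ 2 = (2 : ℝ) ^ (2 * lg n) := by
          rw [mul_comm, Real.rpow_mul (by norm_num), h7]; norm_num
      _ ≤ (2 : ℝ) ^ (oversampling ω n : ℝ) :=
          Real.rpow_le_rpow_of_exponent_le (by norm_num) h.two_lg_le_oversampling
      _ = _ := Real.rpow_natCast _ _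
  rw [div_le_div_iff₀ (by positivity) (by positivity)]
  calc _ ≤ (8 : ℝ) ^ oversampling ω n * 2 ^ oversampling ω n := by
        gcongr
        exact (Real.exp_le_exp.2 h4).trans h5
    _ = 1 * 2 ^ (4 * oversampling ω n) := by
        rw [← mul_pow, pow_mul]; norm_num

/-- Both failure terms are at most `n ^ (-0.15)`, and `2 ≤ n ^ 0.05` because `n ≥ 2 ^ 20`. -/
theorem tails_le (h : Admissible n p ω) :
    p * (1 / (n : ℝ) ^ 2) + (n : ℝ) ^ (-0.15 : ℝ) ≤ (n : ℝ) ^ (-0.1 : ℝ) := by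
  have h3 := h.pos
  have hn1 := h.one_le_cast
  have h1 : p * (1 / (n : ℝ) ^ 2) ≤ (n : ℝ) ^ (-0.15 : ℝ) := by
    have hpn : (p : ℝ) ≤ n := by exact_mod_cast h.p_le
    calc p * (1 / (n : ℝ) ^ 2) ≤ n * (1 / (n : ℝ) ^ 2) := by gcongr
      _ = (n : ℝ) ^ (-1 : ℝ) := by rw [Real.rpow_neg_one]; field_simp
      _ ≤ _ := Real.rpow_le_rpow_of_exponent_le hn1 (by norm_num)
  have h2 : (2 : ℝ) ≤ (n : ℝ) ^ (0.05 : ℝ) := by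
    have h4 : ((2 : ℝ) ^ (20 : ℕ)) ^ (0.05 : ℝ) = 2 := by
      rw [← Real.rpow_natCast, ← Real.rpow_mul (by norm_num)]
      norm_num
    rw [← h4]
    exact Real.rpow_le_rpow (by positivity) (by exact_mod_cast h.large) (by norm_num)
  have h5 : (n : ℝ) ^ (-0.1 : ℝ) = (n : ℝ) ^ (0.05 : ℝ) * (n : ℝ) ^ (-0.15 : ℝ) := by
    rw [← Real.rpow_add h3]; norm_num
  rw [h5]
  have h6 : 0 ≤ (n : ℝ) ^ (-0.15 : ℝ) := by positivity
  nlinarith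

end Admissible

end IRan

theorem one_sub_le_uniformProb {Ω : Type*} [Finite Ω] [Nonempty Ω] {E F : Set Ω} {ε : ℝ}
    (hF : (F.ncard : ℝ) ≤ ε * Nat.card Ω) (h : ∀ x, x ∉ F → x ∈ E) : 1 - ε ≤ uniformProb E := by
  have hpos : (0 : ℝ) < Nat.card Ω := by exact_mod_cast Nat.card_pos
  rw [uniformProb, le_div_iff₀ hpos]
  have h1 : Fᶜ.ncard ≤ E.ncard := Set.ncard_le_ncard h (Set.toFinite _)
  have h2 : (F.ncard : ℝ) + Fᶜ.ncard = Nat.card Ω := by exact_mod_cast Set.ncard_add_ncard_compl F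
  have h3 : (Fᶜ.ncard : ℝ) ≤ E.ncard := by exact_mod_cast h1
  linarith

/-! ### Probabilities of the two bad events -/

namespace IRan

open Filter in
theorem exists_large_admissible : ∃ n₀ : ℕ, ∀ n ≥ n₀,
    2 ^ 20 ≤ n ∧ 6 * lg n ≤ (n : ℝ) ^ (0.06 : ℝ) := by
  have h1 := (isLittleO_log_rpow_atTop (show (0 : ℝ) < 0.06 by norm_num)).bound
    (show (0 : ℝ) < Real.log 2 / 6 by have := Real.log_pos (show (1 : ℝ) < 2 by norm_num); positivity)
  have h2 := (tendsto_natCast_atTop_atTop (R := ℝ)).eventually h1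
  obtain ⟨N, hN⟩ := eventually_atTop.1 h2
  refine ⟨max N (2 ^ 20), fun n hn => ⟨le_of_max_le_right hn, ?_⟩⟩
  have h3 := hN n (le_of_max_le_left hn)
  have hl := Real.log_pos (show (1 : ℝ) < 2 by norm_num)
  rw [Real.norm_of_nonneg (Real.rpow_nonneg (Nat.cast_nonneg n) _)] at h3
  have h4 := (le_abs_self _).trans h3
  rw [lg, Real.logb]
  have h5 : Real.log n / Real.log 2 ≤ (n : ℝ) ^ (0.06 : ℝ) / 6 := by
    rw [div_le_iff₀ hl]
    linarith
  linarith

section Sampling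

variable {K : Type*} {n p : ℕ} {ω : ℝ} {X : Fin p → List K}

theorem IsInput.card_eq (hX : IsInput n X) : Fintype.card (Σ k : Fin p, Fin (X k).length) = n := by
  rw [Fintype.card_sigma]
  simpa using hX.total

theorem IsInput.nonempty_draws (hX : IsInput n X) (h : Admissible n p ω) :
    Nonempty (Draws X (oversampling ω n)) := by
  refine Function.Embedding.nonempty_of_card_le ?_
  rw [hX.card_eq, Fintype.card_fin]
  exact (Nat.sub_le _ _).trans h.oversampling_mul_le

/-- It is unlikely that many draws hit the same processor. -/
theorem IsInput.ncard_many_requests_le (hX : IsInput n X) (h : Admissible n p ω) :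
    ({d : Draws X (oversampling ω n) | ∃ k, 4 * oversampling ω n ≤
      (Finset.univ.filter fun i => (d i).1 = k).card}.ncard : ℝ) ≤
      p * (1 / (n : ℝ) ^ 2) * Nat.card (Draws X (oversampling ω n)) := by
  classical
  set A : Fin p → Finset (Σ k : Fin p, Fin (X k).length) := fun k =>
    Finset.univ.filter fun a => a.1 = k
  have hA : ∀ k, (A k).card ≤ n ⌈/⌉ p := by
    intro k
    refine le_trans (le_of_eq ?_) (hX.even k)
    rw [Finset.card_filter, Fintype.sum_sigma, Finset.sum_eq_single k]
    · simp
    · intro j _ hj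
      simp [hj]
    · simp
  have hhits : ∀ (d : Draws X (oversampling ω n)) k,
      (Finset.univ.filter fun i => (d i).1 = k).card = hits (A k) d := by
    intro d k
    simp [hits, A]
  have hk : ∀ k, ((Finset.univ.filter fun d : Draws X (oversampling ω n) =>
      4 * oversampling ω n ≤ hits (A k) d).card : ℝ) ≤
      Nat.card (Draws X (oversampling ω n)) * (1 / (n : ℝ) ^ 2) := by
    intro k
    refine (card_hits_ge_le (A k) _).trans ?_
    rw [← Nat.card_eq_fintype_card (α := Draws X (oversampling ω n)), hX.card_eq]
    exact mul_le_mul_of_nonneg_left (h.request_tail_le (hA k)) (Nat.cast_nonneg _)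
  have hsub : {d : Draws X (oversampling ω n) | ∃ k, 4 * oversampling ω n ≤
      (Finset.univ.filter fun i => (d i).1 = k).card} ⊆
      ((Finset.univ.biUnion fun k => Finset.univ.filter fun d : Draws X (oversampling ω n) =>
        4 * oversampling ω n ≤ hits (A k) d : Finset (Draws X (oversampling ω n))) : Set _) := by
    rintro d ⟨k, hd⟩
    rw [hhits] at hd
    simp only [Finset.coe_biUnion, Set.mem_iUnion]
    exact ⟨k, by simp, by simpa using hd⟩
  have h1 := Set.ncard_le_ncard hsub (Set.toFinite _)
  rw [Set.ncard_coe_finset] at h1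
  calc _ ≤ (((Finset.univ.biUnion fun k => Finset.univ.filter fun d : Draws X (oversampling ω n) =>
        4 * oversampling ω n ≤ hits (A k) d).card : ℕ) : ℝ) := by exact_mod_cast h1
    _ ≤ ∑ k : Fin p, ((Finset.univ.filter fun d : Draws X (oversampling ω n) =>
        4 * oversampling ω n ≤ hits (A k) d).card : ℝ) := by
        exact_mod_cast Finset.card_biUnion_le
    _ ≤ ∑ _k : Fin p, (Nat.card (Draws X (oversampling ω n)) * (1 / (n : ℝ) ^ 2) : ℝ) :=
        Finset.sum_le_sum fun k _ => hk k
    _ = _ := by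
        rw [Finset.sum_const, Finset.card_univ, Fintype.card_fin, nsmul_eq_mul]
        ring

variable [LinearOrder K]

/-- It is unlikely that an interval with few sample keys has many keys. -/
theorem IsInput.ncard_long_interval_le (hX : IsInput n X) (h : Admissible n p ω) :
    ({d : Draws X (oversampling ω n) | ∃ I : Set K, I.OrdConnected ∧
      {i | drawnKey X (d i) ∈ I}.ncard ≤ oversampling ω n ∧
      Admissible.span n p ω + Admissible.cell n p ω ≤ {a | drawnKey X a ∈ I}.ncard}.ncard : ℝ) ≤
      (n : ℝ) ^ (-0.15 : ℝ) * Nat.card (Draws X (oversampling ω n)) := by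
  have hω : 0 < ω := by linarith [h.one_le]
  have hpos : 0 < Fintype.card (Σ k : Fin p, Fin (X k).length) := by
    rw [hX.card_eq]; have := h.large; omega
  have key := card_exists_long_preimage_le (injective_drawnKey hX.distinct)
    (N := oversampling ω n * p - 1) (oversampling ω n) (Admissible.span n p ω)
    (Admissible.cell n p ω) (e := 1 / ω) (by positivity) h.cell_pos h.span_pos hpos
    (by rw [hX.card_eq]; exact h.le_draws_mul_span)
  rw [hX.card_eq] at key
  have h2 := mul_le_mul_of_nonneg_right h.long_interval_tail_le
    (Nat.cast_nonneg (α := ℝ) (Nat.card (Draws X (oversampling ω n))))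
  refine key.trans (le_trans (le_of_eq ?_) h2)
  ring

end Sampling

end IRan

end BSP

/-! ### The main theorem -/

theorem mainTheorem4 :
    ∃ C ρ : ℝ, 0 < C ∧ 0 < ρ ∧ ∃ n₀ : ℕ, ∀ (n p : ℕ) (ω L g : ℝ),
      n₀ ≤ n → 2 ≤ p → 1 ≤ ω → 0 ≤ L → 0 ≤ g →
      2 * p * ω ^ 2 * BSP.lg n < n / 2 →
      (p : ℝ) ^ 2 ≤ n / (ω * BSP.lg n) →
      L ≤ 2 * n / (p * BSP.lg p ^ 2) →
      ∀ (K : Type u) [LinearOrder K] (X : Fin p → List K), BSP.IRan.IsInput n X →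
        1 - (n : ℝ) ^ (-ρ) ≤ BSP.uniformProb
          {d : BSP.IRan.Draws X (BSP.IRan.oversampling ω n) |
            BSP.IRan.piRatio n (BSP.IRan.oversampling ω n) X d ≤
              1 + BSP.lg p / (ω * BSP.lg n) + 2 * p * ω ^ 2 * BSP.lg p ^ 2 / n
              + C * (1 / (ω * BSP.lg n)
                  + ω ^ (3 / 2 : ℝ) * BSP.lg p / √(n * BSP.lg n)) ∧
            BSP.IRan.muRatio L g n (BSP.IRan.oversampling ω n) X d ≤
              (1 + 1 / ω) * g / BSP.lg n + g * p * ω ^ 2 * BSP.lg p ^ 2 / n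
              + L * p * BSP.lg p ^ 2 / (2 * n * BSP.lg n)
              + C * (1 / (BSP.lg p * BSP.lg n)
                  + g * ω ^ (3 / 2 : ℝ) * BSP.lg p / √(n * BSP.lg n)
                  + g / (ω * BSP.lg n ^ 2))} := by
  obtain ⟨n₀, hn₀⟩ := BSP.IRan.exists_large_admissible
  refine ⟨100, 0.1, by norm_num, by norm_num, n₀, ?_⟩
  intro n p ω L g hn hp hω hL hg h1 h2 h3 K _ X hX
  obtain ⟨hlarge, hlog⟩ := hn₀ n hn
  have hlgn : 0 < BSP.lg n :=
    Real.logb_pos (by norm_num) (by exact_mod_cast (show 1 < n by omega))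
  have h : BSP.IRan.Admissible n p ω := by
    refine ⟨hlarge, hlog, hp, hω, by linarith, ?_⟩
    rw [le_div_iff₀ (by positivity)] at h2
    linarith
  have hlp := h.one_le_lg_p
  have hp0 := h.p_pos
  have hn0 := h.pos
  have hLn : L * (p * BSP.lg p ^ 2) ≤ 2 * n := (le_div_iff₀ (by positivity)).1 h3
  have := hX.nonempty_draws h
  -- Outside the union of the two bad events, both ratio bounds hold with certainty, so they hold
  -- simultaneously with the stated probability.
  refine BSP.one_sub_le_uniformProb (F := {d | ∃ k, 4 * BSP.IRan.oversampling ω n ≤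
      (Finset.univ.filter fun i => (d i).1 = k).card} ∪
    {d | ∃ I : Set K, I.OrdConnected ∧
      {i | BSP.IRan.drawnKey X (d i) ∈ I}.ncard ≤ BSP.IRan.oversampling ω n ∧
      BSP.IRan.Admissible.span n p ω + BSP.IRan.Admissible.cell n p ω ≤
        {a | BSP.IRan.drawnKey X a ∈ I}.ncard}) ?_ ?_
  · refine le_trans (Nat.cast_le.2 (Set.ncard_union_le _ _)) ?_
    push_cast
    have a1 := hX.ncard_many_requests_le h
    have a2 := hX.ncard_long_interval_le h
    have a3 := mul_le_mul_of_nonneg_right h.tails_le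
      (Nat.cast_nonneg (α := ℝ) (Nat.card (BSP.IRan.Draws X (BSP.IRan.oversampling ω n))))
    linarith
  · intro d hd
    rw [Set.mem_union, not_or] at hd
    obtain ⟨hd1, hd2⟩ := hd
    have hR : ∀ k, (Finset.univ.filter fun i => (d i).1 = k).card ≤
        4 * BSP.IRan.oversampling ω n := by
      intro k
      by_contra! hlt
      exact hd1 ⟨k, hlt.le⟩
    have hB : ∀ I : Set K, I.OrdConnected →
        {i | BSP.IRan.drawnKey X (d i) ∈ I}.ncard ≤ BSP.IRan.oversampling ω n →
        {a | BSP.IRan.drawnKey X a ∈ I}.ncard ≤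
          BSP.IRan.Admissible.span n p ω + BSP.IRan.Admissible.cell n p ω := by
      intro I hI hs
      by_contra! hlt
      exact hd2 ⟨I, hI, hs, hlt.le⟩
    have hcost := BSP.IRan.cost_le d hp h.oversampling_pos
      (BSP.IRan.injective_drawnKey hX.distinct) (R := 4 * BSP.IRan.oversampling ω n)
      (by omega) hR hX.even h.ceilDiv_le_span_add_cell hB hL hg
    have hden : 0 ≤ (n : ℝ) * BSP.lg n := by positivity
    constructor
    · refine le_trans ?_ (h.comp_ratio_le h.span_add_cell_le)
      exact div_le_div_of_nonneg_right (mul_le_mul_of_nonneg_left hcost.1 (by positivity)) hden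
    · refine le_trans ?_ (h.comm_ratio_le h.span_add_cell_le hL hg hLn)
      exact div_le_div_of_nonneg_right (mul_le_mul_of_nonneg_left hcost.2 (by positivity)) hden
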